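/- **Setting.** Let $G=\mathrm{PGL}_2(\mathbb R)$ with a Haar measure $dg$, let $\Gamma\subset G$ be a discrete cocompact subgroup, $X=\Gamma\backslash G$, and let $\mu_X$ be the $G$-invariant probability measure on $X$. For $\tau\in\mathbb C$ let $V_\tau$ be the space of smooth functions on $\mathbb R^2\setminus 0$ with $f(ax)=|a|^{\tau-1}f(x)$ for $a\ne 0$, on which $G$ acts by $\pi_\tau(g)f(x)=f(g^{-1}x)\,|\det g|^{(\tau-1)/2}$. Consider $\tau\in i\mathbb R$ (principal series) or $\tau\in(-1,0)$ (complementary series; recall $V_\tau\cong V_{-\tau}$), so that $V_\tau$ has a $G$-invariant positive Hermitian form $P$, normalised so that the $\mathrm{PO}(2)$-invariant function equal to $1$ on the unit circle is a unit vector. A nontrivial class-one automorphic representation is such a $V_\tau$ together with a continuous linear $G$-morphism $\nu:V_\tau\to C^\infty(X)$ which carries the $L^2(X,\mu_X)$ Hermitian form to $P$. Let $(V_\tau,\nu)$ and $(V_{\tau'},\nu')$ be two of these. Their smooth completed tensor product $E$ is the space of smooth functions on $(\mathbb R^2\setminus0)^2$ homogeneous as $V_\tau$ in the first and as $V_{\tau'}$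 in the second variable; by restriction it is the space of smooth functions on $S^1\times S^1$ that are even in each variable. Let $\Pi$ be the natural action of $G\times G$ on $E$, and on forms let $(\Pi(g)H)(u)=H(\Pi(g)^{-1}u)$, $\Pi(h)H=\int_{G\times G}h(g)\,\Pi(g)H\,dg$. A positive functional on Hermitian forms on $E$ is an additive map $\rho$ from the cone of continuous nonnegative Hermitian forms on $E$ to $[0,\infty]$. Two kinds of forms are considered. * $H_\Delta(u)=\int_X|N(u)(x,x)|^2\,d\mu_X$, where $N$ is the continuous linear extension of $\nu\otimes\nu'$ from $V_\tau\otimes V_{\tau'}$ to $E$, with values in functions on $X\times X$. * For $\lambda\in i\mathbb R$, $H^{mod}_\lambda(u)=\frac1{2\pi}\int_0^{2\pi}|(T_\lambda u)(z)|^2\,dz$, where $$(T_\lambda u)(z)=\frac1{(2\pi)^{2}}\int_0^{2\pi}\!\!\int_0^{2\pi} u(x,y)\,|\sin(y-z)|^{\frac{\tau-\tau'-\lambda-1}2}\,|\sin(x-z)|^{\frac{-\tau+\tau'-\lambda-1}2}\,|\sin(x-y)|^{\frac{-\tau-\tau'+\lambda-1}2}\,dx\,dy$$ in angular coordinates on the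 circles. **Proposition.** There are a nonnegative function $h\in C_c^\infty(G\times G)$ and constants $C,c>0$, depending only on $\Gamma$ (and the choice of $dg$), such that the following holds for every two automorphic representations $(V_\tau,\nu)$, $(V_{\tau'},\nu')$ as above. The extension $N$ exists, $H_\Delta$ and all $H^{mod}_\lambda$ ($\lambda\in i\mathbb R$) are continuous nonnegative Hermitian forms on $E$, and there is $T_0>0$ such that for every $T\ge T_0$ there is a positive functional $\rho$ on Hermitian forms on $E$ with $$\rho(H_\Delta)\le C\,T^2,\qquad \rho(H^{mod}_\lambda)\ge c\quad\text{for all }\lambda\in i\mathbb R,\ |\lambda|\le 2T .$$ Moreover $\rho$ is of the form $\rho(H)=(\Pi(h)H)(u)$, where $u\in E$ is, as a function on $S^1\times S^1$, nonnegative, supported in the union of the images under $(x,y)\mapsto(\pm x,\pm y)$ of a disc of radius $(100T)^{-1}$, and satisfies $\int u\,dx\,dy=1$ and $\|u\|_{L^2}^2=\int|u|^2\,dx\,dy\le 10^5T^2$. -/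

import Mathlib

open MeasureTheory
open scoped ContDiff ENNReal ComplexConjugate

noncomputable section

namespace TripleProduct

/-! ## The group `G = PGL₂(ℝ)` -/

/-- `G = PGL₂(ℝ) = GL₂(ℝ) / center`, with the quotient topology and its Borel sets. -/
def PGL2R : Type := GL (Fin 2) ℝ ⧸ Subgroup.center (GL (Fin 2) ℝ)

namespace PGL2R

instance : Group PGL2R :=
  inferInstanceAs (Group (GL (Fin 2) ℝ ⧸ Subgroup.center (GL (Fin 2) ℝ)))

instance : TopologicalSpace PGL2R :=
  inferInstanceAs (TopologicalSpace (GL (Fin 2) ℝ ⧸ Subgroup.center (GL (Fin 2) ℝ)))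

instance : IsTopologicalGroup PGL2R :=
  inferInstanceAs (IsTopologicalGroup (GL (Fin 2) ℝ ⧸ Subgroup.center (GL (Fin 2) ℝ)))

instance : MeasurableSpace PGL2R := borel PGL2R

instance : BorelSpace PGL2R := ⟨rfl⟩

/-- The projection `GL₂(ℝ) → PGL₂(ℝ)`. -/
def mk : GL (Fin 2) ℝ →* PGL2R := QuotientGroup.mk' (Subgroup.center (GL (Fin 2) ℝ))

/-- A matrix representing an element of `PGL₂(ℝ)`. -/
def rep (g : PGL2R) : GL (Fin 2) ℝ := Quotient.out g

theorem mk_rep (g : PGL2R) : mk (rep g) = g := QuotientGroup.out_eq' g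

/-- Two matrices with the same class differ by a nonzero scalar. -/
theorem exists_smul_of_mk_eq {g h : GL (Fin 2) ℝ} (e : mk g = mk h) :
    ∃ a : ℝ, a ≠ 0 ∧ (g : Matrix (Fin 2) (Fin 2) ℝ) = a • (h : Matrix (Fin 2) (Fin 2) ℝ) := by
  have h1 : h⁻¹ * g ∈ Subgroup.center (GL (Fin 2) ℝ) := QuotientGroup.eq.mp e.symm
  obtain ⟨a, ha⟩ := Matrix.GeneralLinearGroup.mem_center_iff_val_mem_range_scalar.mp h1
  have h2 : (g : Matrix (Fin 2) (Fin 2) ℝ) = a • (h : Matrix (Fin 2) (Fin 2) ℝ) := by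
    have : (g : Matrix (Fin 2) (Fin 2) ℝ) = (h : Matrix (Fin 2) (Fin 2) ℝ) *
        ((h⁻¹ * g : GL (Fin 2) ℝ) : Matrix (Fin 2) (Fin 2) ℝ) := by
      rw [← Units.val_mul, mul_inv_cancel_left]
    rw [this, ← ha]
    ext i j
    simp [mul_comm]
  refine ⟨a, ?_, h2⟩
  rintro rfl
  have := (Matrix.GeneralLinearGroup.det g).ne_zero
  rw [Matrix.GeneralLinearGroup.val_det_apply, h2] at this
  simp at this

/-- The class in `PGL₂(ℝ)` of a matrix of nonzero determinant (and `1` for the other matrices). -/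
def ofMatrix (A : Fin 2 → Fin 2 → ℝ) : PGL2R :=
  open Classical in
  if h : (Matrix.of A).det ≠ 0 then mk (Matrix.GeneralLinearGroup.mkOfDetNeZero (Matrix.of A) h)
  else 1

/-- A function on `G` is smooth when its lift to the open set of invertible matrices is smooth. -/
def Smooth (f : PGL2R → ℂ) : Prop :=
  ContDiffOn ℝ ∞ (fun A : Fin 2 → Fin 2 → ℝ => f (ofMatrix A)) {A | (Matrix.of A).det ≠ 0}

/-- Smooth real functions on `G × G`. -/
def Smooth₂ (f : PGL2R × PGL2R → ℝ) : Prop :=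
  ContDiffOn ℝ ∞
    (fun A : (Fin 2 → Fin 2 → ℝ) × (Fin 2 → Fin 2 → ℝ) => f (ofMatrix A.1, ofMatrix A.2))
    {A | (Matrix.of A.1).det ≠ 0 ∧ (Matrix.of A.2).det ≠ 0}

end PGL2R

/-! ## The automorphic space `X = Γ \ G` -/

/-- `X = Γ \ G`, the space of cosets `Γ g`. -/
def AutSpace (Γ : Subgroup PGL2R) : Type := Quotient (QuotientGroup.rightRel Γ)

namespace AutSpace

variable {Γ : Subgroup PGL2R}

instance : TopologicalSpace (AutSpace Γ) :=
  inferInstanceAs (TopologicalSpace (Quotient (QuotientGroup.rightRel Γ)))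

instance : MeasurableSpace (AutSpace Γ) := borel (AutSpace Γ)

instance : BorelSpace (AutSpace Γ) := ⟨rfl⟩

/-- The coset `Γ g`. -/
def mk (Γ : Subgroup PGL2R) (g : PGL2R) : AutSpace Γ := Quotient.mk _ g

/-- The right action of `G` on `X`: `Γ x ↦ Γ x g`. -/
def translate (g : PGL2R) : AutSpace Γ → AutSpace Γ :=
  Quotient.map (fun x => x * g) (fun a b hab => by
    change QuotientGroup.rightRel Γ a b at hab
    change QuotientGroup.rightRel Γ (a * g) (b * g)
    rw [QuotientGroup.rightRel_apply] at hab ⊢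
    simpa [mul_assoc] using hab)

theorem translate_mk (g x : PGL2R) : translate g (mk Γ x) = mk Γ (x * g) := rfl

/-- Smooth functions on `X`: those whose lift to `G` is smooth. -/
def Smooth (f : AutSpace Γ → ℂ) : Prop := PGL2R.Smooth (fun g => f (mk Γ g))

end AutSpace

/-! ## The representations `V_τ` of `G` -/

/-- The plane `ℝ²`. -/
abbrev Plane : Type := Fin 2 → ℝ

/-- The point of the unit circle with angular parameter `θ`. -/
def circ (θ : ℝ) : Plane := ![Real.cos θ, Real.sin θ]

/-- The complex power `|r| ^ s` of the absolute value of a real number. -/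
def absPow (r : ℝ) (s : ℂ) : ℂ := ((|r| : ℝ) : ℂ) ^ s

theorem absPow_mul (r r' : ℝ) (s : ℂ) : absPow (r * r') s = absPow r s * absPow r' s := by
  unfold absPow
  rw [abs_mul, Complex.ofReal_mul, Complex.mul_cpow_ofReal_nonneg (abs_nonneg r) (abs_nonneg r')]

theorem absPow_inv_mul {a : ℝ} (ha : a ≠ 0) (s : ℂ) : absPow a⁻¹ s * absPow a s = 1 := by
  rw [← absPow_mul, inv_mul_cancel₀ ha]
  simp [absPow]

theorem absPow_sq_half {a : ℝ} (ha : a ≠ 0) (s : ℂ) : absPow (a ^ 2) (s / 2) = absPow a s := by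
  have h : (((|a|) : ℝ) : ℂ) ≠ 0 := by simpa using ha
  rw [pow_two, absPow_mul]
  unfold absPow
  rw [← Complex.cpow_add _ _ h, add_halves]

/-- `V_τ`: the smooth functions `f` on `ℝ² \ 0` with `f (a x) = |a| ^ (τ - 1) f x` for all `a ≠ 0`.
The value at the origin, which plays no role, is set to `0`. -/
def V (τ : ℂ) : Submodule ℂ (Plane → ℂ) where
  carrier := {f | f 0 = 0 ∧ (∀ a : ℝ, a ≠ 0 → ∀ x, f (a • x) = absPow a (τ - 1) * f x) ∧
    ContDiffOn ℝ ∞ f {x | x ≠ 0}}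
  add_mem' := by
    rintro f g ⟨hf0, hf, hf'⟩ ⟨hg0, hg, hg'⟩
    refine ⟨by simp [hf0, hg0], fun a ha x => ?_, hf'.add hg'⟩
    simp only [Pi.add_apply, hf a ha x, hg a ha x]
    ring
  zero_mem' := ⟨rfl, by simp, contDiffOn_const⟩
  smul_mem' := by
    rintro c f ⟨hf0, hf, hf'⟩
    refine ⟨by simp [hf0], fun a ha x => ?_, contDiffOn_const.smul hf'⟩
    simp only [Pi.smul_apply, smul_eq_mul, hf a ha x]
    ring

/-- The linear action of `GL₂(ℝ)` on the plane has no kernel. -/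
theorem mulVec_ne_zero (g : GL (Fin 2) ℝ) {x : Plane} (hx : x ≠ 0) :
    (g : Matrix (Fin 2) (Fin 2) ℝ).mulVec x ≠ 0 := by
  intro h
  apply hx
  have : ((g⁻¹ : GL (Fin 2) ℝ) : Matrix (Fin 2) (Fin 2) ℝ).mulVec
      ((g : Matrix (Fin 2) (Fin 2) ℝ).mulVec x) = x := by
    rw [Matrix.mulVec_mulVec, ← Units.val_mul, inv_mul_cancel]
    simp
  rw [← this, h, Matrix.mulVec_zero]

theorem contDiff_mulVec (A : Matrix (Fin 2) (Fin 2) ℝ) :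
    ContDiff ℝ ∞ (fun x : Plane => A.mulVec x) :=
  (LinearMap.toContinuousLinearMap (Matrix.mulVecLin A)).contDiff

/-- The action `π_τ(g) f (x) = f (g⁻¹ x) |det g| ^ ((τ - 1) / 2)` of `g ∈ GL₂(ℝ)` on `V_τ`. -/
def V.act {τ : ℂ} (g : GL (Fin 2) ℝ) (f : V τ) : V τ :=
  ⟨fun x => f.1 (((g⁻¹ : GL (Fin 2) ℝ) : Matrix (Fin 2) (Fin 2) ℝ).mulVec x) *
      absPow (g : Matrix (Fin 2) (Fin 2) ℝ).det ((τ - 1) / 2), by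
    obtain ⟨f, hf0, hf, hf'⟩ := f
    refine ⟨by simp [hf0], fun a ha x => ?_, ?_⟩
    · simp only [Matrix.mulVec_smul, hf a ha]
      ring
    · exact (hf'.comp (contDiff_mulVec _).contDiffOn
        (fun x hx => mulVec_ne_zero g⁻¹ hx)).mul contDiffOn_const⟩

/-- The restriction of `f ∈ V_τ` to the unit circle, as a function of the angular parameter. -/
def V.onCircle {τ : ℂ} (f : V τ) (θ : ℝ) : ℂ := f.1 (circ θ)

/-- The parameters of the principal series (`τ ∈ iℝ`) and of the complementary series.  As
`V_τ ≅ V_{-τ}`, the complementary series is parametrised by `τ ∈ (-1, 0)`. -/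
def IsClassOneParam (τ : ℂ) : Prop := τ.re = 0 ∨ (τ.im = 0 ∧ -1 < τ.re ∧ τ.re < 0)

/-- The square `[0, 2π] × [0, 2π]` of angular parameters on `S¹ × S¹`. -/
def square : Set (ℝ × ℝ) := Set.Icc 0 (2 * Real.pi) ×ˢ Set.Icc 0 (2 * Real.pi)

/-- The invariant Hermitian form `P(f)` on `V_τ`, normalised so that the function that is `1` on
the unit circle is a unit vector.  For `τ ∈ iℝ` it is `(2π)⁻¹ ∫ |f|²`; for `τ ∈ (-1, 0)` it is the
double integral of `f(x) conj f(y)` against the kernel `|sin (x - y)| ^ (-1 - τ)`, divided by the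
integral of the kernel. -/
def V.normSq {τ : ℂ} (f : V τ) : ℝ :=
  open Classical in
  if τ.re = 0 then (2 * Real.pi)⁻¹ * ∫ θ in Set.Icc 0 (2 * Real.pi), ‖V.onCircle f θ‖ ^ 2
  else (∫ p in square, (V.onCircle f p.1 * conj (V.onCircle f p.2)).re *
      |Real.sin (p.1 - p.2)| ^ (-1 - τ.re)) /
    ∫ p in square, |Real.sin (p.1 - p.2)| ^ (-1 - τ.re)

/-! ## `X`-enhanced representations -/

/-- A normalised `X`-enhancement of `V_τ`: a continuous linear `G`-morphism `ν : V_τ → C^∞(X)`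
carrying the `L²` form of `X` to the invariant Hermitian form of `V_τ`. -/
structure EnhancedRep {Γ : Subgroup PGL2R} (μ : Measure (AutSpace Γ)) (τ : ℂ) where
  ν : V τ →ₗ[ℂ] (AutSpace Γ → ℂ)
  smooth : ∀ v, AutSpace.Smooth (ν v)
  equivariant : ∀ (g : GL (Fin 2) ℝ) v x,
    ν (V.act g v) x = ν v (AutSpace.translate (PGL2R.mk g) x)
  isometric : ∀ v, ∫ x, ‖ν v x‖ ^ 2 ∂μ = V.normSq v
  continuous : ∃ (k : ℕ) (C : ℝ), ∀ (v : V τ) (M : ℝ),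
    (∀ j ≤ k, ∀ θ, ‖iteratedDeriv j (V.onCircle v) θ‖ ≤ M) → ∀ x, ‖ν v x‖ ≤ C * M

/-! ## The space `E`, the smooth completion of `V_τ ⊗ V_τ'` -/

/-- `E`: the smooth functions on `(ℝ² \ 0) × (ℝ² \ 0)`, homogeneous as `V_τ` in the first variable
and as `V_τ'` in the second.  Restriction to the circles identifies it with the smooth functions on
`S¹ × S¹` that are even in each variable. -/
def E (τ τ' : ℂ) : Submodule ℂ (Plane → Plane → ℂ) where
  carrier := {u | (∀ x y, x = 0 ∨ y = 0 → u x y = 0) ∧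
    (∀ a : ℝ, a ≠ 0 → ∀ x y, u (a • x) y = absPow a (τ - 1) * u x y) ∧
    (∀ a : ℝ, a ≠ 0 → ∀ x y, u x (a • y) = absPow a (τ' - 1) * u x y) ∧
    ContDiffOn ℝ ∞ (fun p : Plane × Plane => u p.1 p.2) {p | p.1 ≠ 0 ∧ p.2 ≠ 0}}
  add_mem' := by
    rintro f g ⟨hf0, hf1, hf2, hf⟩ ⟨hg0, hg1, hg2, hg⟩
    refine ⟨fun x y h => by simp [hf0 x y h, hg0 x y h], fun a ha x y => ?_,
      fun a ha x y => ?_, hf.add hg⟩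
    · simp only [Pi.add_apply, hf1 a ha x y, hg1 a ha x y]
      ring
    · simp only [Pi.add_apply, hf2 a ha x y, hg2 a ha x y]
      ring
  zero_mem' := ⟨by simp, by simp, by simp, contDiffOn_const⟩
  smul_mem' := by
    rintro c f ⟨hf0, hf1, hf2, hf⟩
    refine ⟨fun x y h => by simp [hf0 x y h], fun a ha x y => ?_,
      fun a ha x y => ?_, (contDiffOn_const (c := c)).mul hf⟩
    · simp only [Pi.smul_apply, smul_eq_mul, hf1 a ha x y]
      ring
    · simp only [Pi.smul_apply, smul_eq_mul, hf2 a ha x y]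
      ring

namespace E

variable {τ τ' : ℂ}

/-- The restriction of `u ∈ E` to the product of the unit circles. -/
def onTorus (u : E τ τ') (p : ℝ × ℝ) : ℂ := u.1 (circ p.1) (circ p.2)

/-- The pure tensor `v ⊗ v'`. -/
def tmul (v : V τ) (v' : V τ') : E τ τ' :=
  ⟨fun x y => v.1 x * v'.1 y, by
    obtain ⟨v, hv0, hv, hv'⟩ := v
    obtain ⟨w, hw0, hw, hw'⟩ := v'
    refine ⟨?_, fun a ha x y => ?_, fun a ha x y => ?_, ?_⟩
    · rintro x y (rfl | rfl)
      · simp [hv0]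
      · simp [hw0]
    · simp only [hv a ha x]
      ring
    · simp only [hw a ha y]
      ring
    · exact (hv'.comp contDiff_fst.contDiffOn (fun p hp => hp.1)).mul
        (hw'.comp contDiff_snd.contDiffOn (fun p hp => hp.2))⟩

/-- The action of a pair of invertible matrices on `E`, the product of the two actions. -/
def actGL (g g' : GL (Fin 2) ℝ) (u : E τ τ') : E τ τ' :=
  ⟨fun x y => u.1 (((g⁻¹ : GL (Fin 2) ℝ) : Matrix (Fin 2) (Fin 2) ℝ).mulVec x)
      (((g'⁻¹ : GL (Fin 2) ℝ) : Matrix (Fin 2) (Fin 2) ℝ).mulVec y) *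
      (absPow (g : Matrix (Fin 2) (Fin 2) ℝ).det ((τ - 1) / 2) *
        absPow (g' : Matrix (Fin 2) (Fin 2) ℝ).det ((τ' - 1) / 2)), by
    obtain ⟨u, hu0, hu1, hu2, hu⟩ := u
    refine ⟨?_, fun a ha x y => ?_, fun a ha x y => ?_, ?_⟩
    · rintro x y (rfl | rfl)
      · simp [hu0]
      · simp [hu0]
    · simp only [Matrix.mulVec_smul, hu1 a ha]
      ring
    · simp only [Matrix.mulVec_smul, hu2 a ha]
      ring
    · refine ContDiffOn.mul ?_ contDiffOn_const
      exact hu.comp (((contDiff_mulVec _).comp contDiff_fst).prodMk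
        ((contDiff_mulVec _).comp contDiff_snd)).contDiffOn
        (fun p hp => ⟨mulVec_ne_zero g⁻¹ hp.1, mulVec_ne_zero g'⁻¹ hp.2⟩)⟩

/-- The representation `Π` of `G × G` on `E`. -/
def act (g : PGL2R × PGL2R) (u : E τ τ') : E τ τ' := actGL g.1.rep g.2.rep u

end E

theorem inv_eq_of_eq_smul {g h : GL (Fin 2) ℝ} {a : ℝ} (ha : a ≠ 0)
    (e : (g : Matrix (Fin 2) (Fin 2) ℝ) = a • (h : Matrix (Fin 2) (Fin 2) ℝ)) :
    ((g⁻¹ : GL (Fin 2) ℝ) : Matrix (Fin 2) (Fin 2) ℝ) =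
      a⁻¹ • ((h⁻¹ : GL (Fin 2) ℝ) : Matrix (Fin 2) (Fin 2) ℝ) := by
  have h1 : (g : Matrix (Fin 2) (Fin 2) ℝ) *
      (a⁻¹ • ((h⁻¹ : GL (Fin 2) ℝ) : Matrix (Fin 2) (Fin 2) ℝ)) = 1 := by
    rw [e, Matrix.smul_mul, Matrix.mul_smul, smul_smul, mul_inv_cancel₀ ha, one_smul,
      ← Units.val_mul, mul_inv_cancel, Units.val_one]
  have h2 : ((g⁻¹ : GL (Fin 2) ℝ) : Matrix (Fin 2) (Fin 2) ℝ) * (g : Matrix (Fin 2) (Fin 2) ℝ)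
      = 1 := by
    rw [← Units.val_mul, inv_mul_cancel, Units.val_one]
  exact left_inv_eq_right_inv h2 h1

theorem absPow_det_of_eq_smul {g h : GL (Fin 2) ℝ} {a : ℝ} (ha : a ≠ 0)
    (e : (g : Matrix (Fin 2) (Fin 2) ℝ) = a • (h : Matrix (Fin 2) (Fin 2) ℝ)) (s : ℂ) :
    absPow (g : Matrix (Fin 2) (Fin 2) ℝ).det (s / 2) =
      absPow a s * absPow (h : Matrix (Fin 2) (Fin 2) ℝ).det (s / 2) := by
  rw [e, Matrix.det_smul, Fintype.card_fin, absPow_mul, absPow_sq_half ha]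

/-- The action of `G × G` on `E` does not depend on the matrices chosen to compute it. -/
theorem E.act_mk {τ τ' : ℂ} (g g' : GL (Fin 2) ℝ) (u : E τ τ') :
    E.act (PGL2R.mk g, PGL2R.mk g') u = E.actGL g g' u := by
  obtain ⟨a, ha, ea⟩ := PGL2R.exists_smul_of_mk_eq (PGL2R.mk_rep (PGL2R.mk g))
  obtain ⟨b, hb, eb⟩ := PGL2R.exists_smul_of_mk_eq (PGL2R.mk_rep (PGL2R.mk g'))
  apply Subtype.ext
  funext x y
  obtain ⟨u, hu0, hu1, hu2, hu⟩ := u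
  simp only [E.act, E.actGL, inv_eq_of_eq_smul ha ea, inv_eq_of_eq_smul hb eb,
    absPow_det_of_eq_smul ha ea, absPow_det_of_eq_smul hb eb, Matrix.smul_mulVec,
    hu1 _ (inv_ne_zero ha), hu2 _ (inv_ne_zero hb)]
  have h1 := absPow_inv_mul ha (τ - 1)
  have h2 := absPow_inv_mul hb (τ' - 1)
  linear_combination (absPow b⁻¹ (τ' - 1) * absPow b (τ' - 1) *
      (u ((↑g⁻¹ : Matrix (Fin 2) (Fin 2) ℝ).mulVec x) ((↑g'⁻¹ : Matrix (Fin 2) (Fin 2) ℝ).mulVec y) *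
      (absPow (g : Matrix (Fin 2) (Fin 2) ℝ).det ((τ - 1) / 2) *
        absPow (g' : Matrix (Fin 2) (Fin 2) ℝ).det ((τ' - 1) / 2)))) * h1 +
    (u ((↑g⁻¹ : Matrix (Fin 2) (Fin 2) ℝ).mulVec x) ((↑g'⁻¹ : Matrix (Fin 2) (Fin 2) ℝ).mulVec y) *
      (absPow (g : Matrix (Fin 2) (Fin 2) ℝ).det ((τ - 1) / 2) *
        absPow (g' : Matrix (Fin 2) (Fin 2) ℝ).det ((τ' - 1) / 2))) * h2

/-! ## Hermitian forms on `E` -/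

/-- `q` is bounded by a multiple of the square of a `C^k` norm. -/
def IsSobolevBounded {τ τ' : ℂ} (q : E τ τ' → ℝ) : Prop :=
  ∃ (k : ℕ) (C : ℝ), ∀ (u : E τ τ') (M : ℝ),
    (∀ j ≤ k, ∀ p, ‖iteratedFDeriv ℝ j (E.onTorus u) p‖ ≤ M) → q u ≤ C * M ^ 2

/-- `q` is the quadratic function `u ↦ B(u, u)` of a Hermitian form `B`. -/
def IsHermitianQuad {τ τ' : ℂ} (q : E τ τ' → ℝ) : Prop :=
  ∃ B : E τ τ' →ₗ⋆[ℂ] E τ τ' →ₗ[ℂ] ℂ, (∀ u v, B v u = conj (B u v)) ∧ ∀ u, (q u : ℂ) = B u u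

/-- The cone of nonnegative continuous Hermitian forms on `E` (for the `C^∞` topology); a form `H`
is represented by its quadratic function `u ↦ H(u)`, which determines it. -/
def hermCone (τ τ' : ℂ) : AddSubmonoid (E τ τ' → ℝ) where
  carrier := {q | IsHermitianQuad q ∧ (∀ u, 0 ≤ q u) ∧ IsSobolevBounded q}
  zero_mem' := ⟨⟨0, by simp, by simp⟩, by simp, ⟨0, 0, by simp⟩⟩
  add_mem' := by
    rintro q r ⟨⟨B, hB, hqB⟩, hq, k, C, hC⟩ ⟨⟨B', hB', hrB⟩, hr, k', C', hC'⟩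
    refine ⟨⟨B + B', fun u v => ?_, fun u => ?_⟩, fun u => add_nonneg (hq u) (hr u),
      max k k', C + C', fun u M h => ?_⟩
    · simp [hB u v, hB' u v]
    · simp [hqB u, hrB u]
    · have h1 := hC u M (fun j hj => h j (hj.trans (le_max_left _ _)))
      have h2 := hC' u M (fun j hj => h j (hj.trans (le_max_right _ _)))
      simp only [Pi.add_apply]
      linarith

/-- A positive functional on the Hermitian forms on `E`: an additive map from the cone of
nonnegative forms to `[0, ∞]`. -/
abbrev PositiveFunctional (τ τ' : ℂ) : Type := hermCone τ τ' →+ ℝ≥0∞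

/-! ## The diagonal form -/

/-- `N` is the realisation of `E` in functions on `X × X`, that is, the continuous linear extension
of `ν ⊗ ν'` from `V_τ ⊗ V_τ'` to `E`.  As `V_τ ⊗ V_τ'` is dense in `E`, there is at most one. -/
structure IsRealisation {Γ : Subgroup PGL2R} {μ : Measure (AutSpace Γ)} {τ τ' : ℂ}
    (ν : EnhancedRep μ τ) (ν' : EnhancedRep μ τ')
    (N : E τ τ' →ₗ[ℂ] (AutSpace Γ × AutSpace Γ → ℂ)) : Prop where
  tmul : ∀ v v' x x', N (E.tmul v v') (x, x') = ν.ν v x * ν'.ν v' x'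
  continuous : ∃ (k : ℕ) (C : ℝ), ∀ (u : E τ τ') (M : ℝ),
    (∀ j ≤ k, ∀ p, ‖iteratedFDeriv ℝ j (E.onTorus u) p‖ ≤ M) → ∀ x, ‖N u x‖ ≤ C * M

/-- The diagonal form `H_Δ(u) = ∫_X |u(x, x)|² dμ` on `E`, realised in functions on `X × X`. -/
def diagForm {Γ : Subgroup PGL2R} (μ : Measure (AutSpace Γ)) {τ τ' : ℂ}
    (N : E τ τ' →ₗ[ℂ] (AutSpace Γ × AutSpace Γ → ℂ)) (u : E τ τ') : ℝ :=
  ∫ x, ‖N u (x, x)‖ ^ 2 ∂μ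

/-! ## The model form -/

/-- The invariant `ω(ξ, η) = ξ₁ η₂ - ξ₂ η₁`. -/
def omega (ξ η : Plane) : ℝ := ξ 0 * η 1 - ξ 1 * η 0

/-- The kernel of the model trilinear functional on `V_{l₁} ⊗ V_{l₂} ⊗ V_{l₃}`. -/
def modKernel (l₁ l₂ l₃ : ℂ) (s₁ s₂ s₃ : Plane) : ℂ :=
  absPow (omega s₂ s₃) ((l₁ - l₂ - l₃ - 1) / 2) *
    absPow (omega s₁ s₃) ((-l₁ + l₂ - l₃ - 1) / 2) *
    absPow (omega s₁ s₂) ((-l₁ - l₂ + l₃ - 1) / 2)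

/-- The operator `T : E → conj V_lam` of the model functional, in the circle model: the functional
is `u ⊗ w ↦ (2π)⁻¹ ∫ (T u)(z) w(z) dz`. -/
def modOp {τ τ' : ℂ} (lam : ℂ) (u : E τ τ') (z : ℝ) : ℂ :=
  (((2 * Real.pi) ^ 2)⁻¹ : ℝ) *
    ∫ p in square, E.onTorus u p * modKernel τ τ' lam (circ p.1) (circ p.2) (circ z)

/-- The form `H^mod_lam(u) = ‖T u‖²` for `lam ∈ iℝ`. -/
def modForm (τ τ' lam : ℂ) (u : E τ τ') : ℝ :=
  (2 * Real.pi)⁻¹ * ∫ z in Set.Icc 0 (2 * Real.pi), ‖modOp lam u z‖ ^ 2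

/-! ## Bump vectors and the functionals they define -/

/-- `u` is a bump vector at scale `1 / T`: on `S¹ × S¹` it is a nonnegative function, supported in
the images under `(x, y) ↦ (± x, ± y)` of a disc of radius `1 / (100 T)`, with `∫ u = 1` and
`‖u‖² ≤ 10⁵ T²` in `L²`. -/
structure IsBump {τ τ' : ℂ} (T : ℝ) (u : E τ τ') : Prop where
  nonneg : ∀ p, ∃ r : ℝ, 0 ≤ r ∧ E.onTorus u p = r
  support : ∃ c : ℝ × ℝ, ∀ p, E.onTorus u p ≠ 0 → ∃ m n : ℤ,
    (p.1 - c.1 - m * Real.pi) ^ 2 + (p.2 - c.2 - n * Real.pi) ^ 2 ≤ ((100 * T)⁻¹) ^ 2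
  integral_eq : ∫ p in square, E.onTorus u p = 1
  norm_le : ∫ p in square, ‖E.onTorus u p‖ ^ 2 ≤ 10 ^ 5 * T ^ 2

/-- The value at `q` of the functional `H ↦ (Π(h) H)(u) = ∫ h(g) H(Π(g)⁻¹ u) dg` on forms, where
`dg` is the measure `m × m` on `G × G`. -/
def smoothedValue (m : Measure PGL2R) (h : PGL2R × PGL2R → ℝ) {τ τ' : ℂ} (u : E τ τ')
    (q : E τ τ' → ℝ) : ℝ≥0∞ :=
  ∫⁻ g, ENNReal.ofReal (h g * q (E.act g⁻¹ u)) ∂(m.prod m)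

end TripleProduct

end

open TripleProduct

/-!
The smoothing function is a fixed product `bump₂` of two bumps around the identity of `PGL₂(ℝ)`, and
`u = bumpVector` is a normalised product of two caps of angular size comparable with `1 / T`, one
around each of the two coordinate lines of the plane.

**The realisation.**  The extension `N` of `ν ⊗ ν'` is built without completing tensor products: `ν`
is applied to the slices `u (·, y)` with `x ∈ X` fixed, which gives, as a function of `y`, an element
of `V_τ'`, and then `ν'` is applied to it.  Smoothness in `y` (`E.fiber`) follows from the continuity
of `ν` by a Taylor expansion of the slices in the angle.

**Upper bound for the diagonal form.**  Averaging over a compact set of pairs `(g, g')` moves the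
diagonal point `(x, x)` to `(x g, x g')`, so that the average of `|N(u)|²` over the diagonal is at
most a constant times its average over `X × X`.  This uses that `X` is compact and that its measure
is invariant.  On `X × X` the realisation is isometric in each variable separately, and the invariant
form of `V_τ` is bounded by the `L²` norm on the circle (`V.normSq_le`; for the complementary series
this is Schur's test).  Hence `ρ(H_Δ)` is at most a constant times `‖u‖²`, which is `O(T²)`
(`exists_smoothedValue_diagForm_le`).

**The model forms.**  The exponents of the model kernel are such that the kernel is absolutely
integrable in the first two variables, uniformly in the third one; this is a weighted
arithmetic-geometric mean inequality at the point where the three factors are all singular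
(`exists_kernelMajorant`).  Hence the model forms are continuous.

**Lower bound for the model forms.**  Let `g` be close to the identity, and let the third variable
`z` stay away from the two lines.  On the support of the transform of `u` the three arguments of the
powers in the kernel are, up to scale factors which contribute no phase by homogeneity, at distance
`O(1 / T)` from their values at the centre of the bump, and bounded away from `0`.  The imaginary
parts of the exponents are `O(T)` when `|λ| ≤ 2 T`, and the constants are such that the phase of the
integrand varies by less than `1` (`exp_le_re_cexp_trilinear`, `exists_phase`).  There is therefore
no cancellation in the integral, which is bounded below because the mass of the transforms of `u`
is comparable with `∫ u = 1` (`setIntegral_lineCap_mulVec_ge`); see `modLower_le_modForm`.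
-/

noncomputable section

namespace TripleProduct

/-! ### Topology of `PGL₂(ℝ)` and of `Γ \ G` -/

namespace PGL2R

theorem isOpenQuotientMap_mk : IsOpenQuotientMap mk where
  surjective := QuotientGroup.mk'_surjective _
  continuous := continuous_quotient_mk'
  isOpenMap := QuotientGroup.isOpenMap_coe

theorem continuous_mk : Continuous mk := isOpenQuotientMap_mk.continuous

theorem isEmbedding_coe_GL :
    Topology.IsEmbedding (Units.val : GL (Fin 2) ℝ → Matrix (Fin 2) (Fin 2) ℝ) := by
  refine Units.isEmbedding_val_mk' (f := fun A => A⁻¹) ?_ ?_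
  · intro A hA
    have h1 : A.det ≠ 0 := by
      have : IsUnit A := hA
      exact ((Matrix.isUnit_iff_isUnit_det A).1 this).ne_zero
    refine ContinuousAt.continuousWithinAt ?_
    have : ContinuousAt (fun A : Matrix (Fin 2) (Fin 2) ℝ => (A.det)⁻¹ • A.adjugate) A :=
      ((Continuous.matrix_det continuous_id).continuousAt.inv₀ h1).smul
        (Continuous.matrix_adjugate continuous_id).continuousAt
    simpa [Matrix.inv_def] using this
  · intro u
    exact (Matrix.coe_units_inv u).symm

theorem range_coe_GL :
    Set.range (Units.val : GL (Fin 2) ℝ → Matrix (Fin 2) (Fin 2) ℝ) = {A | A.det ≠ 0} := by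
  ext A
  constructor
  · rintro ⟨g, rfl⟩
    exact ((Matrix.isUnit_iff_isUnit_det _).1 g.isUnit).ne_zero
  · intro h
    exact ⟨Matrix.GeneralLinearGroup.mkOfDetNeZero A h, rfl⟩

theorem isOpen_det_ne_zero : IsOpen {A : Matrix (Fin 2) (Fin 2) ℝ | A.det ≠ 0} :=
  isOpen_ne_fun (Continuous.matrix_det continuous_id) continuous_const

theorem isOpenEmbedding_coe_GL :
    Topology.IsOpenEmbedding (Units.val : GL (Fin 2) ℝ → Matrix (Fin 2) (Fin 2) ℝ) :=
  ⟨isEmbedding_coe_GL, by rw [range_coe_GL]; exact isOpen_det_ne_zero⟩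

instance : LocallyCompactSpace (GL (Fin 2) ℝ) :=
  haveI : LocallyCompactSpace (Matrix (Fin 2) (Fin 2) ℝ) :=
    inferInstanceAs (LocallyCompactSpace (Fin 2 → Fin 2 → ℝ))
  isOpenEmbedding_coe_GL.locallyCompactSpace

instance : SecondCountableTopology (GL (Fin 2) ℝ) :=
  haveI : SecondCountableTopology (Matrix (Fin 2) (Fin 2) ℝ) :=
    inferInstanceAs (SecondCountableTopology (Fin 2 → Fin 2 → ℝ))
  isEmbedding_coe_GL.secondCountableTopology

instance : LocallyCompactSpace PGL2R :=
  inferInstanceAs (LocallyCompactSpace (GL (Fin 2) ℝ ⧸ Subgroup.center (GL (Fin 2) ℝ)))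

instance : SecondCountableTopology PGL2R :=
  isOpenQuotientMap_mk.isQuotientMap.secondCountableTopology isOpenQuotientMap_mk.isOpenMap

theorem isClosed_center : IsClosed (Subgroup.center (GL (Fin 2) ℝ) : Set (GL (Fin 2) ℝ)) := by
  have : (Subgroup.center (GL (Fin 2) ℝ) : Set (GL (Fin 2) ℝ)) =
      ⋂ h : GL (Fin 2) ℝ, {g | h * g = g * h} := by
    ext g
    simp [Subgroup.mem_center_iff]
  rw [this]
  exact isClosed_iInter fun h => isClosed_eq (by fun_prop) (by fun_prop)

instance : T2Space PGL2R :=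
  haveI := isClosed_center
  inferInstanceAs (T2Space (GL (Fin 2) ℝ ⧸ Subgroup.center (GL (Fin 2) ℝ)))

theorem ofMatrix_coe (g : GL (Fin 2) ℝ) : ofMatrix (g : Matrix (Fin 2) (Fin 2) ℝ) = mk g := by
  have h : (Matrix.of (g : Matrix (Fin 2) (Fin 2) ℝ)).det ≠ 0 :=
    ((Matrix.isUnit_iff_isUnit_det _).1 g.isUnit).ne_zero
  unfold ofMatrix
  rw [dif_pos h]
  congr 1
  ext i j
  rfl

theorem Smooth.continuous {f : PGL2R → ℂ} (hf : Smooth f) : Continuous f := by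
  rw [isOpenQuotientMap_mk.isQuotientMap.continuous_iff]
  have h1 : (f ∘ mk) = fun g : GL (Fin 2) ℝ =>
      (fun A : Fin 2 → Fin 2 → ℝ => f (ofMatrix A)) (g : Matrix (Fin 2) (Fin 2) ℝ) := by
    funext g
    simp [ofMatrix_coe]
  rw [h1]
  have h2 : ContinuousOn (fun A : Fin 2 → Fin 2 → ℝ => f (ofMatrix A))
      {A | (Matrix.of A).det ≠ 0} :=
    ContDiffOn.continuousOn hf
  have h3 : Continuous fun g : GL (Fin 2) ℝ =>
      ((g : Matrix (Fin 2) (Fin 2) ℝ) : Fin 2 → Fin 2 → ℝ) :=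
    Units.continuous_val
  exact h2.comp_continuous h3
    (fun g => ((Matrix.isUnit_iff_isUnit_det _).1 g.isUnit).ne_zero)

end PGL2R

namespace AutSpace

variable {Γ : Subgroup PGL2R}

theorem isOpenQuotientMap_mk : IsOpenQuotientMap (mk Γ) where
  surjective := Quotient.mk_surjective
  continuous := continuous_quotient_mk'
  isOpenMap := by
    intro U hU
    have h1 : IsOpen (mk Γ ⁻¹' (mk Γ '' U)) := by
      have : mk Γ ⁻¹' (mk Γ '' U) = ⋃ γ : Γ, (fun g => (γ : PGL2R) * g) ⁻¹' U := by
        ext g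
        simp only [Set.mem_preimage, Set.mem_image, Set.mem_iUnion]
        constructor
        · rintro ⟨y, hy, e⟩
          have : QuotientGroup.rightRel Γ y g := Quotient.exact e
          rw [QuotientGroup.rightRel_apply] at this
          refine ⟨⟨_, inv_mem this⟩, ?_⟩
          simpa using hy
        · rintro ⟨γ, hγ⟩
          refine ⟨_, hγ, Quotient.sound ?_⟩
          change QuotientGroup.rightRel Γ _ _
          rw [QuotientGroup.rightRel_apply]
          simp
      rw [this]
      exact isOpen_iUnion fun γ => hU.preimage (continuous_const_mul _)
    exact h1

theorem surjective_mk : Function.Surjective (mk Γ) := isOpenQuotientMap_mk.surjective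

instance : SecondCountableTopology (AutSpace Γ) :=
  (isOpenQuotientMap_mk (Γ := Γ)).isQuotientMap.secondCountableTopology
    isOpenQuotientMap_mk.isOpenMap

theorem continuous_translate :
    Continuous fun p : AutSpace Γ × PGL2R => translate p.2 p.1 := by
  have h := (isOpenQuotientMap_mk (Γ := Γ)).prodMap (IsOpenQuotientMap.id (X := PGL2R))
  rw [h.isQuotientMap.continuous_iff]
  have : (fun p : AutSpace Γ × PGL2R => translate p.2 p.1) ∘ Prod.map (mk Γ) id =
      fun p : PGL2R × PGL2R => mk Γ (p.1 * p.2) := rfl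
  rw [this]
  exact isOpenQuotientMap_mk.continuous.comp continuous_mul

theorem continuous_translate_right (g : PGL2R) :
    Continuous (translate g : AutSpace Γ → AutSpace Γ) :=
  continuous_translate.comp (continuous_id.prodMk continuous_const)

theorem translate_translate (g h : PGL2R) (x : AutSpace Γ) :
    translate h (translate g x) = translate (g * h) x := by
  obtain ⟨y, rfl⟩ := surjective_mk x
  simp [translate_mk, mul_assoc]

theorem translate_one (x : AutSpace Γ) : translate 1 x = x := by
  obtain ⟨y, rfl⟩ := surjective_mk x
  simp [translate_mk]

theorem Smooth.continuous {f : AutSpace Γ → ℂ} (hf : Smooth f) : Continuous f := by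
  rw [isOpenQuotientMap_mk.isQuotientMap.continuous_iff]
  exact PGL2R.Smooth.continuous hf

end AutSpace

/-! ### Calculus of periodic functions of two angles -/

/-- The derivative of a function of two angles along the constant vector field `v`. -/
def dirDeriv (v : ℝ × ℝ) (f : ℝ × ℝ → ℂ) (p : ℝ × ℝ) : ℂ := fderiv ℝ f p v

/-- Functions of two angles that are `2π`-periodic in each of them. -/
def Biperiodic {F : Type*} (f : ℝ × ℝ → F) : Prop :=
  (∀ p, f (p + (2 * Real.pi, 0)) = f p) ∧ ∀ p, f (p + (0, 2 * Real.pi)) = f p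

theorem contDiff_dirDeriv {f : ℝ × ℝ → ℂ} (hf : ContDiff ℝ ∞ f) (v : ℝ × ℝ) :
    ContDiff ℝ ∞ (dirDeriv v f) :=
  (hf.fderiv_right (m := ∞) (by simp)).clm_apply contDiff_const

theorem dirDeriv_comm {f : ℝ × ℝ → ℂ} (hf : ContDiff ℝ ∞ f) (v w : ℝ × ℝ) :
    dirDeriv v (dirDeriv w f) = dirDeriv w (dirDeriv v f) := by
  have hd : Differentiable ℝ (fderiv ℝ f) :=
    (hf.fderiv_right (m := ∞) (by simp)).differentiable (by simp)
  have key : ∀ v w p, dirDeriv v (dirDeriv w f) p = fderiv ℝ (fderiv ℝ f) p v w := by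
    intro v w p
    have : HasFDerivAt (dirDeriv w f)
        ((ContinuousLinearMap.apply ℝ ℂ w).comp (fderiv ℝ (fderiv ℝ f) p)) p :=
      (ContinuousLinearMap.apply ℝ ℂ w).hasFDerivAt.comp p (hd p).hasFDerivAt
    simp [dirDeriv, this.fderiv]
  funext p
  rw [key, key]
  exact (hf.contDiffAt.isSymmSndFDerivAt (n := ∞)
    (by
      simp only [minSmoothness_of_isRCLikeNormedField]
      exact WithTop.coe_le_coe.2 (le_top : (2 : ℕ∞) ≤ ⊤))) v w

theorem norm_iteratedFDeriv_dirDeriv_le {f : ℝ × ℝ → ℂ} (hf : ContDiff ℝ ∞ f) (v : ℝ × ℝ)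
    (hv : ‖v‖ ≤ 1) (n : ℕ) (p : ℝ × ℝ) :
    ‖iteratedFDeriv ℝ n (dirDeriv v f) p‖ ≤ ‖iteratedFDeriv ℝ (n + 1) f p‖ := by
  have h1 : dirDeriv v f = (ContinuousLinearMap.apply ℝ ℂ v) ∘ (fderiv ℝ f) := rfl
  have hL : ‖ContinuousLinearMap.apply ℝ ℂ v‖ ≤ 1 := by
    refine ContinuousLinearMap.opNorm_le_bound _ zero_le_one fun L => ?_
    simpa using (L.le_opNorm v).trans (mul_le_of_le_one_right (norm_nonneg _) hv)
  rw [h1, ← norm_iteratedFDeriv_fderiv]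
  refine (ContinuousLinearMap.norm_iteratedFDeriv_comp_left _
    (hf.fderiv_right (m := ∞) (by simp)).contDiffAt (by exact_mod_cast le_top)).trans ?_
  exact mul_le_of_le_one_left (norm_nonneg _) hL

theorem contDiff_iterate_dirDeriv {f : ℝ × ℝ → ℂ} (hf : ContDiff ℝ ∞ f) (v : ℝ × ℝ) (i : ℕ) :
    ContDiff ℝ ∞ ((dirDeriv v)^[i] f) := by
  induction i with
  | zero => exact hf
  | succ i ih => rw [Function.iterate_succ_apply']; exact contDiff_dirDeriv ih v

theorem norm_iteratedFDeriv_iterate_dirDeriv_le {f : ℝ × ℝ → ℂ} (hf : ContDiff ℝ ∞ f) (v : ℝ × ℝ)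
    (hv : ‖v‖ ≤ 1) (i n : ℕ) (p : ℝ × ℝ) :
    ‖iteratedFDeriv ℝ n ((dirDeriv v)^[i] f) p‖ ≤ ‖iteratedFDeriv ℝ (n + i) f p‖ := by
  induction i generalizing n with
  | zero => rfl
  | succ i ih =>
    rw [Function.iterate_succ_apply']
    refine (norm_iteratedFDeriv_dirDeriv_le (contDiff_iterate_dirDeriv hf v i) v hv n p).trans ?_
    refine (ih (n + 1)).trans (le_of_eq ?_)
    rw [show n + 1 + i = n + (i + 1) by omega]

theorem norm_iterate_dirDeriv_le {f : ℝ × ℝ → ℂ} (hf : ContDiff ℝ ∞ f) (v : ℝ × ℝ)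
    (hv : ‖v‖ ≤ 1) (i : ℕ) (p : ℝ × ℝ) :
    ‖(dirDeriv v)^[i] f p‖ ≤ ‖iteratedFDeriv ℝ i f p‖ := by
  have := norm_iteratedFDeriv_iterate_dirDeriv_le hf v hv i 0 p
  rw [zero_add] at this
  simpa using this

theorem dirDeriv_iterate_comm {f : ℝ × ℝ → ℂ} (hf : ContDiff ℝ ∞ f) (v w : ℝ × ℝ) (i : ℕ) :
    (dirDeriv v)^[i] (dirDeriv w f) = dirDeriv w ((dirDeriv v)^[i] f) := by
  induction i with
  | zero => rfl
  | succ i ih =>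
    rw [Function.iterate_succ_apply', Function.iterate_succ_apply', ih,
      dirDeriv_comm (contDiff_iterate_dirDeriv hf v i)]

theorem hasDerivAt_fst {f : ℝ × ℝ → ℂ} (hf : ContDiff ℝ ∞ f) (θ φ : ℝ) :
    HasDerivAt (fun t => f (t, φ)) (dirDeriv (1, 0) f (θ, φ)) θ := by
  have h := (hf.differentiable (by simp) (θ, φ)).hasFDerivAt
  exact h.comp_hasDerivAt θ ((hasDerivAt_id θ).prodMk (hasDerivAt_const θ φ))

theorem hasDerivAt_snd {f : ℝ × ℝ → ℂ} (hf : ContDiff ℝ ∞ f) (θ φ : ℝ) :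
    HasDerivAt (fun t => f (θ, t)) (dirDeriv (0, 1) f (θ, φ)) φ := by
  have h := (hf.differentiable (by simp) (θ, φ)).hasFDerivAt
  exact h.comp_hasDerivAt φ ((hasDerivAt_const φ θ).prodMk (hasDerivAt_id φ))

theorem iteratedDeriv_fst {f : ℝ × ℝ → ℂ} (hf : ContDiff ℝ ∞ f) (j : ℕ) (φ θ : ℝ) :
    iteratedDeriv j (fun t => f (t, φ)) θ = (dirDeriv (1, 0))^[j] f (θ, φ) := by
  induction j generalizing θ with
  | zero => simp
  | succ j ih =>
    rw [iteratedDeriv_succ, Function.iterate_succ_apply', show iteratedDeriv j _ = _ from funext ih]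
    exact (hasDerivAt_fst (contDiff_iterate_dirDeriv hf _ j) θ φ).deriv

/-- A uniform first-order Taylor estimate in the second angle. -/
theorem norm_taylor_snd_le {f : ℝ × ℝ → ℂ} (hf : ContDiff ℝ ∞ f) {M : ℝ}
    (hM : ∀ p, ‖dirDeriv (0, 1) (dirDeriv (0, 1) f) p‖ ≤ M) (θ φ₀ φ : ℝ) :
    ‖f (θ, φ) - f (θ, φ₀) - (φ - φ₀) * dirDeriv (0, 1) f (θ, φ₀)‖ ≤ M * |φ - φ₀| ^ 2 := by
  have hM0 : 0 ≤ M := (norm_nonneg _).trans (hM 0)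
  have h1 : ∀ t, ‖dirDeriv (0, 1) f (θ, t) - dirDeriv (0, 1) f (θ, φ₀)‖ ≤ M * |t - φ₀| := by
    intro t
    have hd := fun s => hasDerivAt_snd (contDiff_dirDeriv hf (0, 1)) θ s
    exact convex_univ.norm_image_sub_le_of_norm_deriv_le
      (f := fun s => dirDeriv (0, 1) f (θ, s))
      (fun s _ => (hd s).differentiableAt)
      (fun s _ => by rw [(hd s).deriv]; exact hM _) (Set.mem_univ φ₀) (Set.mem_univ t)
  have hd : ∀ s : ℝ, HasDerivAt (fun s : ℝ => f (θ, s) - s * dirDeriv (0, 1) f (θ, φ₀))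
      (dirDeriv (0, 1) f (θ, s) - dirDeriv (0, 1) f (θ, φ₀)) s := by
    intro s
    have := (hasDerivAt_snd hf θ s).sub
      ((Complex.ofRealCLM.hasDerivAt (x := s)).mul_const (dirDeriv (0, 1) f (θ, φ₀)))
    exact this.congr_deriv (by simp)
  have h2 := (convex_uIcc φ₀ φ).norm_image_sub_le_of_norm_deriv_le (C := M * |φ - φ₀|)
      (f := fun s : ℝ => f (θ, s) - s * dirDeriv (0, 1) f (θ, φ₀))
      (fun s _ => (hd s).differentiableAt)
      (fun s hs => by
        rw [(hd s).deriv]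
        refine (h1 s).trans (mul_le_mul_of_nonneg_left ?_ hM0)
        exact Set.abs_sub_left_of_mem_uIcc hs)
      Set.left_mem_uIcc Set.right_mem_uIcc
  calc _ = ‖f (θ, φ) - φ * dirDeriv (0, 1) f (θ, φ₀)
        - (f (θ, φ₀) - φ₀ * dirDeriv (0, 1) f (θ, φ₀))‖ := by congr 1; ring
    _ ≤ _ := h2
    _ = _ := by rw [Real.norm_eq_abs]; ring

theorem Biperiodic.exists_mem_square {F : Type*} {f : ℝ × ℝ → F} (hf : Biperiodic f) (p : ℝ × ℝ) :
    ∃ q ∈ square, f p = f q := by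
  obtain ⟨x, y⟩ := p
  obtain ⟨x', hx', ex⟩ := Function.Periodic.exists_mem_Ico₀ (f := fun x => f (x, y))
    (fun x => by simpa using hf.1 (x, y)) Real.two_pi_pos x
  obtain ⟨y', hy', ey⟩ := Function.Periodic.exists_mem_Ico₀ (f := fun y => f (x', y))
    (fun y => by simpa using hf.2 (x', y)) Real.two_pi_pos y
  exact ⟨(x', y'), ⟨Set.Ico_subset_Icc_self hx', Set.Ico_subset_Icc_self hy'⟩, by
    simpa using ex.trans ey⟩

theorem isCompact_square : IsCompact square := isCompact_Icc.prod isCompact_Icc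

theorem Biperiodic.exists_bound {F : Type*} [NormedAddCommGroup F] {f : ℝ × ℝ → F}
    (hf : Biperiodic f) (hc : Continuous f) : ∃ M, ∀ p, ‖f p‖ ≤ M := by
  obtain ⟨M, hM⟩ := isCompact_square.exists_bound_of_continuousOn hc.continuousOn
  refine ⟨M, fun p => ?_⟩
  obtain ⟨q, hq, e⟩ := hf.exists_mem_square p
  rw [e]
  exact hM q hq

theorem Biperiodic.iteratedFDeriv {f : ℝ × ℝ → ℂ} (hf : Biperiodic f) (n : ℕ) :
    Biperiodic (iteratedFDeriv ℝ n f) := by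
  constructor
  · intro p
    rw [← iteratedFDeriv_comp_add_right]
    congr 1
    funext q
    exact hf.1 q
  · intro p
    rw [← iteratedFDeriv_comp_add_right]
    congr 1
    funext q
    exact hf.2 q

theorem Biperiodic.exists_bound_iteratedFDeriv {f : ℝ × ℝ → ℂ} (hf : Biperiodic f)
    (hc : ContDiff ℝ ∞ f) (k : ℕ) : ∃ M, ∀ j ≤ k, ∀ p, ‖_root_.iteratedFDeriv ℝ j f p‖ ≤ M := by
  have h : ∀ j, ∃ M, ∀ p, ‖_root_.iteratedFDeriv ℝ j f p‖ ≤ M := fun j =>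
    (hf.iteratedFDeriv j).exists_bound (hc.continuous_iteratedFDeriv (by exact_mod_cast le_top))
  choose M hM using h
  refine ⟨∑ j ∈ Finset.range (k + 1), M j, fun j hj p => (hM j p).trans ?_⟩
  exact Finset.single_le_sum (f := M) (fun i _ => (norm_nonneg _).trans (hM i 0))
    (Finset.mem_range.2 (by omega))

/-! ### Slices, fibre functionals and the realisation of `E` -/

theorem contDiff_circ : ContDiff ℝ ∞ circ := by
  rw [contDiff_pi]
  intro i
  fin_cases i
  · exact Real.contDiff_cos
  · exact Real.contDiff_sin

theorem circ_ne_zero (θ : ℝ) : circ θ ≠ 0 := by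
  intro h
  have h0 := congrFun h 0
  have h1 := congrFun h 1
  simp only [circ, Matrix.cons_val_zero, Matrix.cons_val_one, Pi.zero_apply] at h0 h1
  have := Real.cos_sq_add_sin_sq θ
  simp [h0, h1] at this

theorem circ_add_two_pi (θ : ℝ) : circ (θ + 2 * Real.pi) = circ θ := by
  simp [circ]

theorem isOpen_ne_zero_prod : IsOpen {p : Plane × Plane | p.1 ≠ 0 ∧ p.2 ≠ 0} :=
  (isOpen_ne_fun continuous_fst continuous_const).inter
    (isOpen_ne_fun continuous_snd continuous_const)

theorem absPow_neg_one (s : ℂ) : absPow (-1) s = 1 := by simp [absPow]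

/-- The plane rotated by the angle `t`. -/
def rot (t : ℝ) (y : Plane) : Plane :=
  ![Real.cos t * y 0 - Real.sin t * y 1, Real.sin t * y 0 + Real.cos t * y 1]

theorem rot_circ (t φ : ℝ) : rot t (circ φ) = circ (φ + t) := by
  simp only [rot, circ, Matrix.cons_val_zero, Matrix.cons_val_one, Real.cos_add, Real.sin_add]
  congr 1
  · ring
  · congr 1
    ring

theorem rot_smul (t a : ℝ) (y : Plane) : rot t (a • y) = a • rot t y := by
  funext i
  fin_cases i <;> simp [rot] <;> ring

theorem rot_zero_right (t : ℝ) : rot t 0 = 0 := by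
  funext i
  fin_cases i <;> simp [rot]

theorem rot_zero_left (y : Plane) : rot 0 y = y := by
  funext i
  fin_cases i <;> simp [rot]

theorem hasDerivAt_rot (y : Plane) : HasDerivAt (fun t => rot t y) ![-y 1, y 0] 0 := by
  rw [hasDerivAt_pi]
  intro i
  fin_cases i
  · have := ((Real.hasDerivAt_cos 0).mul_const (y 0)).sub ((Real.hasDerivAt_sin 0).mul_const (y 1))
    exact this.congr_deriv (by simp)
  · have := ((Real.hasDerivAt_sin 0).mul_const (y 0)).add ((Real.hasDerivAt_cos 0).mul_const (y 1))
    exact this.congr_deriv (by simp)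

namespace E

variable {τ τ' : ℂ}

theorem contDiff_onTorus (u : E τ τ') : ContDiff ℝ ∞ (onTorus u) := by
  have h := u.2.2.2.2.comp_contDiff
    ((contDiff_circ.comp contDiff_fst).prodMk (contDiff_circ.comp contDiff_snd))
    (fun p : ℝ × ℝ => ⟨circ_ne_zero p.1, circ_ne_zero p.2⟩)
  exact h

theorem biperiodic_onTorus (u : E τ τ') : Biperiodic (onTorus u) := by
  constructor <;> intro p <;> simp [onTorus, circ_add_two_pi]

/-- The function `x ↦ u(x, y)`, as an element of `V_τ`. -/
def slice (u : E τ τ') (y : Plane) : V τ :=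
  ⟨fun x => u.1 x y, u.2.1 0 y (Or.inl rfl), fun a ha x => u.2.2.1 a ha x y, by
    by_cases hy : y = 0
    · have : (fun x => u.1 x y) = fun _ => 0 := funext fun x => u.2.1 x y (Or.inr hy)
      rw [this]
      exact contDiffOn_const
    · exact u.2.2.2.2.comp (contDiff_id.prodMk contDiff_const).contDiffOn fun x hx => ⟨hx, hy⟩⟩

theorem slice_zero (u : E τ τ') : slice u 0 = 0 :=
  Subtype.ext (funext fun x => u.2.1 x 0 (Or.inr rfl))

theorem slice_smul_right (u : E τ τ') {a : ℝ} (ha : a ≠ 0) (y : Plane) :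
    slice u (a • y) = absPow a (τ' - 1) • slice u y :=
  Subtype.ext (funext fun x => u.2.2.2.1 a ha x y)

theorem onCircle_slice (u : E τ τ') (φ : ℝ) :
    V.onCircle (slice u (circ φ)) = fun θ => onTorus u (θ, φ) := rfl

/-- The derivative of `u ∈ E` along the rotations of the second variable. -/
def rotDeriv (u : E τ τ') : E τ τ' :=
  ⟨fun x y => deriv (fun t => u.1 x (rot t y)) 0, by
    have key : ∀ p ∈ {p : Plane × Plane | p.1 ≠ 0 ∧ p.2 ≠ 0},
        deriv (fun t => u.1 p.1 (rot t p.2)) 0 =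
          fderiv ℝ (fun p : Plane × Plane => u.1 p.1 p.2) p (0, ![-p.2 1, p.2 0]) := by
      intro p hp
      have h1 : HasFDerivAt (fun p : Plane × Plane => u.1 p.1 p.2)
          (fderiv ℝ (fun p : Plane × Plane => u.1 p.1 p.2) p) (p.1, rot 0 p.2) := by
        rw [rot_zero_left]
        exact ((u.2.2.2.2.contDiffAt (isOpen_ne_zero_prod.mem_nhds hp)).differentiableAt
          (by simp)).hasFDerivAt
      exact (h1.comp_hasDerivAt (0 : ℝ)
        ((hasDerivAt_const (0 : ℝ) p.1).prodMk (hasDerivAt_rot p.2))).deriv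
    refine ⟨?_, fun a ha x y => ?_, fun a ha x y => ?_, ?_⟩
    · rintro x y (rfl | rfl)
      · simp [u.2.1 0 _ (Or.inl rfl)]
      · simp [rot_zero_right]
    · simp only [u.2.2.1 a ha]
      exact deriv_const_mul_field _
    · simp only [rot_smul, u.2.2.2.1 a ha]
      exact deriv_const_mul_field _
    · refine ContDiffOn.congr ?_ key
      refine (u.2.2.2.2.fderiv_of_isOpen isOpen_ne_zero_prod (m := ∞) (by simp)).clm_apply ?_
      refine (contDiff_const.prodMk ?_).contDiffOn
      rw [contDiff_pi]
      intro i
      fin_cases i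
      · exact ((contDiff_apply ℝ ℝ (1 : Fin 2)).comp contDiff_snd).neg
      · exact (contDiff_apply ℝ ℝ (0 : Fin 2)).comp contDiff_snd⟩

theorem onTorus_rotDeriv (u : E τ τ') : onTorus (rotDeriv u) = dirDeriv (0, 1) (onTorus u) := by
  funext p
  have h := hasDerivAt_snd (contDiff_onTorus u) p.1 p.2
  have h2 : HasDerivAt (fun t => onTorus u (p.1, p.2 + t)) (dirDeriv (0, 1) (onTorus u) p) 0 := by
    have : HasDerivAt (fun t => onTorus u (p.1, t)) (dirDeriv (0, 1) (onTorus u) p) (p.2 + 0) := by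
      simpa using h
    exact this.comp_const_add p.2 0
  have h3 : (fun t => onTorus u (p.1, p.2 + t)) = fun t => u.1 (circ p.1) (rot t (circ p.2)) := by
    funext t
    simp [onTorus, rot_circ]
  rw [h3] at h2
  exact h2.deriv

theorem onTorus_iterate_rotDeriv (u : E τ τ') (j : ℕ) :
    onTorus (rotDeriv^[j] u) = (dirDeriv (0, 1))^[j] (onTorus u) := by
  induction j with
  | zero => rfl
  | succ j ih =>
    rw [Function.iterate_succ_apply', Function.iterate_succ_apply', onTorus_rotDeriv, ih]

end E

/-- A linear functional on `V_τ` is bounded by `C` times the `C^k` norm on the unit circle. -/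
def IsCkBounded {τ : ℂ} (k : ℕ) (C : ℝ) (l : V τ →ₗ[ℂ] ℂ) : Prop :=
  ∀ (v : V τ) (M : ℝ), (∀ j ≤ k, ∀ θ, ‖iteratedDeriv j (V.onCircle v) θ‖ ≤ M) → ‖l v‖ ≤ C * M

theorem norm_unit_fst : ‖((1, 0) : ℝ × ℝ)‖ ≤ 1 := by simp [Prod.norm_def]

theorem norm_unit_snd : ‖((0, 1) : ℝ × ℝ)‖ ≤ 1 := by simp [Prod.norm_def]

namespace IsCkBounded

variable {τ τ' : ℂ} {k : ℕ} {C : ℝ} {l : V τ →ₗ[ℂ] ℂ}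

theorem norm_slice_le (hl : IsCkBounded k C l) (u : E τ τ') {M : ℝ}
    (hM : ∀ j ≤ k, ∀ p, ‖iteratedFDeriv ℝ j (E.onTorus u) p‖ ≤ M) (φ : ℝ) :
    ‖l (E.slice u (circ φ))‖ ≤ C * M := by
  refine hl _ _ fun j hj θ => ?_
  rw [E.onCircle_slice, iteratedDeriv_fst (E.contDiff_onTorus u)]
  exact (norm_iterate_dirDeriv_le (E.contDiff_onTorus u) _ norm_unit_fst _ _).trans (hM j hj _)

theorem norm_slice_iterate_rotDeriv_le (hl : IsCkBounded k C l) (u : E τ τ') {M : ℝ} {n : ℕ}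
    (hM : ∀ j ≤ k + n, ∀ p, ‖iteratedFDeriv ℝ j (E.onTorus u) p‖ ≤ M) {i : ℕ} (hi : i ≤ n)
    (φ : ℝ) : ‖l (E.slice (E.rotDeriv^[i] u) (circ φ))‖ ≤ C * M := by
  refine hl.norm_slice_le _ (fun j hj p => ?_) φ
  rw [E.onTorus_iterate_rotDeriv]
  exact (norm_iteratedFDeriv_iterate_dirDeriv_le (E.contDiff_onTorus u) _ norm_unit_snd _ _ _).trans
    (hM _ (by omega) _)

/-- A continuous functional may be differentiated under: the second-order Taylor estimate holds
in the `C^k` norm of the slices. -/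
theorem hasDerivAt_slice (hl : IsCkBounded k C l) (u : E τ τ') (φ₀ : ℝ) :
    HasDerivAt (fun φ => l (E.slice u (circ φ))) (l (E.slice (E.rotDeriv u) (circ φ₀))) φ₀ := by
  obtain ⟨M, hM⟩ := (E.biperiodic_onTorus u).exists_bound_iteratedFDeriv
    (E.contDiff_onTorus u) (k + 2)
  have hu := E.contDiff_onTorus u
  have key : ∀ φ : ℝ, ‖l (E.slice u (circ φ)) - l (E.slice u (circ φ₀)) -
      (φ - φ₀) • l (E.slice (E.rotDeriv u) (circ φ₀))‖ ≤ C * M * ‖‖φ - φ₀‖ ^ 2‖ := by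
    intro φ
    have e : l (E.slice u (circ φ)) - l (E.slice u (circ φ₀)) -
        (φ - φ₀) • l (E.slice (E.rotDeriv u) (circ φ₀)) =
        l (E.slice u (circ φ) - E.slice u (circ φ₀) -
          ((φ - φ₀ : ℝ) : ℂ) • E.slice (E.rotDeriv u) (circ φ₀)) := by
      simp
    rw [e, mul_assoc]
    refine hl _ _ fun j hj θ => ?_
    have h1 : V.onCircle (E.slice u (circ φ) - E.slice u (circ φ₀) -
          ((φ - φ₀ : ℝ) : ℂ) • E.slice (E.rotDeriv u) (circ φ₀)) = fun t =>
        E.onTorus u (t, φ) - E.onTorus u (t, φ₀) -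
          ((φ - φ₀ : ℝ) : ℂ) * dirDeriv (0, 1) (E.onTorus u) (t, φ₀) := by
      rw [← E.onTorus_rotDeriv]
      rfl
    have hc : ∀ {f : ℝ × ℝ → ℂ}, ContDiff ℝ ∞ f → ∀ s, ContDiffAt ℝ j (fun t => f (t, s)) θ :=
      fun hf s => ((hf.comp (contDiff_id.prodMk contDiff_const)).of_le
        (by exact_mod_cast le_top)).contDiffAt
    have hdu := contDiff_dirDeriv hu (0, 1)
    have h2 : iteratedDeriv j (fun t =>
        E.onTorus u (t, φ) - E.onTorus u (t, φ₀) -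
          ((φ - φ₀ : ℝ) : ℂ) * dirDeriv (0, 1) (E.onTorus u) (t, φ₀)) θ =
        (dirDeriv (1, 0))^[j] (E.onTorus u) (θ, φ) - (dirDeriv (1, 0))^[j] (E.onTorus u) (θ, φ₀) -
          (φ - φ₀) * dirDeriv (0, 1) ((dirDeriv (1, 0))^[j] (E.onTorus u)) (θ, φ₀) := by
      rw [iteratedDeriv_fun_sub ((hc hu φ).sub (hc hu φ₀)) (contDiffAt_const.mul (hc hdu φ₀)),
        iteratedDeriv_fun_sub (hc hu φ) (hc hu φ₀), iteratedDeriv_const_mul_field,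
        iteratedDeriv_fst hu, iteratedDeriv_fst hu, iteratedDeriv_fst hdu, dirDeriv_iterate_comm hu]
      push_cast
      rfl
    rw [h1, h2, norm_pow, norm_norm, Real.norm_eq_abs]
    refine norm_taylor_snd_le (contDiff_iterate_dirDeriv hu _ j) (fun p => ?_) θ φ₀ φ
    rw [← dirDeriv_iterate_comm hu, ← dirDeriv_iterate_comm (contDiff_dirDeriv hu _)]
    refine (norm_iterate_dirDeriv_le (contDiff_dirDeriv hdu _) _ norm_unit_fst _ _).trans ?_
    refine (norm_iteratedFDeriv_dirDeriv_le hdu _ norm_unit_snd _ _).trans ?_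
    refine (norm_iteratedFDeriv_dirDeriv_le hu _ norm_unit_snd _ _).trans (hM _ (by omega) _)
  rw [hasDerivAt_iff_isLittleO]
  exact (Asymptotics.IsBigO.of_bound _ (Filter.Eventually.of_forall key)).trans_isLittleO
    (Asymptotics.isLittleO_pow_sub_sub φ₀ one_lt_two)

theorem iteratedDeriv_slice (hl : IsCkBounded k C l) (u : E τ τ') (j : ℕ) :
    iteratedDeriv j (fun φ => l (E.slice u (circ φ))) =
      fun φ => l (E.slice (E.rotDeriv^[j] u) (circ φ)) := by
  induction j with
  | zero => simp
  | succ j ih =>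
    rw [iteratedDeriv_succ, ih]
    funext φ
    rw [(hl.hasDerivAt_slice _ φ).deriv, Function.iterate_succ_apply']

theorem contDiff_slice (hl : IsCkBounded k C l) (u : E τ τ') :
    ContDiff ℝ ∞ (fun φ => l (E.slice u (circ φ))) := by
  refine contDiff_of_differentiable_iteratedDeriv fun m _ => ?_
  rw [hl.iteratedDeriv_slice]
  exact fun φ => (hl.hasDerivAt_slice _ φ).differentiableAt

end IsCkBounded

theorem absPow_eq_exp {r : ℝ} (hr : r ≠ 0) (s : ℂ) :
    absPow r s = Complex.exp (s * (Real.log |r| : ℝ)) := by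
  have h : ((|r| : ℝ) : ℂ) ≠ 0 := by simpa using hr
  rw [absPow, Complex.cpow_def_of_ne_zero h, Complex.ofReal_log (abs_nonneg r), mul_comm]

/-- A homogeneous function on the plane is smooth away from the origin when its restriction to
the unit circle is smooth. -/
theorem contDiffOn_of_contDiff_circ {s : ℂ} {f : Plane → ℂ}
    (hf : ∀ a : ℝ, a ≠ 0 → ∀ x, f (a • x) = absPow a s * f x)
    (hc : ContDiff ℝ ∞ fun θ => f (circ θ)) : ContDiffOn ℝ ∞ f {x | x ≠ 0} := by
  have hz : ContDiff ℝ ∞ fun y : Plane => (y 0 : ℂ) + y 1 * Complex.I :=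
    (Complex.ofRealCLM.contDiff.comp (contDiff_apply ℝ ℝ (0 : Fin 2))).add
      ((Complex.ofRealCLM.contDiff.comp (contDiff_apply ℝ ℝ (1 : Fin 2))).mul contDiff_const)
  have main : ∀ y : Plane, (y 0 : ℂ) + y 1 * Complex.I ∈ Complex.slitPlane →
      ContDiffAt ℝ ∞ f y := by
    intro y hy
    have hlog : ContDiffAt ℝ ∞ (fun y : Plane => Complex.log ((y 0 : ℂ) + y 1 * Complex.I)) y :=
      ContDiffAt.comp (g := Complex.log) (f := fun y : Plane => (y 0 : ℂ) + y 1 * Complex.I) y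
        ((Complex.contDiffAt_log hy).restrict_scalars ℝ) hz.contDiffAt
    have hre := Complex.reCLM.contDiff.contDiffAt.comp y hlog
    have him := Complex.imCLM.contDiff.contDiffAt.comp y hlog
    have h1 : ContDiffAt ℝ ∞ (fun y : Plane =>
        Complex.exp (s * ((Complex.log ((y 0 : ℂ) + y 1 * Complex.I)).re : ℝ)) *
        f (circ (Complex.log ((y 0 : ℂ) + y 1 * Complex.I)).im)) y :=
      ((contDiffAt_const.mul (Complex.ofRealCLM.contDiff.contDiffAt.comp y hre)).cexp).mul
        (hc.contDiffAt.comp y him)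
    refine h1.congr_of_eventuallyEq ?_
    filter_upwards [hz.continuous.continuousAt.eventually (Complex.isOpen_slitPlane.mem_nhds hy)]
      with w hw
    set ζ : ℂ := (w 0 : ℂ) + w 1 * Complex.I with hζ
    have hζ0 : ζ ≠ 0 := Complex.slitPlane_ne_zero hw
    have e : w = Real.exp (Complex.log ζ).re • circ (Complex.log ζ).im := by
      have h2 := Complex.exp_log hζ0
      have hre2 := congrArg Complex.re h2
      have him2 := congrArg Complex.im h2
      rw [Complex.exp_re] at hre2
      rw [Complex.exp_im] at him2
      funext i
      fin_cases i
      · simpa [circ, hζ] using hre2.symm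
      · simpa [circ, hζ] using him2.symm
    conv_lhs => rw [e]
    rw [hf _ (Real.exp_pos _).ne', absPow_eq_exp (Real.exp_pos _).ne', abs_of_pos (Real.exp_pos _),
      Real.log_exp]
  intro y hy
  by_cases hs : (y 0 : ℂ) + y 1 * Complex.I ∈ Complex.slitPlane
  · exact (main y hs).contDiffWithinAt
  · -- off the slit plane, `f y = f (-y)` reduces to the previous case
    have hs' : ((-y) 0 : ℝ) + ((-y) 1 : ℝ) * Complex.I ∈ Complex.slitPlane := by
      simp only [Complex.mem_slitPlane_iff, not_or, not_lt, not_not] at hs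
      simp only [Complex.mem_slitPlane_iff]
      left
      have h0 : y 0 ≤ 0 := by simpa using hs.1
      have h1 : y 1 = 0 := by simpa using hs.2
      have : y 0 ≠ 0 := by
        intro h
        apply hy
        funext i
        fin_cases i
        · exact h
        · exact h1
      have : y 0 < 0 := lt_of_le_of_ne h0 this
      simpa using this
    have h2 : f = fun w => f (-w) := by
      funext w
      have := hf (-1) (by norm_num) w
      rw [absPow_neg_one, one_mul] at this
      simpa using this.symm
    rw [h2]
    exact ((main (-y) hs').comp y contDiff_neg.contDiffAt).contDiffWithinAt

namespace E

variable {τ τ' : ℂ}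

/-- A continuous functional `l` on `V_τ` applied to the first variable of `u ∈ E`: the element
`y ↦ l(u(·, y))` of `V_τ'`. -/
def fiber (l : V τ →ₗ[ℂ] ℂ) (hl : ∃ k C, IsCkBounded k C l) : E τ τ' →ₗ[ℂ] V τ' where
  toFun u := ⟨fun y => l (slice u y), by
    have hhom : ∀ a : ℝ, a ≠ 0 → ∀ y, l (slice u (a • y)) = absPow a (τ' - 1) * l (slice u y) :=
      fun a ha y => by rw [slice_smul_right u ha, map_smul, smul_eq_mul]
    obtain ⟨k, C, hl⟩ := hl
    exact ⟨by simp [slice_zero], hhom, contDiffOn_of_contDiff_circ hhom (hl.contDiff_slice u)⟩⟩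
  map_add' u v := Subtype.ext (funext fun y => l.map_add (slice u y) (slice v y))
  map_smul' c u := Subtype.ext (funext fun y => l.map_smul c (slice u y))

theorem fiber_apply (l : V τ →ₗ[ℂ] ℂ) (hl : ∃ k C, IsCkBounded k C l) (u : E τ τ') (y : Plane) :
    (fiber l hl u).1 y = l (slice u y) := rfl

end E

/-- A continuous function of two variables, the first of which ranges over a compact set up to
periodicity, is continuous in the second variable uniformly in the first. -/
theorem eventually_norm_sub_le_of_isCompact {X Y F : Type*} [TopologicalSpace X]
    [TopologicalSpace Y] [NormedAddCommGroup F] {g : Y × X → F} (hg : Continuous g) {s : Set Y}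
    (hs : IsCompact s) (hp : ∀ y, ∃ z ∈ s, ∀ x, g (y, x) = g (z, x)) (x₀ : X) {ε : ℝ}
    (hε : 0 < ε) : ∀ᶠ x in nhds x₀, ∀ y, ‖g (y, x) - g (y, x₀)‖ ≤ ε := by
  have h1 : ∀ y ∈ s, ∀ᶠ q : X × Y in nhds (x₀, y), ‖g (q.2, q.1) - g (q.2, x₀)‖ ≤ ε := by
    intro y _
    have hc : Continuous fun q : X × Y => ‖g (q.2, q.1) - g (q.2, x₀)‖ := by fun_prop
    have := hc.continuousAt (x := (x₀, y))
    exact (this.eventually_lt_const (by simpa using hε)).mono fun _ h => h.le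
  have h2 := hs.eventually_forall_of_forall_eventually
    (P := fun x y => ‖g (y, x) - g (y, x₀)‖ ≤ ε) h1
  filter_upwards [h2] with x hx y
  obtain ⟨z, hz, e⟩ := hp y
  rw [e, e]
  exact hx z hz

section Realisation

variable {Γ : Subgroup PGL2R} {μ : Measure (AutSpace Γ)} {τ τ' : ℂ}

namespace EnhancedRep

/-- The functional `v ↦ ν(v)(x)`. -/
def evalAt (ν : EnhancedRep μ τ) (x : AutSpace Γ) : V τ →ₗ[ℂ] ℂ := (LinearMap.proj x).comp ν.ν

theorem evalAt_apply (ν : EnhancedRep μ τ) (x : AutSpace Γ) (v : V τ) :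
    ν.evalAt x v = ν.ν v x := rfl

theorem exists_isCkBounded (ν : EnhancedRep μ τ) : ∃ k C, ∀ x, IsCkBounded k C (ν.evalAt x) := by
  obtain ⟨k, C, h⟩ := ν.continuous
  exact ⟨k, C, fun x v M hM => h v M hM x⟩

theorem exists_isCkBounded_at (ν : EnhancedRep μ τ) (x : AutSpace Γ) :
    ∃ k C, IsCkBounded k C (ν.evalAt x) := by
  obtain ⟨k, C, h⟩ := ν.exists_isCkBounded
  exact ⟨k, C, h x⟩

theorem continuous_apply (ν : EnhancedRep μ τ) (v : V τ) : Continuous (ν.ν v) :=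
  (ν.smooth v).continuous

/-- The realisations of the slices of `u` are Lipschitz in the angle, uniformly on `X`. -/
theorem continuous_slice (ν : EnhancedRep μ τ) (u : E τ τ') :
    Continuous fun p : ℝ × AutSpace Γ => ν.ν (E.slice u (circ p.1)) p.2 := by
  obtain ⟨k, C, h⟩ := ν.exists_isCkBounded
  obtain ⟨M, hM⟩ := (E.biperiodic_onTorus u).exists_bound_iteratedFDeriv
    (E.contDiff_onTorus u) (k + 1)
  refine continuous_prod_of_continuous_lipschitzWith _ (C * M).toNNReal
    (fun φ => ν.continuous_apply (E.slice u (circ φ))) (fun x => ?_)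
  have hd := fun φ => (h x).hasDerivAt_slice u φ
  refine lipschitzWith_of_nnnorm_deriv_le (f := fun φ => ν.evalAt x (E.slice u (circ φ)))
    (fun φ => (hd φ).differentiableAt) fun φ => ?_
  rw [(hd φ).deriv]
  refine NNReal.le_toNNReal_of_coe_le ?_
  exact (h x).norm_slice_iterate_rotDeriv_le u (n := 1) hM (i := 1) le_rfl φ

end EnhancedRep

variable (ν : EnhancedRep μ τ) (ν' : EnhancedRep μ τ')

/-- The realisation of `E` in functions on `X × X`: the morphism `ν` is applied in the first
variable and `ν'` in the second. -/
def realisation : E τ τ' →ₗ[ℂ] (AutSpace Γ × AutSpace Γ → ℂ) where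
  toFun u p := ν'.ν (E.fiber (ν.evalAt p.1) (ν.exists_isCkBounded_at p.1) u) p.2
  map_add' u v := by
    funext p
    simp
  map_smul' c u := by
    funext p
    simp

theorem realisation_apply (u : E τ τ') (x x' : AutSpace Γ) :
    realisation ν ν' u (x, x') = ν'.ν (E.fiber (ν.evalAt x) (ν.exists_isCkBounded_at x) u) x' := rfl

theorem iteratedDeriv_onCircle_fiber (u : E τ τ') (x : AutSpace Γ) (j : ℕ) (φ : ℝ) :
    iteratedDeriv j (V.onCircle (E.fiber (ν.evalAt x) (ν.exists_isCkBounded_at x) u)) φ =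
      ν.ν (E.slice (E.rotDeriv^[j] u) (circ φ)) x := by
  obtain ⟨k, C, h⟩ := ν.exists_isCkBounded
  exact congrFun ((h x).iteratedDeriv_slice u j) φ

theorem isRealisation_realisation : IsRealisation ν ν' (realisation ν ν') where
  tmul v v' x x' := by
    have : E.fiber (ν.evalAt x) (ν.exists_isCkBounded_at x) (E.tmul v v') = ν.ν v x • v' := by
      refine Subtype.ext (funext fun y => ?_)
      have h : E.slice (E.tmul v v') y = v'.1 y • v :=
        Subtype.ext (funext fun z => mul_comm _ _)
      rw [E.fiber_apply, h, map_smul, EnhancedRep.evalAt_apply, smul_eq_mul, mul_comm]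
      rfl
    rw [realisation_apply, this, map_smul]
    rfl
  continuous := by
    obtain ⟨k, C, h⟩ := ν.exists_isCkBounded
    obtain ⟨k', C', h'⟩ := ν'.exists_isCkBounded
    refine ⟨k + k', C' * C, fun u M hM p => ?_⟩
    rw [mul_assoc]
    refine h' p.2 _ _ fun j hj φ => ?_
    rw [iteratedDeriv_onCircle_fiber]
    exact (h p.1).norm_slice_iterate_rotDeriv_le u hM hj φ

theorem continuous_realisation (u : E τ τ') : Continuous (realisation ν ν' u) := by
  obtain ⟨k', C', h'⟩ := ν'.exists_isCkBounded
  rw [continuous_iff_continuousAt]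
  rintro ⟨x₀, x₀'⟩
  rw [Metric.continuousAt_iff']
  intro ε hε
  have hη : 0 < ε / 2 / (|C'| + 1) := by positivity
  have h1 : ∀ᶠ x in nhds x₀, ∀ j ∈ Finset.range (k' + 1), ∀ φ,
      ‖ν.ν (E.slice (E.rotDeriv^[j] u) (circ φ)) x -
        ν.ν (E.slice (E.rotDeriv^[j] u) (circ φ)) x₀‖ ≤ ε / 2 / (|C'| + 1) := by
    rw [Filter.eventually_all_finset]
    intro j _
    refine eventually_norm_sub_le_of_isCompact (ν.continuous_slice (E.rotDeriv^[j] u))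
      (isCompact_Icc (a := 0) (b := 2 * Real.pi)) (fun φ => ?_) x₀ hη
    obtain ⟨ψ, hψ, e⟩ := Function.Periodic.exists_mem_Ico₀ (f := circ) circ_add_two_pi
      Real.two_pi_pos φ
    exact ⟨ψ, Set.Ico_subset_Icc_self hψ, fun x => by simp only [e]⟩
  set w := E.fiber (ν.evalAt x₀) (ν.exists_isCkBounded_at x₀) u with hw
  have h2 : ∀ᶠ x' in nhds x₀', dist (ν'.ν w x') (ν'.ν w x₀') < ε / 2 :=
    Metric.continuousAt_iff'.1 (ν'.continuous_apply w).continuousAt _ (half_pos hε)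
  rw [nhds_prod_eq]
  filter_upwards [h1.prod_inl (nhds x₀'), h2.prod_inr (nhds x₀)] with p hp1 hp2
  have h3 : dist (realisation ν ν' u p) (ν'.ν w p.2) ≤ ε / 2 := by
    rw [dist_eq_norm]
    have e : realisation ν ν' u p - ν'.ν w p.2 = ν'.evalAt p.2
        (E.fiber (ν.evalAt p.1) (ν.exists_isCkBounded_at p.1) u - w) := by
      rw [map_sub]
      rfl
    rw [e]
    have h4 : ‖ν'.evalAt p.2 (E.fiber (ν.evalAt p.1) (ν.exists_isCkBounded_at p.1) u - w)‖ ≤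
        C' * (ε / 2 / (|C'| + 1)) := by
      refine h' p.2 _ _ fun j hj φ => ?_
      have h5 : V.onCircle (E.fiber (ν.evalAt p.1) (ν.exists_isCkBounded_at p.1) u - w) = fun φ =>
          V.onCircle (E.fiber (ν.evalAt p.1) (ν.exists_isCkBounded_at p.1) u) φ -
            V.onCircle w φ := rfl
      have hsm : ∀ v : V τ', ContDiffAt ℝ j (V.onCircle v) φ := fun v =>
        ((v.2.2.2.comp_contDiff contDiff_circ circ_ne_zero).of_le
          (by exact_mod_cast le_top)).contDiffAt
      rw [h5, iteratedDeriv_fun_sub (hsm _) (hsm _), hw, iteratedDeriv_onCircle_fiber,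
        iteratedDeriv_onCircle_fiber]
      exact hp1 j (Finset.mem_range.2 (by omega)) φ
    refine h4.trans ?_
    calc C' * (ε / 2 / (|C'| + 1)) ≤ |C'| * (ε / 2 / (|C'| + 1)) :=
          mul_le_mul_of_nonneg_right (le_abs_self _) hη.le
      _ ≤ (|C'| + 1) * (ε / 2 / (|C'| + 1)) := by gcongr; linarith
      _ = ε / 2 := by field_simp
  calc dist (realisation ν ν' u p) (realisation ν ν' u (x₀, x₀')) ≤
        dist (realisation ν ν' u p) (ν'.ν w p.2) + dist (ν'.ν w p.2) (ν'.ν w x₀') :=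
          dist_triangle _ _ _
    _ < ε / 2 + ε / 2 := add_lt_add_of_le_of_lt h3 hp2
    _ = ε := add_halves ε

theorem realisation_actGL (g g' : GL (Fin 2) ℝ) (u : E τ τ') (x x' : AutSpace Γ) :
    realisation ν ν' (E.actGL g g' u) (x, x') =
      realisation ν ν' u
        (AutSpace.translate (PGL2R.mk g) x, AutSpace.translate (PGL2R.mk g') x') := by
  rw [realisation_apply, realisation_apply, ← ν'.equivariant]
  refine congrFun (congrArg ν'.ν (Subtype.ext (funext fun y => ?_))) x'
  have h : E.slice (E.actGL g g' u) y =
      absPow (g' : Matrix (Fin 2) (Fin 2) ℝ).det ((τ' - 1) / 2) •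
        V.act g (E.slice u (((g'⁻¹ : GL (Fin 2) ℝ) : Matrix (Fin 2) (Fin 2) ℝ).mulVec y)) := by
    refine Subtype.ext (funext fun z => ?_)
    simp only [E.slice, E.actGL, V.act, Submodule.coe_smul, Pi.smul_apply, smul_eq_mul]
    ring
  rw [E.fiber_apply, h, map_smul, EnhancedRep.evalAt_apply, ν.equivariant]
  simp only [V.act, E.fiber_apply, EnhancedRep.evalAt_apply, smul_eq_mul]
  ring

theorem realisation_act (g : PGL2R × PGL2R) (u : E τ τ') (x x' : AutSpace Γ) :
    realisation ν ν' (E.act g u) (x, x') =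
      realisation ν ν' u (AutSpace.translate g.1 x, AutSpace.translate g.2 x') := by
  rw [E.act, realisation_actGL, PGL2R.mk_rep, PGL2R.mk_rep]

end Realisation

/-! ### Powers of `|sin|` and the invariant Hermitian form -/

theorem periodic_abs_sin_rpow (e : ℝ) : Function.Periodic (fun t => |Real.sin t| ^ e) Real.pi := by
  intro t
  simp [Real.sin_add_pi]

theorem measurable_abs_sin_rpow (e : ℝ) : Measurable fun t => |Real.sin t| ^ e :=
  (Real.measurable_sin.norm).pow_const e

theorem intervalIntegrable_abs_sin_rpow {e : ℝ} (he : -1 < e) (a b : ℝ) :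
    IntervalIntegrable (fun t => |Real.sin t| ^ e) volume a b := by
  have hpi := Real.pi_pos
  rcases le_or_gt 0 e with h0 | h0
  · exact ((Real.continuous_sin.abs).rpow_const fun _ => Or.inr h0).intervalIntegrable _ _
  have h1 : IntervalIntegrable (fun t => |Real.sin t| ^ e) volume 0 (Real.pi / 2) := by
    have h2 : IntervalIntegrable (fun t : ℝ => (2 / Real.pi) ^ e * t ^ e) volume 0 (Real.pi / 2) :=
      (intervalIntegral.intervalIntegrable_rpow' he).const_mul _
    refine h2.mono_fun (measurable_abs_sin_rpow e).aestronglyMeasurable ?_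
    rw [Filter.EventuallyLE, ae_restrict_iff' measurableSet_uIoc]
    refine Filter.Eventually.of_forall fun t ht => ?_
    rw [Set.uIoc_of_le (by positivity)] at ht
    have h3 := Real.mul_le_sin ht.1.le ht.2
    have h4 : 0 < 2 / Real.pi * t := mul_pos (by positivity) ht.1
    rw [← Real.mul_rpow (by positivity) ht.1.le, Real.norm_of_nonneg (by positivity),
      Real.norm_of_nonneg (by positivity), abs_of_pos (h4.trans_le h3)]
    exact Real.rpow_le_rpow_of_nonpos h4 h3 h0.le
  have h2 : IntervalIntegrable (fun t => |Real.sin t| ^ e) volume (Real.pi / 2) Real.pi := by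
    have := (h1.comp_sub_left Real.pi).symm
    simp only [Real.sin_pi_sub, sub_zero] at this
    rwa [show Real.pi - Real.pi / 2 = Real.pi / 2 by ring] at this
  refine (periodic_abs_sin_rpow e).intervalIntegrable hpi.ne' (t := 0) ?_ a b
  rw [zero_add]
  exact h1.trans h2

/-- The integral of `|sin| ^ e` over a period of the circle. -/
def sinInt (e : ℝ) : ℝ := ∫ t in Set.Icc 0 (2 * Real.pi), |Real.sin t| ^ e

theorem integrableOn_abs_sin_sub_rpow {e : ℝ} (he : -1 < e) (y : ℝ) :
    IntegrableOn (fun x => |Real.sin (x - y)| ^ e) (Set.Icc 0 (2 * Real.pi)) := by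
  have h := (intervalIntegrable_abs_sin_rpow he (0 - y) (2 * Real.pi - y)).comp_sub_right y
  rw [sub_add_cancel, sub_add_cancel] at h
  rw [integrableOn_Icc_iff_integrableOn_Ioc]
  exact (intervalIntegrable_iff_integrableOn_Ioc_of_le Real.two_pi_pos.le).1 h

theorem setIntegral_abs_sin_sub_rpow (e : ℝ) (y : ℝ) :
    ∫ x in Set.Icc 0 (2 * Real.pi), |Real.sin (x - y)| ^ e = sinInt e := by
  rw [sinInt, integral_Icc_eq_integral_Ioc, integral_Icc_eq_integral_Ioc,
    ← intervalIntegral.integral_of_le Real.two_pi_pos.le,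
    ← intervalIntegral.integral_of_le Real.two_pi_pos.le,
    intervalIntegral.integral_comp_sub_right (fun t => |Real.sin t| ^ e)]
  have := ((periodic_abs_sin_rpow e).nat_mul 2).intervalIntegral_add_eq (0 - y) 0
  push_cast at this
  rw [zero_add] at this
  rw [← this]
  congr 1
  ring

theorem volume_restrict_square : (volume : Measure (ℝ × ℝ)).restrict square =
    (volume.restrict (Set.Icc 0 (2 * Real.pi))).prod
      (volume.restrict (Set.Icc 0 (2 * Real.pi))) := by
  rw [Measure.prod_restrict]
  rfl

theorem abs_sin_sub_comm (x y : ℝ) : |Real.sin (x - y)| = |Real.sin (y - x)| := by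
  rw [← neg_sub, Real.sin_neg, abs_neg]

theorem sinInt_nonneg (e : ℝ) : 0 ≤ sinInt e := integral_nonneg fun _ => by positivity

theorem integrableOn_square_mul_abs_sin {e : ℝ} (he : -1 < e) {g : ℝ → ℝ}
    (hg : IntegrableOn g (Set.Icc 0 (2 * Real.pi))) :
    IntegrableOn (fun p : ℝ × ℝ => g p.1 * |Real.sin (p.1 - p.2)| ^ e) square ∧
    IntegrableOn (fun p : ℝ × ℝ => g p.2 * |Real.sin (p.1 - p.2)| ^ e) square := by
  have hm : Measurable fun p : ℝ × ℝ => |Real.sin (p.1 - p.2)| ^ e :=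
    (measurable_abs_sin_rpow e).comp (measurable_fst.sub measurable_snd)
  have hnorm : ∀ c y, ∫ x in Set.Icc 0 (2 * Real.pi), ‖c * |Real.sin (x - y)| ^ e‖ =
      ‖c‖ * sinInt e := by
    intro c y
    rw [← setIntegral_abs_sin_sub_rpow e y, ← integral_const_mul]
    refine integral_congr_ae (Filter.Eventually.of_forall fun x => ?_)
    simp only [norm_mul]
    rw [Real.norm_of_nonneg (by positivity : 0 ≤ |Real.sin (x - y)| ^ e)]
  constructor
  · rw [IntegrableOn, volume_restrict_square]
    refine (integrable_prod_iff (f := fun p : ℝ × ℝ => g p.1 * |Real.sin (p.1 - p.2)| ^ e)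
      (hg.aestronglyMeasurable.comp_fst.mul hm.aestronglyMeasurable)).2
      ⟨Filter.Eventually.of_forall fun x => ?_, ?_⟩
    · simp only [abs_sin_sub_comm x]
      exact (integrableOn_abs_sin_sub_rpow he x).const_mul (g x)
    · have : (fun x => ∫ y in Set.Icc 0 (2 * Real.pi), ‖g x * |Real.sin (x - y)| ^ e‖) =
          fun x => ‖g x‖ * sinInt e := by
        funext x
        simp only [abs_sin_sub_comm x, hnorm]
      rw [this]
      exact hg.norm.mul_const _
  · rw [IntegrableOn, volume_restrict_square]
    refine (integrable_prod_iff' (f := fun p : ℝ × ℝ => g p.2 * |Real.sin (p.1 - p.2)| ^ e)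
      (hg.aestronglyMeasurable.comp_snd.mul hm.aestronglyMeasurable)).2
      ⟨Filter.Eventually.of_forall fun y => ?_, ?_⟩
    · exact (integrableOn_abs_sin_sub_rpow he y).const_mul (g y)
    · simp only [hnorm]
      exact hg.norm.mul_const _

theorem setIntegral_square_mul_abs_sin {e : ℝ} (he : -1 < e) {g : ℝ → ℝ}
    (hg : IntegrableOn g (Set.Icc 0 (2 * Real.pi))) :
    ∫ p in square, g p.1 * |Real.sin (p.1 - p.2)| ^ e =
      (∫ t in Set.Icc 0 (2 * Real.pi), g t) * sinInt e ∧
    ∫ p in square, g p.2 * |Real.sin (p.1 - p.2)| ^ e =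
      (∫ t in Set.Icc 0 (2 * Real.pi), g t) * sinInt e := by
  obtain ⟨h1, h2⟩ := integrableOn_square_mul_abs_sin he hg
  rw [IntegrableOn, volume_restrict_square] at h1 h2
  rw [volume_restrict_square, integral_prod _ h1, integral_prod_symm _ h2, ← integral_mul_const]
  constructor <;> refine integral_congr_ae (Filter.Eventually.of_forall fun x => ?_)
  · simp only [integral_const_mul, abs_sin_sub_comm x, setIntegral_abs_sin_sub_rpow]
  · simp only [integral_const_mul, setIntegral_abs_sin_sub_rpow]

theorem V.contDiff_onCircle {τ : ℂ} (v : V τ) : ContDiff ℝ ∞ (V.onCircle v) :=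
  v.2.2.2.comp_contDiff contDiff_circ circ_ne_zero

theorem V.exists_bound_onCircle {τ : ℂ} (v : V τ) : ∃ M, ∀ θ, ‖V.onCircle v θ‖ ≤ M := by
  obtain ⟨M, hM⟩ := Biperiodic.exists_bound (f := fun p : ℝ × ℝ => V.onCircle v p.1)
    ⟨fun p => by simp [V.onCircle, circ_add_two_pi], fun p => by simp⟩
    ((V.contDiff_onCircle v).continuous.comp continuous_fst)
  exact ⟨M, fun θ => hM (θ, 0)⟩

/-- The invariant form is at most the `L²` norm on the circle; in the complementary series this is
Schur's test for the positive kernel. -/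
theorem V.normSq_le {τ : ℂ} (hτ : IsClassOneParam τ) (v : V τ) :
    V.normSq v ≤ (2 * Real.pi)⁻¹ * ∫ θ in Set.Icc 0 (2 * Real.pi), ‖V.onCircle v θ‖ ^ 2 := by
  unfold V.normSq
  split_ifs with h0
  · exact le_rfl
  have hτ' : -1 < τ.re ∧ τ.re < 0 := by
    rcases hτ with h | h
    · exact absurd h h0
    · exact h.2
  have he : -1 < -1 - τ.re := by linarith [hτ'.2]
  obtain ⟨M, hM⟩ := V.exists_bound_onCircle v
  have hc := (V.contDiff_onCircle v).continuous
  have hsq : IntegrableOn (fun t => ‖V.onCircle v t‖ ^ 2) (Set.Icc 0 (2 * Real.pi)) :=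
    (hc.norm.pow 2).continuousOn.integrableOn_compact isCompact_Icc
  obtain ⟨i1, i2⟩ := integrableOn_square_mul_abs_sin he hsq
  obtain ⟨e1, e2⟩ := setIntegral_square_mul_abs_sin he hsq
  have i3 := (integrableOn_square_mul_abs_sin he (g := fun _ => 1) (integrable_const _)).1
  have e3 := (setIntegral_square_mul_abs_sin he (g := fun _ => 1) (integrable_const _)).1
  simp only [one_mul] at i3
  simp only [one_mul, integral_const, MeasurableSet.univ, measureReal_restrict_apply,
    Set.univ_inter, smul_eq_mul, mul_one, Real.volume_real_Icc, sub_zero,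
    max_eq_left Real.two_pi_pos.le] at e3
  set A := ∫ θ in Set.Icc 0 (2 * Real.pi), ‖V.onCircle v θ‖ ^ 2 with hA
  have hA0 : 0 ≤ A := integral_nonneg fun _ => by positivity
  have key : ∫ p in square, (V.onCircle v p.1 * conj (V.onCircle v p.2)).re *
      |Real.sin (p.1 - p.2)| ^ (-1 - τ.re) ≤ A * sinInt (-1 - τ.re) := by
    have h1 : ∫ p in square, (V.onCircle v p.1 * conj (V.onCircle v p.2)).re *
        |Real.sin (p.1 - p.2)| ^ (-1 - τ.re) ≤
        ∫ p in square, ((1 / 2) * (‖V.onCircle v p.1‖ ^ 2 * |Real.sin (p.1 - p.2)| ^ (-1 - τ.re)) +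
          (1 / 2) * (‖V.onCircle v p.2‖ ^ 2 * |Real.sin (p.1 - p.2)| ^ (-1 - τ.re))) := by
      refine integral_mono ?_ ((i1.const_mul _).add (i2.const_mul _)) fun p => ?_
      · refine i3.bdd_mul (c := M * M) ?_
          (Filter.Eventually.of_forall fun p => ?_)
        · exact (Complex.continuous_re.comp ((hc.comp continuous_fst).mul
            (Complex.continuous_conj.comp (hc.comp continuous_snd)))).aestronglyMeasurable
        · refine (Complex.abs_re_le_norm _).trans ?_
          rw [norm_mul, RCLike.norm_conj]
          exact mul_le_mul (hM _) (hM _) (norm_nonneg _) ((norm_nonneg _).trans (hM p.1))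
      · have h2 : (V.onCircle v p.1 * conj (V.onCircle v p.2)).re ≤
            1 / 2 * ‖V.onCircle v p.1‖ ^ 2 + 1 / 2 * ‖V.onCircle v p.2‖ ^ 2 := by
          refine (Complex.re_le_norm _).trans ?_
          rw [norm_mul, RCLike.norm_conj]
          nlinarith [sq_nonneg (‖V.onCircle v p.1‖ - ‖V.onCircle v p.2‖)]
        have h3 : 0 ≤ |Real.sin (p.1 - p.2)| ^ (-1 - τ.re) := by positivity
        calc _ ≤ (1 / 2 * ‖V.onCircle v p.1‖ ^ 2 + 1 / 2 * ‖V.onCircle v p.2‖ ^ 2) *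
              |Real.sin (p.1 - p.2)| ^ (-1 - τ.re) := mul_le_mul_of_nonneg_right h2 h3
          _ = _ := by ring
    refine h1.trans (le_of_eq ?_)
    rw [integral_add (i1.const_mul _) (i2.const_mul _), integral_const_mul, integral_const_mul,
      e1, e2]
    ring
  rw [e3]
  rcases (sinInt_nonneg (-1 - τ.re)).eq_or_lt with h | h
  · rw [← h]
    simp only [mul_zero, div_zero]
    positivity
  · rw [div_le_iff₀ (mul_pos Real.two_pi_pos h)]
    refine key.trans (le_of_eq ?_)
    field_simp

section L2

variable {Γ : Subgroup PGL2R} [CompactSpace (AutSpace Γ)] {μ : Measure (AutSpace Γ)}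
  [IsProbabilityMeasure μ] {τ τ' : ℂ}

theorem ofReal_setIntegral_norm_sq {X : Type*} [MeasurableSpace X] [TopologicalSpace X]
    [OpensMeasurableSpace X] {m : Measure X} {s : Set X} (hs : m s ≠ ⊤) {f : X → ℂ}
    (hf : Continuous f) {M : ℝ} (hM : ∀ x, ‖f x‖ ≤ M) :
    ENNReal.ofReal (∫ x in s, ‖f x‖ ^ 2 ∂m) = ∫⁻ x in s, ‖f x‖ₑ ^ 2 ∂m := by
  have : IsFiniteMeasure (m.restrict s) := ⟨by simpa using hs.lt_top⟩
  have hi : Integrable (fun x => ‖f x‖ ^ 2) (m.restrict s) :=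
    Integrable.of_bound (hf.norm.pow 2).measurable.aestronglyMeasurable (M ^ 2)
      (Filter.Eventually.of_forall fun x => by
        rw [norm_pow, norm_norm]
        exact pow_le_pow_left₀ (norm_nonneg _) (hM x) 2)
  rw [ofReal_integral_eq_lintegral_ofReal hi (Filter.Eventually.of_forall fun x => by positivity)]
  simp_rw [ENNReal.ofReal_pow (norm_nonneg _), ofReal_norm]

theorem ofReal_integral_norm_sq {f : AutSpace Γ → ℂ} (hf : Continuous f) :
    ENNReal.ofReal (∫ x, ‖f x‖ ^ 2 ∂μ) = ∫⁻ x, ‖f x‖ₑ ^ 2 ∂μ := by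
  obtain ⟨M, hM⟩ := isCompact_univ.exists_bound_of_continuousOn hf.continuousOn
  have := ofReal_setIntegral_norm_sq (measure_ne_top μ Set.univ) hf (fun x => hM x trivial)
  simpa using this

theorem EnhancedRep.lintegral_le (hτ : IsClassOneParam τ) (ν : EnhancedRep μ τ) (v : V τ) :
    ∫⁻ x, ‖ν.ν v x‖ₑ ^ 2 ∂μ ≤ ENNReal.ofReal (2 * Real.pi)⁻¹ *
      ∫⁻ θ in Set.Icc 0 (2 * Real.pi), ‖V.onCircle v θ‖ₑ ^ 2 := by
  obtain ⟨M, hM⟩ := V.exists_bound_onCircle v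
  rw [← ofReal_integral_norm_sq (ν.continuous_apply v), ν.isometric,
    ← ofReal_setIntegral_norm_sq isCompact_Icc.measure_lt_top.ne
      (V.contDiff_onCircle v).continuous hM,
    ← ENNReal.ofReal_mul (by positivity)]
  exact ENNReal.ofReal_le_ofReal (V.normSq_le hτ v)

/-- The realisation is bounded from `L²(S¹ × S¹)` to `L²(X × X)`: the bounds for `ν'` and `ν` are
applied one variable at a time. -/
theorem lintegral_realisation_le (hτ : IsClassOneParam τ) (hτ' : IsClassOneParam τ')
    (ν : EnhancedRep μ τ) (ν' : EnhancedRep μ τ') (u : E τ τ') :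
    ∫⁻ x, ∫⁻ x', ‖realisation ν ν' u (x, x')‖ₑ ^ 2 ∂μ ∂μ ≤
      ENNReal.ofReal (2 * Real.pi)⁻¹ ^ 2 *
        ENNReal.ofReal (∫ p in square, ‖E.onTorus u p‖ ^ 2) := by
  have hm : Measurable fun p : AutSpace Γ × ℝ => ‖ν.ν (E.slice u (circ p.2)) p.1‖ₑ ^ 2 :=
    ((ν.continuous_slice u).comp continuous_swap).enorm.measurable.pow_const 2
  obtain ⟨M, hM⟩ := (E.biperiodic_onTorus u).exists_bound (E.contDiff_onTorus u).continuous
  have h1 : ∀ x, ∫⁻ x', ‖realisation ν ν' u (x, x')‖ₑ ^ 2 ∂μ ≤ ENNReal.ofReal (2 * Real.pi)⁻¹ *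
      ∫⁻ φ in Set.Icc 0 (2 * Real.pi), ‖ν.ν (E.slice u (circ φ)) x‖ₑ ^ 2 :=
    fun x => ν'.lintegral_le hτ' (E.fiber (ν.evalAt x) (ν.exists_isCkBounded_at x) u)
  refine (lintegral_mono h1).trans ?_
  rw [lintegral_const_mul _ hm.lintegral_prod_right', lintegral_lintegral_swap hm.aemeasurable]
  have h2 : ∀ φ, ∫⁻ x, ‖ν.ν (E.slice u (circ φ)) x‖ₑ ^ 2 ∂μ ≤ ENNReal.ofReal (2 * Real.pi)⁻¹ *
      ∫⁻ θ in Set.Icc 0 (2 * Real.pi), ‖E.onTorus u (θ, φ)‖ₑ ^ 2 :=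
    fun φ => ν.lintegral_le hτ (E.slice u (circ φ))
  refine (mul_le_mul_right (lintegral_mono h2) _).trans (le_of_eq ?_)
  have h3 : Measurable fun p : ℝ × ℝ => ‖E.onTorus u p‖ₑ ^ 2 :=
    (E.contDiff_onTorus u).continuous.enorm.measurable.pow_const 2
  rw [lintegral_const_mul' _ _ ENNReal.ofReal_ne_top, ← mul_assoc, ← pow_two,
    ofReal_setIntegral_norm_sq (s := square) isCompact_square.measure_lt_top.ne
      (E.contDiff_onTorus u).continuous hM, volume_restrict_square,
    lintegral_prod_symm' _ h3]

end L2

/-! ### Averages over compact sets of translates -/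

namespace AutSpace

variable {Γ : Subgroup PGL2R}

/-- The translates of `x` by the elements of `U`. -/
def orbit (U : Set PGL2R) (x : AutSpace Γ) : Set (AutSpace Γ) := (fun k => translate k x) '' U

theorem isOpen_orbit {U : Set PGL2R} (hU : IsOpen U) (x : AutSpace Γ) : IsOpen (orbit U x) := by
  obtain ⟨y, rfl⟩ := surjective_mk x
  have : orbit U (mk Γ y) = mk Γ '' ((fun k => y * k) '' U) := by
    rw [orbit, Set.image_image]
    rfl
  rw [this]
  exact isOpenQuotientMap_mk.isOpenMap _ (isOpenMap_mul_left y U hU)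

theorem exists_translate_eq (x z : AutSpace Γ) : ∃ g, translate g x = z := by
  obtain ⟨y, rfl⟩ := surjective_mk x
  obtain ⟨w, rfl⟩ := surjective_mk z
  exact ⟨y⁻¹ * w, by simp [translate_mk]⟩

variable {μ : Measure (AutSpace Γ)}

theorem measure_preimage_translate (hμ : ∀ g : PGL2R, μ.map (translate g) = μ) (g : PGL2R)
    {s : Set (AutSpace Γ)} (hs : MeasurableSet s) : μ (translate g ⁻¹' s) = μ s := by
  rw [← Measure.map_apply (continuous_translate_right g).measurable hs, hμ]

/-- Countably many translates of an open neighbourhood of the identity cover `G`, so that its orbits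
have positive measure. -/
theorem measure_orbit_pos [IsProbabilityMeasure μ]
    (hμ : ∀ g : PGL2R, μ.map (translate g) = μ) {U : Set PGL2R} (hU : IsOpen U) (h1 : 1 ∈ U)
    (x : AutSpace Γ) : 0 < μ (orbit U x) := by
  rw [pos_iff_ne_zero]
  intro h0
  obtain ⟨s, hs, hcov⟩ := TopologicalSpace.countable_cover_nhds
    (f := fun g : PGL2R => (fun w => w * g⁻¹) ⁻¹' U) (fun g =>
      (hU.preimage (continuous_mul_const g⁻¹)).mem_nhds (by simpa using h1))
  have huniv : (Set.univ : Set (AutSpace Γ)) ⊆ ⋃ g ∈ s, translate g⁻¹ ⁻¹' orbit U x := by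
    intro z _
    obtain ⟨w, rfl⟩ := exists_translate_eq x z
    have hw : w ∈ ⋃ g ∈ s, (fun w => w * g⁻¹) ⁻¹' U := by rw [hcov]; trivial
    simp only [Set.mem_iUnion, Set.mem_preimage] at hw ⊢
    obtain ⟨g, hg, hgU⟩ := hw
    exact ⟨g, hg, w * g⁻¹, hgU, (translate_translate _ _ _).symm⟩
  have hz : μ (⋃ g ∈ s, translate g⁻¹ ⁻¹' orbit U x) = 0 := by
    rw [measure_biUnion_null_iff hs]
    intro g _
    rw [measure_preimage_translate hμ _ (isOpen_orbit hU x).measurableSet, h0]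
  have := measure_mono_null huniv hz
  simp at this

/-- By compactness of `X`, the orbits of a neighbourhood of the identity have measure bounded
below. -/
theorem exists_le_measure_orbit [IsProbabilityMeasure μ] [CompactSpace (AutSpace Γ)]
    (hμ : ∀ g : PGL2R, μ.map (translate g) = μ) {U : Set PGL2R} (hU : U ∈ nhds 1) :
    ∃ δ : ℝ≥0∞, 0 < δ ∧ ∀ x : AutSpace Γ, δ ≤ μ (orbit U x) := by
  obtain ⟨V, hV, hVU⟩ := exists_nhds_split_inv hU
  obtain ⟨W, hWV, hWo, hW1⟩ := mem_nhds_iff.1 hV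
  have key : ∃ δ : ℝ≥0∞, 0 < δ ∧ ∀ x ∈ (Set.univ : Set (AutSpace Γ)), δ ≤ μ (orbit U x) := by
    refine isCompact_univ.induction_on
      (p := fun s => ∃ δ : ℝ≥0∞, 0 < δ ∧ ∀ x ∈ s, δ ≤ μ (orbit U x)) ⟨1, one_pos, by simp⟩
      (fun s t hst ⟨δ, h0, h⟩ => ⟨δ, h0, fun x hx => h x (hst hx)⟩)
      (fun s t ⟨δ, h0, h⟩ ⟨ε, h0', h'⟩ => ⟨min δ ε, lt_min h0 h0', ?_⟩) ?_
    · rintro x (hx | hx)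
      · exact (min_le_left _ _).trans (h x hx)
      · exact (min_le_right _ _).trans (h' x hx)
    · intro x _
      refine ⟨orbit W⁻¹ x, mem_nhdsWithin_of_mem_nhds
        ((isOpen_orbit hWo.inv x).mem_nhds ⟨1, by simpa using hW1, translate_one x⟩),
        μ (orbit W⁻¹ x), measure_orbit_pos hμ hWo.inv (by simpa using hW1) x, ?_⟩
      rintro x' ⟨v, hv, rfl⟩
      refine measure_mono ?_
      rintro _ ⟨w, hw, rfl⟩
      refine ⟨v⁻¹ * w, ?_, ?_⟩
      · simpa [div_eq_mul_inv] using hVU _ (hWV hv) _ (hWV hw)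
      · simp [translate_translate]
  obtain ⟨δ, h0, h⟩ := key
  exact ⟨δ, h0, fun x => h x trivial⟩

/-- Comparison of two averages over compact sets of translates, at a point and at a nearby point.
The modular character of `G` is bounded on compact sets: it is read off from the measures of the
translates of a compact set. -/
theorem measure_mul_lintegral_translate_le (m : Measure PGL2R) [m.IsHaarMeasure]
    {φ : AutSpace Γ → ℝ≥0∞} (hφ : Measurable φ) {K K' S S' : Set PGL2R} (hK : MeasurableSet K)
    (hK' : MeasurableSet K') (hS' : MeasurableSet S') {k : PGL2R}
    (hKk : ∀ g ∈ K, g * k ∈ K') (hSk : ∀ g ∈ S, g * k⁻¹ ∈ S') (x : AutSpace Γ) :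
    m S * ∫⁻ g in K, φ (translate g⁻¹ x) ∂m ≤
      m S' * ∫⁻ g in K', φ (translate g⁻¹ (translate k x)) ∂m := by
  have hmod := Measure.map_right_mul_eq_modularCharacterFun_smul m k⁻¹
  set d := Measure.modularCharacterFun k⁻¹
  have h1 : m S ≤ d * m S' := by
    have : m ((fun g => g * k⁻¹) ⁻¹' S') = d * m S' := by
      rw [← Measure.map_apply (measurable_mul_const _) hS', hmod]
      rfl
    rw [← this]
    exact measure_mono hSk
  have hmeas : Measurable fun g : PGL2R => φ (translate g⁻¹ x) :=
    hφ.comp (continuous_translate.comp (continuous_const.prodMk continuous_inv)).measurable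
  have h2 : d * ∫⁻ g in K, φ (translate g⁻¹ x) ∂m ≤
      ∫⁻ g in K', φ (translate g⁻¹ (translate k x)) ∂m := by
    have e : ∫⁻ g in K', φ (translate g⁻¹ (translate k x)) ∂m =
        ∫⁻ g, ((fun g => g * k) ⁻¹' K').indicator (fun g => φ (translate g⁻¹ x)) g
          ∂(m.map (fun g => g * k⁻¹)) := by
      rw [lintegral_map (hmeas.indicator (measurable_mul_const k hK')) (measurable_mul_const _),
        ← lintegral_indicator hK']
      refine lintegral_congr fun g => ?_
      by_cases hg : g ∈ K' <;> simp [Set.indicator, hg, translate_translate]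
    rw [e, hmod, ← lintegral_indicator hK]
    rw [show (d • m) = ((d : ℝ≥0∞) • m) from rfl, lintegral_smul_measure, smul_eq_mul]
    gcongr with g
    exact hKk
  calc m S * ∫⁻ g in K, φ (translate g⁻¹ x) ∂m
      ≤ d * m S' * ∫⁻ g in K, φ (translate g⁻¹ x) ∂m := by gcongr
    _ = m S' * (d * ∫⁻ g in K, φ (translate g⁻¹ x) ∂m) := by ring
    _ ≤ _ := by gcongr

open scoped Pointwise in
/-- Averages over a compact set of translates are bounded by the integral, uniformly in the base
point. -/
theorem exists_lintegral_translate_le [IsProbabilityMeasure μ] [CompactSpace (AutSpace Γ)]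
    (hμ : ∀ g : PGL2R, μ.map (translate g) = μ) (m : Measure PGL2R) [m.IsHaarMeasure]
    {K : Set PGL2R} (hK : IsCompact K) :
    ∃ C : ℝ≥0∞, C ≠ ⊤ ∧ ∀ φ : AutSpace Γ → ℝ≥0∞, Measurable φ → ∀ x,
      ∫⁻ g in K, φ (translate g⁻¹ x) ∂m ≤ C * ∫⁻ x, φ x ∂μ := by
  obtain ⟨U, hUc, hU1⟩ := exists_compact_mem_nhds (1 : PGL2R)
  obtain ⟨δ, hδ, hδU⟩ := exists_le_measure_orbit (Γ := Γ) hμ (interior_mem_nhds.2 hU1)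
  set K' := K * U
  set S' := U * U⁻¹
  have hK' : IsCompact K' := hK.mul hUc
  have hS' : IsCompact S' := hUc.mul hUc.inv
  have hU0 : 0 < m U := hU1 |> Measure.measure_pos_of_mem_nhds m
  have hδt : δ ≠ ⊤ := ((hδU (mk Γ 1)).trans_lt (measure_lt_top _ _)).ne
  refine ⟨(δ * m U)⁻¹ * (m S' * m K'), ?_, fun φ hφ x => ?_⟩
  · refine ENNReal.mul_ne_top (ENNReal.inv_ne_top.2 (ENNReal.mul_pos hδ.ne' hU0.ne').ne') ?_
    exact ENNReal.mul_ne_top hS'.measure_lt_top.ne hK'.measure_lt_top.ne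
  have hmeas : Measurable fun p : AutSpace Γ × PGL2R => φ (translate p.2⁻¹ p.1) :=
    hφ.comp (continuous_translate.comp
      (continuous_fst.prodMk (continuous_snd.inv))).measurable
  have h1 : δ * m U * ∫⁻ g in K, φ (translate g⁻¹ x) ∂m ≤ m S' * m K' * ∫⁻ x, φ x ∂μ := by
    calc δ * m U * ∫⁻ g in K, φ (translate g⁻¹ x) ∂m
        ≤ μ (orbit (interior U) x) * (m U * ∫⁻ g in K, φ (translate g⁻¹ x) ∂m) := by
          rw [mul_assoc]
          gcongr
          exact hδU x
      _ = ∫⁻ _ in orbit (interior U) x, (m U * ∫⁻ g in K, φ (translate g⁻¹ x) ∂m) ∂μ := by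
          rw [setLIntegral_const, mul_comm]
      _ ≤ ∫⁻ z in orbit (interior U) x, (m S' * ∫⁻ g in K', φ (translate g⁻¹ z) ∂m) ∂μ := by
          refine setLIntegral_mono' (isOpen_orbit isOpen_interior x).measurableSet ?_
          rintro _ ⟨k, hk, rfl⟩
          refine measure_mul_lintegral_translate_le m hφ hK.measurableSet hK'.measurableSet
            hS'.measurableSet (fun g hg => ?_) (fun g hg => ?_) x
          · exact Set.mul_mem_mul hg (interior_subset hk)
          · exact Set.mul_mem_mul hg (Set.inv_mem_inv.2 (interior_subset hk))
      _ ≤ ∫⁻ z, (m S' * ∫⁻ g in K', φ (translate g⁻¹ z) ∂m) ∂μ := setLIntegral_le_lintegral _ _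
      _ = m S' * ∫⁻ g in K', (∫⁻ z, φ (translate g⁻¹ z) ∂μ) ∂m := by
          rw [lintegral_const_mul _ hmeas.lintegral_prod_right',
            lintegral_lintegral_swap hmeas.aemeasurable]
      _ = m S' * ∫⁻ g in K', (∫⁻ z, φ z ∂μ) ∂m := by
          congr 2
          funext g
          rw [← lintegral_map hφ (continuous_translate_right g⁻¹).measurable, hμ]
      _ = m S' * m K' * ∫⁻ x, φ x ∂μ := by rw [setLIntegral_const]; ring
  have hc0 : δ * m U ≠ 0 := (ENNReal.mul_pos hδ.ne' hU0.ne').ne'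
  have hct : δ * m U ≠ ⊤ := ENNReal.mul_ne_top hδt hUc.measure_lt_top.ne
  calc ∫⁻ g in K, φ (translate g⁻¹ x) ∂m
      = (δ * m U)⁻¹ * (δ * m U * ∫⁻ g in K, φ (translate g⁻¹ x) ∂m) := by
        rw [← mul_assoc, ENNReal.inv_mul_cancel hc0 hct, one_mul]
    _ ≤ (δ * m U)⁻¹ * (m S' * m K' * ∫⁻ x, φ x ∂μ) := by gcongr
    _ = _ := by ring

/-- The two-variable form of the bound for averages of translates: moving the diagonal of `X × X`
by a compact set of pairs spreads it over `X × X` with bounded density. -/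
theorem exists_lintegral_diag_translate_le [IsProbabilityMeasure μ] [CompactSpace (AutSpace Γ)]
    (hμ : ∀ g : PGL2R, μ.map (translate g) = μ) (m : Measure PGL2R) [m.IsHaarMeasure]
    {K : Set PGL2R} (hK : IsCompact K) :
    ∃ C : ℝ≥0∞, C ≠ ⊤ ∧ ∀ F : AutSpace Γ × AutSpace Γ → ℝ≥0∞, Measurable F →
      ∫⁻ g in K ×ˢ K, (∫⁻ x, F (translate g.1⁻¹ x, translate g.2⁻¹ x) ∂μ) ∂(m.prod m) ≤
        C * ∫⁻ z, ∫⁻ z', F (z, z') ∂μ ∂μ := by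
  obtain ⟨C, hC, hCK⟩ := exists_lintegral_translate_le (Γ := Γ) hμ m hK
  refine ⟨C * C, ENNReal.mul_ne_top hC hC, fun F hFm => ?_⟩
  have hcont : Continuous fun q : (PGL2R × PGL2R) × AutSpace Γ =>
      (translate q.1.1⁻¹ q.2, translate q.1.2⁻¹ q.2) :=
    (continuous_translate.comp (continuous_snd.prodMk continuous_fst.fst.inv)).prodMk
      (continuous_translate.comp (continuous_snd.prodMk continuous_fst.snd.inv))
  have hm3 : Measurable fun q : (PGL2R × PGL2R) × AutSpace Γ =>
      F (translate q.1.1⁻¹ q.2, translate q.1.2⁻¹ q.2) := hFm.comp hcont.measurable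
  have h3 : ∀ x : AutSpace Γ, ∫⁻ g in K ×ˢ K,
      F (translate g.1⁻¹ x, translate g.2⁻¹ x) ∂(m.prod m) ≤
        C * C * ∫⁻ z, ∫⁻ z', F (z, z') ∂μ ∂μ := by
    intro x
    have hmx : Measurable fun g : PGL2R × PGL2R => F (translate g.1⁻¹ x, translate g.2⁻¹ x) :=
      hm3.comp (measurable_id.prodMk measurable_const)
    rw [← Measure.prod_restrict, lintegral_prod _ hmx.aemeasurable]
    have h4 : ∀ g : PGL2R, ∫⁻ g' in K, F (translate g⁻¹ x, translate g'⁻¹ x) ∂m ≤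
        C * ∫⁻ z', F (translate g⁻¹ x, z') ∂μ := fun g =>
      hCK (fun z' => F (translate g⁻¹ x, z')) (hFm.comp measurable_prodMk_left) x
    refine (lintegral_mono h4).trans ?_
    have hm5 : Measurable fun z => ∫⁻ z', F (z, z') ∂μ := hFm.lintegral_prod_right'
    rw [lintegral_const_mul' _ _ hC, mul_assoc]
    gcongr
    exact hCK _ hm5 x
  rw [lintegral_lintegral_swap hm3.aemeasurable]
  refine (lintegral_mono h3).trans (le_of_eq ?_)
  rw [lintegral_const, measure_univ, mul_one]

end AutSpace

/-- The squared `L²` norm of a bounded realisation of `E` on a finite measure space is a continuous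
Hermitian form. -/
theorem integral_norm_sq_mem_hermCone {τ τ' : ℂ} {Z : Type*} [MeasurableSpace Z] {κ : Measure Z}
    [IsFiniteMeasure κ] (L : E τ τ' →ₗ[ℂ] (Z → ℂ)) (hm : ∀ u, Measurable (L u))
    (hb : ∃ (k : ℕ) (C : ℝ), ∀ (u : E τ τ') (M : ℝ),
      (∀ j ≤ k, ∀ p, ‖iteratedFDeriv ℝ j (E.onTorus u) p‖ ≤ M) → ∀ z, ‖L u z‖ ≤ C * M) :
    (fun u => ∫ z, ‖L u z‖ ^ 2 ∂κ) ∈ hermCone τ τ' := by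
  obtain ⟨k, C, hC⟩ := hb
  have hbd : ∀ u, ∃ M, ∀ z, ‖L u z‖ ≤ M := fun u => by
    obtain ⟨M, hM⟩ := (E.biperiodic_onTorus u).exists_bound_iteratedFDeriv (E.contDiff_onTorus u) k
    exact ⟨C * M, hC u M hM⟩
  have hi : ∀ u v : E τ τ', Integrable (fun z => conj (L u z) * L v z) κ := by
    intro u v
    obtain ⟨M, hM⟩ := hbd u
    obtain ⟨M', hM'⟩ := hbd v
    refine Integrable.of_bound
      ((Complex.continuous_conj.measurable.comp (hm u)).mul (hm v)).aestronglyMeasurable (M * M')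
      (Filter.Eventually.of_forall fun z => ?_)
    rw [norm_mul, RCLike.norm_conj]
    exact mul_le_mul (hM z) (hM' z) (norm_nonneg _) ((norm_nonneg _).trans (hM z))
  refine ⟨⟨LinearMap.mk₂'ₛₗ (starRingEnd ℂ) (RingHom.id ℂ) (fun u v =>
      ∫ z, conj (L u z) * L v z ∂κ) ?_ ?_ ?_ ?_, ?_, ?_⟩,
    fun u => integral_nonneg fun _ => by positivity, ?_⟩
  · intro u u' v
    rw [← integral_add (hi _ _) (hi _ _)]
    simp [add_mul]
  · intro c u v
    rw [smul_eq_mul, ← integral_const_mul]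
    simp [mul_assoc]
  · intro u v v'
    rw [← integral_add (hi _ _) (hi _ _)]
    simp [mul_add]
  · intro c u v
    rw [RingHom.id_apply, smul_eq_mul, ← integral_const_mul]
    simp [mul_left_comm]
  · intro u v
    simp only [LinearMap.mk₂'ₛₗ_apply]
    rw [← integral_conj]
    simp [mul_comm]
  · intro u
    simp only [LinearMap.mk₂'ₛₗ_apply]
    rw [← integral_complex_ofReal]
    refine integral_congr_ae (Filter.Eventually.of_forall fun x => ?_)
    simp only [Complex.conj_mul', Complex.ofReal_pow]
  · refine ⟨k, C ^ 2 * κ.real Set.univ, fun u M hM => ?_⟩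
    have hb : ∀ z, ‖‖L u z‖ ^ 2‖ ≤ C ^ 2 * M ^ 2 := by
      intro z
      rw [norm_pow, norm_norm, ← mul_pow]
      exact pow_le_pow_left₀ (norm_nonneg _) (hC u M hM z) 2
    have := norm_integral_le_of_norm_le_const (μ := κ) (Filter.Eventually.of_forall hb)
    exact (Real.le_norm_self _).trans (this.trans (le_of_eq (by ring)))

theorem continuous_realisation_diag {Γ : Subgroup PGL2R} {μ : Measure (AutSpace Γ)} {τ τ' : ℂ}
    (ν : EnhancedRep μ τ) (ν' : EnhancedRep μ τ') (u : E τ τ') :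
    Continuous fun x => realisation ν ν' u (x, x) :=
  (continuous_realisation ν ν' u).comp (continuous_id.prodMk continuous_id)

theorem diagForm_mem_hermCone {Γ : Subgroup PGL2R} {μ : Measure (AutSpace Γ)} [IsFiniteMeasure μ]
    {τ τ' : ℂ} (ν : EnhancedRep μ τ) (ν' : EnhancedRep μ τ') :
    diagForm μ (realisation ν ν') ∈ hermCone τ τ' := by
  refine integral_norm_sq_mem_hermCone (κ := μ)
    ((LinearMap.funLeft ℂ ℂ fun x : AutSpace Γ => (x, x)).comp (realisation ν ν'))
    (fun u => (continuous_realisation_diag ν ν' u).measurable) ?_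
  obtain ⟨k, C, hC⟩ := (isRealisation_realisation ν ν').continuous
  exact ⟨k, C, fun u M hM x => hC u M hM (x, x)⟩

section Diagonal

variable {Γ : Subgroup PGL2R} [CompactSpace (AutSpace Γ)] {μ : Measure (AutSpace Γ)}
  [IsProbabilityMeasure μ] {τ τ' : ℂ}

theorem ofReal_diagForm_act (ν : EnhancedRep μ τ) (ν' : EnhancedRep μ τ') (u : E τ τ')
    (g : PGL2R × PGL2R) :
    ENNReal.ofReal (diagForm μ (realisation ν ν') (E.act g u)) =
      ∫⁻ x, ‖realisation ν ν' u (AutSpace.translate g.1 x, AutSpace.translate g.2 x)‖ₑ ^ 2 ∂μ := by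
  rw [diagForm, ofReal_integral_norm_sq (continuous_realisation_diag ν ν' _)]
  simp only [realisation_act]

/-- The smoothed diagonal form is bounded by the `L²` norm: smoothing spreads the diagonal of
`X × X` over all of `X × X`. -/
theorem exists_smoothedValue_diagForm_le
    (hμ : ∀ g : PGL2R, μ.map (AutSpace.translate g) = μ) (m : Measure PGL2R) [m.IsHaarMeasure]
    {h : PGL2R × PGL2R → ℝ} (hc : Continuous h) (hs : HasCompactSupport h) :
    ∃ C : ℝ≥0∞, C ≠ ⊤ ∧ ∀ {τ τ' : ℂ}, IsClassOneParam τ → IsClassOneParam τ' →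
      ∀ (ν : EnhancedRep μ τ) (ν' : EnhancedRep μ τ') (u : E τ τ'),
      smoothedValue m h u (diagForm μ (realisation ν ν')) ≤
        C * ENNReal.ofReal (∫ p in square, ‖E.onTorus u p‖ ^ 2) := by
  obtain ⟨H, hH⟩ := hc.bounded_above_of_compact_support hs
  set K : Set PGL2R := Prod.fst '' tsupport h ∪ Prod.snd '' tsupport h with hKdef
  have hK : IsCompact K :=
    (hs.isCompact.image continuous_fst).union (hs.isCompact.image continuous_snd)
  obtain ⟨C, hC, hCK⟩ := AutSpace.exists_lintegral_diag_translate_le (Γ := Γ) hμ m hK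
  refine ⟨ENNReal.ofReal H * C * ENNReal.ofReal (2 * Real.pi)⁻¹ ^ 2, ?_,
    fun {τ τ'} hτ hτ' ν ν' u => ?_⟩
  · exact ENNReal.mul_ne_top (ENNReal.mul_ne_top ENNReal.ofReal_ne_top hC)
      (ENNReal.pow_ne_top ENNReal.ofReal_ne_top)
  have hFm : Measurable fun p => ‖realisation ν ν' u p‖ₑ ^ 2 :=
    (continuous_realisation ν ν' u).enorm.measurable.pow_const 2
  have h1 : ∀ g : PGL2R × PGL2R,
      ENNReal.ofReal (h g * diagForm μ (realisation ν ν') (E.act g⁻¹ u)) ≤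
        (K ×ˢ K).indicator (fun g => ENNReal.ofReal H *
          ∫⁻ x, ‖realisation ν ν' u (AutSpace.translate g.1⁻¹ x,
            AutSpace.translate g.2⁻¹ x)‖ₑ ^ 2 ∂μ) g := by
    intro g
    by_cases hg : h g = 0
    · simp [hg]
    have hgK : g ∈ K ×ˢ K := by
      have : g ∈ tsupport h := subset_tsupport h hg
      exact ⟨Or.inl ⟨g, this, rfl⟩, Or.inr ⟨g, this, rfl⟩⟩
    rw [Set.indicator_of_mem hgK]
    have h0 : 0 ≤ diagForm μ (realisation ν ν') (E.act g⁻¹ u) :=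
      integral_nonneg fun _ => by positivity
    have h2 := ofReal_diagForm_act ν ν' u g⁻¹
    rw [Prod.fst_inv, Prod.snd_inv] at h2
    rw [← h2, ← ENNReal.ofReal_mul ((norm_nonneg _).trans (hH g))]
    exact ENNReal.ofReal_le_ofReal
      (mul_le_mul_of_nonneg_right ((Real.le_norm_self _).trans (hH g)) h0)
  refine (lintegral_mono h1).trans ?_
  rw [lintegral_indicator (hK.measurableSet.prod hK.measurableSet),
    lintegral_const_mul' _ _ ENNReal.ofReal_ne_top, mul_assoc, mul_assoc]
  refine mul_le_mul_right ((hCK _ hFm).trans ?_) _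
  exact mul_le_mul_right (lintegral_realisation_le hτ hτ' ν ν' u) _

end Diagonal

/-! ### Continuity of Hermitian forms along orbits -/

/-- The derivatives in the second variable of a function that is smooth in both variables are
jointly continuous. -/
theorem continuousOn_iteratedFDeriv_right {X Y F : Type*} [NormedAddCommGroup X] [NormedSpace ℝ X]
    [NormedAddCommGroup Y] [NormedSpace ℝ Y] [NormedAddCommGroup F] [NormedSpace ℝ F]
    {f : X × Y → F} {S : Set X} (hS : IsOpen S) (hf : ContDiffOn ℝ ∞ f (S ×ˢ Set.univ)) (j : ℕ) :
    ContinuousOn (fun q : X × Y => iteratedFDeriv ℝ j (fun y => f (q.1, y)) q.2)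
      (S ×ˢ Set.univ) := by
  have hSo : IsOpen (S ×ˢ (Set.univ : Set Y)) := hS.prod isOpen_univ
  have key : ∀ q ∈ S ×ˢ (Set.univ : Set Y), iteratedFDeriv ℝ j (fun y => f (q.1, y)) q.2 =
      (iteratedFDeriv ℝ j f q).compContinuousLinearMap
        (fun _ => ContinuousLinearMap.inr ℝ X Y) := by
    rintro ⟨a, y⟩ ⟨ha, -⟩
    set T : Set (X × Y) := (fun w => w + (a, 0)) ⁻¹' (S ×ˢ Set.univ)
    have hT : IsOpen T := hSo.preimage (continuous_add_const _)
    have hfT : ContDiffOn ℝ ∞ (fun w => f (w + (a, 0))) T :=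
      hf.comp (contDiff_id.add contDiff_const).contDiffOn fun w hw => hw
    have hpre : ContinuousLinearMap.inr ℝ X Y ⁻¹' T = Set.univ := by
      ext z
      simpa [T] using ha
    have h0 : ContinuousLinearMap.inr ℝ X Y y ∈ T := by simpa [T] using ha
    have h1 := ContinuousLinearMap.iteratedFDerivWithin_comp_right (ContinuousLinearMap.inr ℝ X Y)
      hfT hT.uniqueDiffOn (by rw [hpre]; exact uniqueDiffOn_univ) h0 (i := j)
      (by exact_mod_cast le_top)
    rw [hpre, iteratedFDerivWithin_univ, iteratedFDerivWithin_of_isOpen j hT h0,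
      iteratedFDeriv_comp_add_right] at h1
    have e1 : (fun w => f (w + (a, 0))) ∘ ContinuousLinearMap.inr ℝ X Y = fun y => f (a, y) := by
      funext z
      simp
    have e2 : ContinuousLinearMap.inr ℝ X Y y + (a, 0) = (a, y) := by simp
    rw [e1, e2] at h1
    exact h1
  refine ContinuousOn.congr ?_ key
  have h2 : ContinuousOn (iteratedFDeriv ℝ j f) (S ×ˢ Set.univ) :=
    (hf.continuousOn_iteratedFDerivWithin (by exact_mod_cast le_top) hSo.uniqueDiffOn).congr
      fun q hq => (iteratedFDerivWithin_of_isOpen j hSo hq).symm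
  exact (ContinuousMultilinearMap.compContinuousLinearMapL
    (fun _ => ContinuousLinearMap.inr ℝ X Y)).continuous.comp_continuousOn h2

section Forms

variable {τ τ' : ℂ}

/-- The Cauchy–Schwarz inequality for a nonnegative Hermitian form, with a weight `δ`. -/
theorem IsHermitianQuad.abs_add_sub_le {q : E τ τ' → ℝ} (hq : IsHermitianQuad q)
    (h0 : ∀ u, 0 ≤ q u) (x y : E τ τ') {δ : ℝ} (hδ : 0 < δ) :
    |q (x + y) - q x| ≤ q y + δ * q x + δ⁻¹ * q y := by
  obtain ⟨B, hB, hqB⟩ := hq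
  have hBl : ∀ x y z, B (x + y) z = B x z + B y z := fun x y z => by
    rw [map_add, LinearMap.add_apply]
  have hBc : ∀ (c : ℂ) x z, B (c • x) z = conj c * B x z := fun c x z => by
    rw [map_smulₛₗ, LinearMap.smul_apply, smul_eq_mul]
  have hBr : ∀ (c : ℂ) x z, B x (c • z) = c * B x z := fun c x z => by
    rw [map_smul, smul_eq_mul]
  have hadd : ∀ x y : E τ τ', q (x + y) = q x + q y + 2 * (B x y).re := by
    intro x y
    have : ((q (x + y) : ℝ) : ℂ) = ((q x + q y + 2 * (B x y).re : ℝ) : ℂ) := by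
      push_cast
      rw [hqB, hBl, map_add, map_add, hqB, hqB, hB x y]
      have key := Complex.add_conj (B x y)
      push_cast at key
      linear_combination key
    exact_mod_cast this
  have hsm : ∀ (t : ℝ) (x : E τ τ'), q ((t : ℂ) • x) = t ^ 2 * q x := by
    intro t x
    have : ((q ((t : ℂ) • x) : ℝ) : ℂ) = ((t ^ 2 * q x : ℝ) : ℂ) := by
      push_cast
      rw [hqB, hqB, hBc, hBr, Complex.conj_ofReal]
      ring
    exact_mod_cast this
  have hsq : Real.sqrt δ ^ 2 = δ := Real.sq_sqrt hδ.le
  have hs : Real.sqrt δ ≠ 0 := (Real.sqrt_pos.2 hδ).ne'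
  have hre : ∀ r : ℝ, r ≠ 0 → 0 ≤ r ^ 2 * q x + (r⁻¹) ^ 2 * q y + 2 * (B x y).re := by
    intro r hr
    have h := h0 ((r : ℂ) • x + ((r⁻¹ : ℝ) : ℂ) • y)
    rw [hadd, hsm, hsm, hBc, hBr, Complex.conj_ofReal, ← mul_assoc, ← Complex.ofReal_mul,
      mul_inv_cancel₀ hr, Complex.ofReal_one, one_mul] at h
    exact h
  have hre' : ∀ r : ℝ, r ≠ 0 → 0 ≤ r ^ 2 * q x + (r⁻¹) ^ 2 * q y - 2 * (B x y).re := by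
    intro r hr
    have h := h0 ((r : ℂ) • x + ((-r⁻¹ : ℝ) : ℂ) • y)
    rw [hadd, hsm, hsm, hBc, hBr, Complex.conj_ofReal, ← mul_assoc, ← Complex.ofReal_mul, mul_neg,
      mul_inv_cancel₀ hr, Complex.ofReal_neg, Complex.ofReal_one, neg_one_mul,
      Complex.neg_re, neg_sq] at h
    linarith
  have h1 := hre _ hs
  have h2 := hre' _ hs
  rw [inv_pow, hsq] at h1 h2
  have hy := h0 y
  rw [hadd, abs_le]
  constructor <;> linarith

/-- A continuous Hermitian form is continuous along a family of vectors that is continuous in every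
`C^k` norm. -/
theorem continuousAt_hermCone {A : Type*} [TopologicalSpace A] {q : E τ τ' → ℝ}
    (hq : q ∈ hermCone τ τ') {v : A → E τ τ'} {a₀ : A}
    (hv : ∀ (k : ℕ) (ε : ℝ), 0 < ε → ∀ᶠ a in nhds a₀, ∀ j ≤ k, ∀ p,
      ‖iteratedFDeriv ℝ j (E.onTorus (v a - v a₀)) p‖ ≤ ε) :
    ContinuousAt (fun a => q (v a)) a₀ := by
  obtain ⟨hH, h0, k, C, hC⟩ := hq
  rw [Metric.continuousAt_iff']
  intro ε hε
  set R := 2 * |C| + q (v a₀) + 1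
  have hR : 0 < R := by have := h0 (v a₀); positivity
  set δ := min 1 (ε / R)
  have hδ : 0 < δ := lt_min one_pos (by positivity)
  have hδ1 : δ ≤ 1 := min_le_left _ _
  have hδR : δ * R ≤ ε := by
    have : δ ≤ ε / R := min_le_right _ _
    rwa [le_div_iff₀ hR] at this
  filter_upwards [hv k δ hδ] with a ha
  have h1 := hC _ _ ha
  have h2 := hH.abs_add_sub_le h0 (v a₀) (v a - v a₀) hδ
  rw [add_sub_cancel] at h2
  rw [Real.dist_eq]
  have h3 : q (v a - v a₀) ≤ |C| * δ ^ 2 :=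
    h1.trans (mul_le_mul_of_nonneg_right (le_abs_self C) (by positivity))
  have h4 : δ⁻¹ * q (v a - v a₀) ≤ |C| * δ := by
    calc δ⁻¹ * q (v a - v a₀) ≤ δ⁻¹ * (|C| * δ ^ 2) := by gcongr
      _ = |C| * δ := by field_simp
  have h5 : |C| * δ ^ 2 ≤ |C| * δ := by
    have : δ ^ 2 ≤ δ := by nlinarith
    gcongr
  calc |q (v a) - q (v a₀)| ≤ |C| * δ + δ * q (v a₀) + |C| * δ := by linarith
    _ < δ * R := by simp only [R]; nlinarith
    _ ≤ ε := hδR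

/-- The pairs of invertible matrices. -/
def invertiblePairs : Set ((Fin 2 → Fin 2 → ℝ) × (Fin 2 → Fin 2 → ℝ)) :=
  {A | (Matrix.of A.1).det ≠ 0 ∧ (Matrix.of A.2).det ≠ 0}

theorem continuous_det_coe : Continuous fun A : Fin 2 → Fin 2 → ℝ => (Matrix.of A).det :=
  Continuous.matrix_det (continuous_id : Continuous fun A : Matrix (Fin 2) (Fin 2) ℝ => A)

theorem isOpen_invertiblePairs : IsOpen invertiblePairs :=
  (isOpen_ne_fun (continuous_det_coe.comp continuous_fst) continuous_const).inter
    (isOpen_ne_fun (continuous_det_coe.comp continuous_snd) continuous_const)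

theorem contDiff_of_mulVec : ContDiff ℝ ∞ fun p : (Fin 2 → Fin 2 → ℝ) × Plane =>
    (Matrix.of p.1).mulVec p.2 := by
  rw [contDiff_pi]
  intro i
  simp only [Matrix.mulVec, dotProduct, Matrix.of_apply]
  fun_prop

theorem of_mulVec_ne_zero {A : Fin 2 → Fin 2 → ℝ} (hA : (Matrix.of A).det ≠ 0) {x : Plane}
    (hx : x ≠ 0) : (Matrix.of A).mulVec x ≠ 0 :=
  mulVec_ne_zero (Matrix.GeneralLinearGroup.mkOfDetNeZero (Matrix.of A) hA) hx

theorem contDiffOn_comp_mulVec (u : E τ τ') :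
    ContDiffOn ℝ ∞ (fun q : ((Fin 2 → Fin 2 → ℝ) × (Fin 2 → Fin 2 → ℝ)) × (ℝ × ℝ) =>
      u.1 ((Matrix.of q.1.1).mulVec (circ q.2.1)) ((Matrix.of q.1.2).mulVec (circ q.2.2)))
      (invertiblePairs ×ˢ Set.univ) := by
  have h1 : ContDiff ℝ ∞ fun q : ((Fin 2 → Fin 2 → ℝ) × (Fin 2 → Fin 2 → ℝ)) × (ℝ × ℝ) =>
      (Matrix.of q.1.1).mulVec (circ q.2.1) :=
    contDiff_of_mulVec.comp (contDiff_fst.fst.prodMk (contDiff_circ.comp contDiff_snd.fst))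
  have h2 : ContDiff ℝ ∞ fun q : ((Fin 2 → Fin 2 → ℝ) × (Fin 2 → Fin 2 → ℝ)) × (ℝ × ℝ) =>
      (Matrix.of q.1.2).mulVec (circ q.2.2) :=
    contDiff_of_mulVec.comp (contDiff_fst.snd.prodMk (contDiff_circ.comp contDiff_snd.snd))
  refine u.2.2.2.2.comp (h1.prodMk h2).contDiffOn ?_
  · rintro q ⟨hq, -⟩
    exact ⟨of_mulVec_ne_zero hq.1 (circ_ne_zero _), of_mulVec_ne_zero hq.2 (circ_ne_zero _)⟩

/-- The entries of an invertible matrix, as a function. -/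
def entries (g : GL (Fin 2) ℝ) : Fin 2 → Fin 2 → ℝ := (g : Matrix (Fin 2) (Fin 2) ℝ)

theorem continuous_entries : Continuous entries :=
  (Units.continuous_val : Continuous (Units.val : GL (Fin 2) ℝ → Matrix (Fin 2) (Fin 2) ℝ))

theorem det_coe_ne_zero (g : GL (Fin 2) ℝ) : (g : Matrix (Fin 2) (Fin 2) ℝ).det ≠ 0 :=
  ((Matrix.isUnit_iff_isUnit_det _).1 g.isUnit).ne_zero

theorem entries_mem_invertiblePairs (g : GL (Fin 2) ℝ × GL (Fin 2) ℝ) :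
    (entries g.1, entries g.2) ∈ invertiblePairs := ⟨det_coe_ne_zero _, det_coe_ne_zero _⟩

theorem continuous_absPow {A : Type*} [TopologicalSpace A] {f : A → ℝ} (hf : Continuous f)
    (h0 : ∀ a, f a ≠ 0) (s : ℂ) : Continuous fun a => absPow (f a) s := by
  have e : (fun a => absPow (f a) s) = fun a => Complex.exp (s * (Real.log |f a| : ℝ)) :=
    funext fun a => absPow_eq_exp (h0 a) s
  rw [e]
  exact (continuous_const.mul (Complex.continuous_ofReal.comp
    (hf.abs.log fun a => abs_ne_zero.2 (h0 a)))).cexp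

/-- The restriction to the torus of a transform of `u`, as a function of the matrices as well. -/
theorem onTorus_actGL_inv (A B : GL (Fin 2) ℝ) (u : E τ τ') :
    E.onTorus (E.actGL A⁻¹ B⁻¹ u) = fun p =>
      (absPow ((A⁻¹ : GL (Fin 2) ℝ) : Matrix (Fin 2) (Fin 2) ℝ).det ((τ - 1) / 2) *
        absPow ((B⁻¹ : GL (Fin 2) ℝ) : Matrix (Fin 2) (Fin 2) ℝ).det ((τ' - 1) / 2)) *
      u.1 ((A : Matrix (Fin 2) (Fin 2) ℝ).mulVec (circ p.1))
        ((B : Matrix (Fin 2) (Fin 2) ℝ).mulVec (circ p.2)) := by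
  funext p
  simp only [E.onTorus, E.actGL, inv_inv]
  ring

theorem continuous_iteratedFDeriv_actGL (u : E τ τ') (j : ℕ) :
    Continuous fun q : (ℝ × ℝ) × (GL (Fin 2) ℝ × GL (Fin 2) ℝ) =>
      iteratedFDeriv ℝ j (E.onTorus (E.actGL q.2.1⁻¹ q.2.2⁻¹ u)) q.1 := by
  have hdet : Continuous fun g : GL (Fin 2) ℝ =>
      ((g⁻¹ : GL (Fin 2) ℝ) : Matrix (Fin 2) (Fin 2) ℝ).det :=
    Continuous.matrix_det (Units.continuous_val.comp continuous_inv)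
  have h1 := continuousOn_iteratedFDeriv_right isOpen_invertiblePairs (contDiffOn_comp_mulVec u) j
  have h2 := h1.comp_continuous (f := fun q : (ℝ × ℝ) × (GL (Fin 2) ℝ × GL (Fin 2) ℝ) =>
      ((entries q.2.1, entries q.2.2), q.1))
    (((continuous_entries.comp continuous_snd.fst).prodMk
      (continuous_entries.comp continuous_snd.snd)).prodMk continuous_fst)
    (fun q => ⟨entries_mem_invertiblePairs q.2, trivial⟩)
  have h3 : Continuous fun q : (ℝ × ℝ) × (GL (Fin 2) ℝ × GL (Fin 2) ℝ) =>
      absPow ((q.2.1⁻¹ : GL (Fin 2) ℝ) : Matrix (Fin 2) (Fin 2) ℝ).det ((τ - 1) / 2) *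
        absPow ((q.2.2⁻¹ : GL (Fin 2) ℝ) : Matrix (Fin 2) (Fin 2) ℝ).det ((τ' - 1) / 2) :=
    (continuous_absPow (hdet.comp continuous_snd.fst) (fun q => det_coe_ne_zero _) _).mul
      (continuous_absPow (hdet.comp continuous_snd.snd) (fun q => det_coe_ne_zero _) _)
  refine (h3.smul h2).congr fun q => ?_
  rw [onTorus_actGL_inv]
  have hsm : ContDiff ℝ ∞ fun p : ℝ × ℝ =>
      u.1 ((q.2.1 : Matrix (Fin 2) (Fin 2) ℝ).mulVec (circ p.1))
        ((q.2.2 : Matrix (Fin 2) (Fin 2) ℝ).mulVec (circ p.2)) :=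
    (contDiffOn_comp_mulVec u).comp_contDiff (f := fun p : ℝ × ℝ =>
      ((entries q.2.1, entries q.2.2), p))
      (contDiff_const.prodMk contDiff_id) (fun p => ⟨entries_mem_invertiblePairs q.2, trivial⟩)
  exact (iteratedFDeriv_const_smul_apply (hsm.contDiffAt.of_le (by exact_mod_cast le_top))).symm

theorem continuous_hermCone_actGL {q : E τ τ' → ℝ} (hq : q ∈ hermCone τ τ') (u : E τ τ') :
    Continuous fun g : GL (Fin 2) ℝ × GL (Fin 2) ℝ => q (E.actGL g.1⁻¹ g.2⁻¹ u) := by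
  rw [continuous_iff_continuousAt]
  intro g₀
  refine continuousAt_hermCone hq fun k ε hε => ?_
  have h1 : ∀ᶠ g in nhds g₀, ∀ j ∈ Finset.range (k + 1), ∀ p,
      ‖iteratedFDeriv ℝ j (E.onTorus (E.actGL g.1⁻¹ g.2⁻¹ u)) p -
        iteratedFDeriv ℝ j (E.onTorus (E.actGL g₀.1⁻¹ g₀.2⁻¹ u)) p‖ ≤ ε := by
    rw [Filter.eventually_all_finset]
    intro j _
    refine eventually_norm_sub_le_of_isCompact (continuous_iteratedFDeriv_actGL u j)
      isCompact_square (fun p => ?_) g₀ hε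
    have hb : Biperiodic fun (p : ℝ × ℝ) (g : GL (Fin 2) ℝ × GL (Fin 2) ℝ) =>
        iteratedFDeriv ℝ j (E.onTorus (E.actGL g.1⁻¹ g.2⁻¹ u)) p :=
      ⟨fun p => funext fun g => ((E.biperiodic_onTorus _).iteratedFDeriv j).1 p,
        fun p => funext fun g => ((E.biperiodic_onTorus _).iteratedFDeriv j).2 p⟩
    obtain ⟨z, hz, e⟩ := hb.exists_mem_square p
    exact ⟨z, hz, fun g => congrFun e g⟩
  filter_upwards [h1] with g hg j hj p
  have e : E.onTorus (E.actGL g.1⁻¹ g.2⁻¹ u - E.actGL g₀.1⁻¹ g₀.2⁻¹ u) =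
      E.onTorus (E.actGL g.1⁻¹ g.2⁻¹ u) - E.onTorus (E.actGL g₀.1⁻¹ g₀.2⁻¹ u) := rfl
  have hsm : ∀ v : E τ τ', ContDiffAt ℝ j (E.onTorus v) p := fun v =>
    ((E.contDiff_onTorus v).of_le (by exact_mod_cast le_top)).contDiffAt
  rw [e, iteratedFDeriv_sub_apply (hsm _) (hsm _)]
  exact hg j (Finset.mem_range.2 (by omega)) p

theorem continuous_hermCone_act {q : E τ τ' → ℝ} (hq : q ∈ hermCone τ τ') (u : E τ τ') :
    Continuous fun g : PGL2R × PGL2R => q (E.act g⁻¹ u) := by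
  have h := PGL2R.isOpenQuotientMap_mk.prodMap PGL2R.isOpenQuotientMap_mk
  rw [h.isQuotientMap.continuous_iff]
  refine (continuous_hermCone_actGL hq u).congr fun g => ?_
  simp only [Function.comp_apply, Prod.map]
  rw [← E.act_mk, map_inv, map_inv]
  rfl

/-- The positive functional `H ↦ (Π(h) H)(u)`. -/
def smoothedFunctional (m : Measure PGL2R) {h : PGL2R × PGL2R → ℝ} (hc : Continuous h)
    (h0 : ∀ g, 0 ≤ h g) (u : E τ τ') : PositiveFunctional τ τ' where
  toFun q := smoothedValue m h u q.1
  map_zero' := by simp [smoothedValue]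
  map_add' q r := by
    have hm : Measurable fun g : PGL2R × PGL2R => ENNReal.ofReal (h g * q.1 (E.act g⁻¹ u)) :=
      (hc.mul (continuous_hermCone_act q.2 u)).measurable.ennreal_ofReal
    simp only [smoothedValue, AddSubmonoid.coe_add, Pi.add_apply]
    rw [← lintegral_add_left hm]
    refine lintegral_congr fun g => ?_
    rw [← ENNReal.ofReal_add (mul_nonneg (h0 g) (q.2.2.1 _)) (mul_nonneg (h0 g) (r.2.2.1 _)),
      mul_add]

end Forms

/-! ### Integrability of the model kernel -/

theorem norm_absPow_le (r : ℝ) (s : ℂ) : ‖absPow r s‖ ≤ |r| ^ s.re := by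
  rcases eq_or_ne r 0 with rfl | hr
  · by_cases hs : s = 0
    · simp [absPow, hs]
    · simp only [absPow, abs_zero, Complex.ofReal_zero, Complex.zero_cpow hs, norm_zero]
      positivity
  · rw [absPow, Complex.norm_cpow_eq_rpow_re_of_pos (abs_pos.2 hr)]

theorem measurable_absPow {A : Type*} [MeasurableSpace A] {f : A → ℝ} (hf : Measurable f) (s : ℂ) :
    Measurable fun a => absPow (f a) s :=
  (Complex.measurable_ofReal.comp hf.norm).pow_const s

theorem omega_circ (x y : ℝ) : omega (circ x) (circ y) = Real.sin (y - x) := by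
  simp only [omega, circ, Matrix.cons_val_zero, Matrix.cons_val_one, Real.sin_sub]
  ring

theorem IsClassOneParam.re_mem {τ : ℂ} (h : IsClassOneParam τ) : -1 < τ.re ∧ τ.re ≤ 0 := by
  rcases h with h | ⟨-, h1, h2⟩
  · rw [h]
    norm_num
  · exact ⟨h1, h2.le⟩

/-- Weighted arithmetic-geometric mean inequality: a product of three powers whose exponents are
critical at the triple point is bounded by products of two locally integrable powers. -/
theorem rpow_mul_rpow_mul_rpow_le {A B D p q r : ℝ} (hA : 0 ≤ A) (hB : 0 ≤ B) (hD : 0 ≤ D)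
    (hA1 : A ≤ 1) (hB1 : B ≤ 1) (hD1 : D ≤ 1) (hp : 0 < p) (hq : 0 < q) (hpq : p + q = 1)
    (hr : -(1 / 2) ≤ r) :
    A ^ (-p) * B ^ (-q) * D ^ r ≤ A ^ (-(4 * p / (1 + 3 * p))) * B ^ (-(4 * q / (1 + 3 * q))) +
      A ^ (-(4 * p / (1 + 3 * p))) * D ^ (-(2 / 3) : ℝ) +
      B ^ (-(4 * q / (1 + 3 * q))) * D ^ (-(2 / 3) : ℝ) := by
  set a := 4 * p / (1 + 3 * p) with ha
  set b := 4 * q / (1 + 3 * q) with hb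
  have hap : p ≤ a := by rw [ha, le_div_iff₀ (by positivity)]; nlinarith
  have hbq : q ≤ b := by rw [hb, le_div_iff₀ (by positivity)]; nlinarith
  have n1 : 0 ≤ A ^ (-a) * B ^ (-b) := by positivity
  have n2 : 0 ≤ A ^ (-a) * D ^ (-(2 / 3) : ℝ) := by positivity
  have n3 : 0 ≤ B ^ (-b) * D ^ (-(2 / 3) : ℝ) := by positivity
  rcases hA.eq_or_lt with rfl | hA0
  · rw [Real.zero_rpow (by linarith : -p ≠ 0)]
    simp only [zero_mul]
    positivity
  rcases hB.eq_or_lt with rfl | hB0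
  · rw [Real.zero_rpow (by linarith : -q ≠ 0)]
    simp only [mul_zero, zero_mul]
    positivity
  rcases hD.eq_or_lt with rfl | hD0
  · have h1 : (0 : ℝ) ^ r ≤ 1 := by
      rcases eq_or_ne r 0 with rfl | h
      · simp
      · rw [Real.zero_rpow h]; exact zero_le_one
    calc A ^ (-p) * B ^ (-q) * 0 ^ r ≤ A ^ (-p) * B ^ (-q) :=
          mul_le_of_le_one_right (by positivity) h1
      _ ≤ A ^ (-a) * B ^ (-b) := by
          gcongr ?_ * ?_
          · exact Real.rpow_le_rpow_of_exponent_ge hA0 hA1 (by linarith)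
          · exact Real.rpow_le_rpow_of_exponent_ge hB0 hB1 (by linarith)
      _ ≤ _ := by linarith
  have h1 : D ^ r ≤ D ^ (-(1 / 2) : ℝ) := Real.rpow_le_rpow_of_exponent_ge hD0 hD1 hr
  have h2 := Real.geom_mean_le_arith_mean3_weighted (w₁ := 1 / 4) (w₂ := 3 * p / 4) (w₃ := 3 * q / 4)
    (by norm_num) (by positivity) (by positivity) n1 n2 n3 (by linarith)
  have h3 : (A ^ (-a) * B ^ (-b)) ^ (1 / 4 : ℝ) * (A ^ (-a) * D ^ (-(2 / 3) : ℝ)) ^ (3 * p / 4) *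
      (B ^ (-b) * D ^ (-(2 / 3) : ℝ)) ^ (3 * q / 4) = A ^ (-p) * B ^ (-q) * D ^ (-(1 / 2) : ℝ) := by
    have eA : A ^ (-p) = A ^ (-a * (1 / 4)) * A ^ (-a * (3 * p / 4)) := by
      rw [← Real.rpow_add hA0]
      congr 1
      rw [ha]
      field_simp
      ring
    have eB : B ^ (-q) = B ^ (-b * (1 / 4)) * B ^ (-b * (3 * q / 4)) := by
      rw [← Real.rpow_add hB0]
      congr 1
      rw [hb]
      field_simp
      ring
    have eD : D ^ (-(1 / 2) : ℝ) = D ^ (-(2 / 3) * (3 * p / 4)) * D ^ (-(2 / 3) * (3 * q / 4)) := by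
      rw [← Real.rpow_add hD0]
      congr 1
      linarith
    rw [Real.mul_rpow (by positivity) (by positivity), Real.mul_rpow (by positivity) (by positivity),
      Real.mul_rpow (by positivity) (by positivity), ← Real.rpow_mul hA, ← Real.rpow_mul hB,
      ← Real.rpow_mul hA, ← Real.rpow_mul hD, ← Real.rpow_mul hB, ← Real.rpow_mul hD, eA, eB, eD]
    ring
  rw [h3] at h2
  calc A ^ (-p) * B ^ (-q) * D ^ r ≤ A ^ (-p) * B ^ (-q) * D ^ (-(1 / 2) : ℝ) := by gcongr
    _ ≤ _ := h2
    _ ≤ _ := by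
      have k1 : 3 * p / 4 ≤ 1 := by linarith
      have k2 : 3 * q / 4 ≤ 1 := by linarith
      have := mul_le_of_le_one_left n1 (by norm_num : (1 / 4 : ℝ) ≤ 1)
      have := mul_le_of_le_one_left n2 k1
      have := mul_le_of_le_one_left n3 k2
      linarith

/-- A majorant of the model kernel, as a function of the two integration angles. -/
def kernelMajorant (a b : ℝ) (z : ℝ) (p : ℝ × ℝ) : ℝ :=
  |Real.sin (p.1 - z)| ^ b * |Real.sin (p.2 - z)| ^ a +
    |Real.sin (p.2 - z)| ^ a * |Real.sin (p.1 - p.2)| ^ (-(2 / 3) : ℝ) +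
    |Real.sin (p.1 - z)| ^ b * |Real.sin (p.1 - p.2)| ^ (-(2 / 3) : ℝ)

theorem integrableOn_kernelMajorant {a b : ℝ} (ha : -1 < a) (hb : -1 < b) (z : ℝ) :
    IntegrableOn (kernelMajorant a b z) square ∧ ∫ p in square, kernelMajorant a b z p =
      sinInt b * sinInt a + sinInt a * sinInt (-(2 / 3)) + sinInt b * sinInt (-(2 / 3)) := by
  have h23 : (-1 : ℝ) < -(2 / 3) := by norm_num
  have ia := integrableOn_abs_sin_sub_rpow ha z
  have ib := integrableOn_abs_sin_sub_rpow hb z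
  have i1 : IntegrableOn (fun p : ℝ × ℝ => |Real.sin (p.1 - z)| ^ b * |Real.sin (p.2 - z)| ^ a)
      square := by
    rw [IntegrableOn, volume_restrict_square]
    exact ib.mul_prod ia
  have e1 : ∫ p in square, |Real.sin (p.1 - z)| ^ b * |Real.sin (p.2 - z)| ^ a =
      sinInt b * sinInt a := by
    rw [volume_restrict_square, integral_prod_mul (fun x => |Real.sin (x - z)| ^ b)
      (fun y => |Real.sin (y - z)| ^ a), setIntegral_abs_sin_sub_rpow, setIntegral_abs_sin_sub_rpow]
  have i2 := (integrableOn_square_mul_abs_sin h23 ia).2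
  have i3 := (integrableOn_square_mul_abs_sin h23 ib).1
  have e2 := (setIntegral_square_mul_abs_sin h23 ia).2
  have e3 := (setIntegral_square_mul_abs_sin h23 ib).1
  rw [setIntegral_abs_sin_sub_rpow] at e2 e3
  refine ⟨(i1.add i2).add i3, ?_⟩
  have s1 := integral_add i1 i2
  have s2 := integral_add (i1.add i2) i3
  simp only [Pi.add_apply] at s1 s2
  unfold kernelMajorant
  rw [s2, s1, e1, e2, e3]

theorem measurable_modKernel_circ (l₁ l₂ l₃ : ℂ) : Measurable fun q : ℝ × (ℝ × ℝ) =>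
    modKernel l₁ l₂ l₃ (circ q.2.1) (circ q.2.2) (circ q.1) := by
  simp only [modKernel, omega_circ]
  refine ((measurable_absPow ?_ _).mul (measurable_absPow ?_ _)).mul (measurable_absPow ?_ _) <;>
  exact Continuous.measurable (by fun_prop)

/-- The model kernel is absolutely integrable, uniformly in the third variable. -/
theorem exists_kernelMajorant {τ τ' lam : ℂ} (hτ : IsClassOneParam τ) (hτ' : IsClassOneParam τ')
    (hlam : lam.re = 0) : ∃ a b : ℝ, -1 < a ∧ -1 < b ∧ ∀ z p,
      ‖modKernel τ τ' lam (circ p.1) (circ p.2) (circ z)‖ ≤ kernelMajorant a b z p := by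
  obtain ⟨h1, h2⟩ := hτ.re_mem
  obtain ⟨h1', h2'⟩ := hτ'.re_mem
  set P := (1 - τ.re + τ'.re) / 2 with hP
  set Q := (1 + τ.re - τ'.re) / 2 with hQ
  have hP0 : 0 < P := by rw [hP]; linarith
  have hQ0 : 0 < Q := by rw [hQ]; linarith
  have hPQ : P + Q = 1 := by rw [hP, hQ]; ring
  refine ⟨-(4 * P / (1 + 3 * P)), -(4 * Q / (1 + 3 * Q)), ?_, ?_, fun z p => ?_⟩
  · rw [neg_lt_neg_iff, div_lt_one (by positivity)]
    linarith
  · rw [neg_lt_neg_iff, div_lt_one (by positivity)]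
    linarith
  simp only [modKernel, omega_circ, norm_mul]
  have r1 : ((τ - τ' - lam - 1) / 2).re = -P := by
    simp [hP, hlam]
    ring
  have r2 : ((-τ + τ' - lam - 1) / 2).re = -Q := by
    simp [hQ, hlam]
    ring
  have r3 : ((-τ - τ' + lam - 1) / 2).re = (-τ.re - τ'.re - 1) / 2 := by
    simp [hlam]
  have k1 := norm_absPow_le (Real.sin (z - p.2)) ((τ - τ' - lam - 1) / 2)
  have k2 := norm_absPow_le (Real.sin (z - p.1)) ((-τ + τ' - lam - 1) / 2)
  have k3 := norm_absPow_le (Real.sin (p.2 - p.1)) ((-τ - τ' + lam - 1) / 2)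
  rw [r1, abs_sin_sub_comm] at k1
  rw [r2, abs_sin_sub_comm] at k2
  rw [r3, abs_sin_sub_comm] at k3
  have main := rpow_mul_rpow_mul_rpow_le (abs_nonneg (Real.sin (p.2 - z)))
    (abs_nonneg (Real.sin (p.1 - z))) (abs_nonneg (Real.sin (p.1 - p.2)))
    (Real.abs_sin_le_one _) (Real.abs_sin_le_one _) (Real.abs_sin_le_one _) hP0 hQ0 hPQ
    (r := (-τ.re - τ'.re - 1) / 2) (by linarith)
  refine (mul_le_mul (mul_le_mul k1 k2 (norm_nonneg _) (by positivity)) k3 (norm_nonneg _)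
    (by positivity)).trans (main.trans (le_of_eq ?_))
  unfold kernelMajorant
  ring

section ModForm

variable {τ τ' lam : ℂ}

theorem integrableOn_mul_modKernel (hτ : IsClassOneParam τ) (hτ' : IsClassOneParam τ')
    (hlam : lam.re = 0) (u : E τ τ') (z : ℝ) : IntegrableOn (fun p : ℝ × ℝ =>
      E.onTorus u p * modKernel τ τ' lam (circ p.1) (circ p.2) (circ z)) square := by
  obtain ⟨a, b, ha, hb, hK⟩ := exists_kernelMajorant hτ hτ' hlam
  obtain ⟨M, hM⟩ := (E.biperiodic_onTorus u).exists_bound (E.contDiff_onTorus u).continuous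
  have hm : Measurable fun p : ℝ × ℝ => modKernel τ τ' lam (circ p.1) (circ p.2) (circ z) := by
    have := (measurable_modKernel_circ τ τ' lam).comp (measurable_prodMk_left (x := z))
    exact this
  have hi : IntegrableOn (fun p : ℝ × ℝ => modKernel τ τ' lam (circ p.1) (circ p.2) (circ z))
      square :=
    (integrableOn_kernelMajorant ha hb z).1.mono' hm.aestronglyMeasurable
      (Filter.Eventually.of_forall fun p => hK z p)
  exact Integrable.bdd_mul (c := M) (f := E.onTorus u) hi
    (E.contDiff_onTorus u).continuous.aestronglyMeasurable (Filter.Eventually.of_forall hM)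

/-- The model operator, as a linear map. -/
def modOpLinear (hτ : IsClassOneParam τ) (hτ' : IsClassOneParam τ') (hlam : lam.re = 0) :
    E τ τ' →ₗ[ℂ] (ℝ → ℂ) where
  toFun u z := modOp lam u z
  map_add' u v := by
    funext z
    have h : ∀ p, E.onTorus (u + v) p = E.onTorus u p + E.onTorus v p := fun p => rfl
    simp only [modOp, Pi.add_apply, h, add_mul]
    rw [integral_add (integrableOn_mul_modKernel hτ hτ' hlam u z)
      (integrableOn_mul_modKernel hτ hτ' hlam v z), mul_add]
  map_smul' c u := by
    funext z
    have h : ∀ p, E.onTorus (c • u) p = c * E.onTorus u p := fun p => rfl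
    simp only [modOp, Pi.smul_apply, h, mul_assoc, smul_eq_mul, RingHom.id_apply]
    rw [integral_const_mul, mul_left_comm]

theorem measurable_modOp (u : E τ τ') : Measurable (modOp lam u) := by
  have hm : Measurable fun q : ℝ × (ℝ × ℝ) => E.onTorus u q.2 *
      modKernel τ τ' lam (circ q.2.1) (circ q.2.2) (circ q.1) :=
    ((E.contDiff_onTorus u).continuous.measurable.comp measurable_snd).mul
      (measurable_modKernel_circ τ τ' lam)
  exact (hm.stronglyMeasurable.integral_prod_right
    (ν := volume.restrict square)).measurable.const_mul _

theorem exists_norm_modOp_le (hτ : IsClassOneParam τ) (hτ' : IsClassOneParam τ')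
    (hlam : lam.re = 0) : ∃ C, ∀ (u : E τ τ') (M : ℝ), (∀ p, ‖E.onTorus u p‖ ≤ M) →
      ∀ z, ‖modOp lam u z‖ ≤ C * M := by
  obtain ⟨a, b, ha, hb, hK⟩ := exists_kernelMajorant hτ hτ' hlam
  refine ⟨((2 * Real.pi) ^ 2)⁻¹ *
    (sinInt b * sinInt a + sinInt a * sinInt (-(2 / 3)) + sinInt b * sinInt (-(2 / 3))),
    fun u M hM z => ?_⟩
  obtain ⟨i1, e1⟩ := integrableOn_kernelMajorant ha hb z
  have h1 : ‖∫ p in square, E.onTorus u p * modKernel τ τ' lam (circ p.1) (circ p.2) (circ z)‖ ≤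
      ∫ p in square, M * kernelMajorant a b z p := by
    refine norm_integral_le_of_norm_le (i1.const_mul M) (Filter.Eventually.of_forall fun p => ?_)
    rw [norm_mul]
    exact mul_le_mul (hM p) (hK z p) (norm_nonneg _) ((norm_nonneg _).trans (hM p))
  rw [integral_const_mul, e1] at h1
  rw [modOp, norm_mul, Complex.norm_real, Real.norm_of_nonneg (by positivity), mul_assoc]
  gcongr
  exact h1.trans (le_of_eq (mul_comm _ _))

theorem modForm_mem_hermCone (hτ : IsClassOneParam τ) (hτ' : IsClassOneParam τ')
    (hlam : lam.re = 0) : modForm τ τ' lam ∈ hermCone τ τ' := by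
  obtain ⟨C, hC⟩ := exists_norm_modOp_le hτ hτ' hlam
  set κ : Measure ℝ := ENNReal.ofReal (2 * Real.pi)⁻¹ • volume.restrict (Set.Icc 0 (2 * Real.pi))
    with hκ
  have hfin : IsFiniteMeasure κ := Measure.smul_finite _ ENNReal.ofReal_ne_top
  have e : modForm τ τ' lam = fun u => ∫ z, ‖modOpLinear hτ hτ' hlam u z‖ ^ 2 ∂κ := by
    funext u
    rw [hκ, integral_smul_measure, ENNReal.toReal_ofReal (by positivity)]
    rfl
  rw [e]
  refine integral_norm_sq_mem_hermCone _ measurable_modOp ⟨0, C, fun u M hM z => ?_⟩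
  exact hC u M (fun p => by simpa using hM 0 le_rfl p) z

end ModForm

/-! ### The smoothing function on `G × G` -/

/-- A smooth cutoff, equal to `1` on `(-∞, 1/2]` and to `0` on `[1, ∞)`. -/
def cutoff (t : ℝ) : ℝ := Real.smoothTransition (2 - 2 * t)

theorem cutoff_nonneg (t : ℝ) : 0 ≤ cutoff t := Real.smoothTransition.nonneg _

theorem cutoff_le_one (t : ℝ) : cutoff t ≤ 1 := Real.smoothTransition.le_one _

theorem cutoff_eq_one {t : ℝ} (h : t ≤ 1 / 2) : cutoff t = 1 :=
  Real.smoothTransition.one_of_one_le (by linarith)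

theorem lt_one_of_cutoff_ne_zero {t : ℝ} (h : cutoff t ≠ 0) : t < 1 := by
  by_contra! h1
  exact h (Real.smoothTransition.zero_of_nonpos (by linarith))

theorem contDiff_cutoff : ContDiff ℝ ∞ cutoff :=
  Real.smoothTransition.contDiff.comp (contDiff_const.sub (contDiff_const.mul contDiff_id))

namespace PGL2R

theorem ofMatrix_surjective (g : PGL2R) :
    ∃ A : Fin 2 → Fin 2 → ℝ, (Matrix.of A).det ≠ 0 ∧ ofMatrix A = g := by
  refine ⟨entries (rep g), det_coe_ne_zero _, ?_⟩
  rw [entries, ofMatrix_coe, mk_rep]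

theorem continuousOn_ofMatrix : ContinuousOn ofMatrix {A | (Matrix.of A).det ≠ 0} := by
  rw [continuousOn_iff_continuous_domRestrict]
  have h : Continuous fun A : {A : Fin 2 → Fin 2 → ℝ | (Matrix.of A).det ≠ 0} =>
      Matrix.GeneralLinearGroup.mkOfDetNeZero (Matrix.of A.1) A.2 := by
    rw [isEmbedding_coe_GL.continuous_iff]
    exact (continuous_subtype_val :
      Continuous fun A : {A : Fin 2 → Fin 2 → ℝ | (Matrix.of A).det ≠ 0} => A.1)
  refine (continuous_mk.comp h).congr fun A => ?_
  simp only [Function.comp_apply, Set.domRestrict_apply]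
  unfold ofMatrix
  rw [dif_pos (show (Matrix.of A.1).det ≠ 0 from A.2)]

theorem ofMatrix_smul {A : Fin 2 → Fin 2 → ℝ} (hA : (Matrix.of A).det ≠ 0) {a : ℝ} (ha : a ≠ 0) :
    ofMatrix (a • A) = ofMatrix A := by
  have hdet : (Matrix.of (a • A)).det = a ^ 2 * (Matrix.of A).det := by
    simp [Matrix.det_fin_two]
    ring
  have haA : (Matrix.of (a • A)).det ≠ 0 := by
    rw [hdet]
    exact mul_ne_zero (pow_ne_zero 2 ha) hA
  unfold ofMatrix
  rw [dif_pos hA, dif_pos haA]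
  refine (QuotientGroup.eq.2 ?_).symm
  rw [Matrix.GeneralLinearGroup.mem_center_iff_val_mem_range_scalar]
  refine ⟨a, ?_⟩
  set g := Matrix.GeneralLinearGroup.mkOfDetNeZero (Matrix.of A) hA
  have h1 : (Matrix.GeneralLinearGroup.mkOfDetNeZero (Matrix.of (a • A)) haA :
      Matrix (Fin 2) (Fin 2) ℝ) = a • (g : Matrix (Fin 2) (Fin 2) ℝ) := rfl
  rw [Units.val_mul, h1, Matrix.mul_smul, ← Units.val_mul, inv_mul_cancel, Units.val_one]
  ext i j
  simp [Matrix.one_apply, Matrix.diagonal_apply]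

/-- A measure of the distance from the class of a matrix to the identity of `PGL₂(ℝ)`: it is
homogeneous of degree zero and vanishes exactly on scalar matrices. -/
def eccentricity (A : Fin 2 → Fin 2 → ℝ) : ℝ :=
  ((A 0 0 - A 1 1) ^ 2 + A 0 1 ^ 2 + A 1 0 ^ 2) ^ 2 / (Matrix.of A).det ^ 2

theorem eccentricity_smul (A : Fin 2 → Fin 2 → ℝ) {a : ℝ} (ha : a ≠ 0) :
    eccentricity (a • A) = eccentricity A := by
  have hdet : (Matrix.of (a • A)).det = a ^ 2 * (Matrix.of A).det := by
    simp [Matrix.det_fin_two]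
    ring
  unfold eccentricity
  rw [hdet]
  have e : (((a • A) 0 0 - (a • A) 1 1) ^ 2 + (a • A) 0 1 ^ 2 + (a • A) 1 0 ^ 2) ^ 2 =
      (a ^ 2) ^ 2 * ((A 0 0 - A 1 1) ^ 2 + A 0 1 ^ 2 + A 1 0 ^ 2) ^ 2 := by
    simp only [Pi.smul_apply, smul_eq_mul]
    ring
  rw [e, mul_pow]
  exact mul_div_mul_left _ _ (pow_ne_zero 2 (pow_ne_zero 2 ha))

/-- A smooth compactly supported bump on `PGL₂(ℝ)` around the identity. -/
def bump (g : PGL2R) : ℝ := cutoff (eccentricity (entries (rep g)))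

theorem bump_mk (g : GL (Fin 2) ℝ) : bump (mk g) = cutoff (eccentricity (entries g)) := by
  obtain ⟨a, ha, e⟩ := exists_smul_of_mk_eq (mk_rep (mk g))
  have : entries (rep (mk g)) = a • entries g := e
  rw [bump, this, eccentricity_smul _ ha]

theorem bump_ofMatrix {A : Fin 2 → Fin 2 → ℝ} (hA : (Matrix.of A).det ≠ 0) :
    bump (ofMatrix A) = cutoff (eccentricity A) := by
  unfold ofMatrix
  rw [dif_pos hA, bump_mk]
  rfl

theorem bump_nonneg (g : PGL2R) : 0 ≤ bump g := cutoff_nonneg _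

theorem contDiffOn_bump : ContDiffOn ℝ ∞ (fun A : Fin 2 → Fin 2 → ℝ => bump (ofMatrix A))
    {A | (Matrix.of A).det ≠ 0} := by
  refine ContDiffOn.congr ?_ fun A hA => bump_ofMatrix hA
  refine contDiff_cutoff.comp_contDiffOn ?_
  unfold eccentricity
  simp only [Matrix.det_fin_two, Matrix.of_apply]
  refine ContDiffOn.div (ContDiff.contDiffOn (by fun_prop)) (ContDiff.contDiffOn (by fun_prop))
    fun A hA => pow_ne_zero 2 hA

theorem continuous_bump : Continuous bump := by
  rw [isOpenQuotientMap_mk.isQuotientMap.continuous_iff]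
  have h := (contDiffOn_bump.continuousOn).comp_continuous continuous_entries
    (fun g => det_coe_ne_zero g)
  refine h.congr fun g => ?_
  exact congrArg bump (ofMatrix_coe g)

/-- The matrices of determinant `±1` with entries at most `3`. -/
def boundedMatrices : Set (Fin 2 → Fin 2 → ℝ) :=
  {A | |(Matrix.of A).det| = 1} ∩ Set.Icc (fun _ _ => -3) (fun _ _ => 3)

theorem isCompact_ofMatrix_boundedMatrices : IsCompact (ofMatrix '' boundedMatrices) := by
  have h : IsCompact boundedMatrices :=
    isCompact_Icc.inter_left (isClosed_eq continuous_det_coe.abs continuous_const)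
  refine h.image_of_continuousOn (continuousOn_ofMatrix.mono fun A hA h0 => ?_)
  have h1 : |(Matrix.of A).det| = 1 := hA.1
  rw [h0] at h1
  simp at h1

theorem bump_eq_zero {g : PGL2R} (hg : g ∉ ofMatrix '' boundedMatrices) : bump g = 0 := by
  by_contra h0
  apply hg
  obtain ⟨A, hA, rfl⟩ := ofMatrix_surjective g
  rw [bump_ofMatrix hA] at h0
  have h1 := lt_one_of_cutoff_ne_zero h0
  have hd : 0 < |(Matrix.of A).det| := abs_pos.2 hA
  set s := Real.sqrt |(Matrix.of A).det| with hs
  have hs0 : 0 < s := Real.sqrt_pos.2 hd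
  have hss : s ^ 2 = |(Matrix.of A).det| := Real.sq_sqrt hd.le
  refine ⟨s⁻¹ • A, ?_, ofMatrix_smul hA (inv_ne_zero hs0.ne')⟩
  rw [← eccentricity_smul A (inv_ne_zero hs0.ne')] at h1
  have hdet : |(Matrix.of (s⁻¹ • A)).det| = 1 := by
    have : (Matrix.of (s⁻¹ • A)).det = (s ^ 2)⁻¹ * (Matrix.of A).det := by
      simp [Matrix.det_fin_two]
      ring
    rw [this, abs_mul, hss, abs_inv, abs_abs, inv_mul_cancel₀ hd.ne']
  set A' := s⁻¹ • A
  have hsq : (Matrix.of A').det ^ 2 = 1 := by rw [← sq_abs, hdet, one_pow]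
  rw [eccentricity, hsq, div_one] at h1
  have h2 : (A' 0 0 - A' 1 1) ^ 2 + A' 0 1 ^ 2 + A' 1 0 ^ 2 < 1 :=
    lt_of_pow_lt_pow_left₀ 2 zero_le_one (by simpa using h1)
  have hdet2 : (A' 0 0 * A' 1 1 - A' 0 1 * A' 1 0) ^ 2 = 1 := by
    simpa [Matrix.det_fin_two] using hsq
  have h3 : A' 0 0 * A' 1 1 ≤ 2 := by
    have h4 : A' 0 0 * A' 1 1 - A' 0 1 * A' 1 0 ≤ 1 := by nlinarith
    nlinarith [sq_nonneg (A' 0 1 - A' 1 0), sq_nonneg (A' 0 0 - A' 1 1)]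
  have hb : ∀ r : ℝ, r ^ 2 ≤ 9 → -3 ≤ r ∧ r ≤ 3 := fun r hr => by constructor <;> nlinarith
  have k00 := hb (A' 0 0) (by
    nlinarith [sq_nonneg (A' 0 1), sq_nonneg (A' 1 0), sq_nonneg (A' 1 1)])
  have k11 := hb (A' 1 1) (by
    nlinarith [sq_nonneg (A' 0 1), sq_nonneg (A' 1 0), sq_nonneg (A' 0 0)])
  have k01 := hb (A' 0 1) (by nlinarith [sq_nonneg (A' 0 0 - A' 1 1), sq_nonneg (A' 1 0)])
  have k10 := hb (A' 1 0) (by nlinarith [sq_nonneg (A' 0 0 - A' 1 1), sq_nonneg (A' 0 1)])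
  refine ⟨hdet, fun i j => ?_, fun i j => ?_⟩
  · fin_cases i <;> fin_cases j
    exacts [k00.1, k01.1, k10.1, k11.1]
  · fin_cases i <;> fin_cases j
    exacts [k00.2, k01.2, k10.2, k11.2]

/-- The smoothing function on `G × G`. -/
def bump₂ (g : PGL2R × PGL2R) : ℝ := bump g.1 * bump g.2

theorem bump₂_nonneg (g : PGL2R × PGL2R) : 0 ≤ bump₂ g := mul_nonneg (bump_nonneg _) (bump_nonneg _)

theorem continuous_bump₂ : Continuous bump₂ :=
  (continuous_bump.comp continuous_fst).mul (continuous_bump.comp continuous_snd)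

theorem smooth₂_bump₂ : Smooth₂ bump₂ :=
  (contDiffOn_bump.comp contDiff_fst.contDiffOn fun _ hA => hA.1).mul
    (contDiffOn_bump.comp contDiff_snd.contDiffOn fun _ hA => hA.2)

theorem hasCompactSupport_bump₂ : HasCompactSupport bump₂ := by
  refine HasCompactSupport.intro
    (isCompact_ofMatrix_boundedMatrices.prod isCompact_ofMatrix_boundedMatrices) fun g hg => ?_
  rw [Set.mem_prod, not_and_or] at hg
  rcases hg with h | h
  · rw [bump₂, bump_eq_zero h, zero_mul]
  · rw [bump₂, bump_eq_zero h, mul_zero]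

/-- The matrices that are entrywise close to the identity, together with their inverses. -/
def nearOne : Set (GL (Fin 2) ℝ) :=
  {A | ∀ i j, |(A : Matrix (Fin 2) (Fin 2) ℝ) i j - (1 : Matrix (Fin 2) (Fin 2) ℝ) i j| < 1 / 100 ∧
    |((A⁻¹ : GL (Fin 2) ℝ) : Matrix (Fin 2) (Fin 2) ℝ) i j - (1 : Matrix (Fin 2) (Fin 2) ℝ) i j| <
      1 / 100}

theorem isOpen_nearOne : IsOpen nearOne := by
  have h : ∀ i j, Continuous fun A : GL (Fin 2) ℝ =>
      |(A : Matrix (Fin 2) (Fin 2) ℝ) i j - (1 : Matrix (Fin 2) (Fin 2) ℝ) i j| := fun i j =>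
    ((Units.continuous_val.matrix_elem i j).sub continuous_const).abs
  have e : nearOne = ⋂ i, ⋂ j,
      ({A : GL (Fin 2) ℝ | |(A : Matrix (Fin 2) (Fin 2) ℝ) i j -
        (1 : Matrix (Fin 2) (Fin 2) ℝ) i j| < 1 / 100} ∩
      {A : GL (Fin 2) ℝ | |((A⁻¹ : GL (Fin 2) ℝ) : Matrix (Fin 2) (Fin 2) ℝ) i j -
        (1 : Matrix (Fin 2) (Fin 2) ℝ) i j| < 1 / 100}) := by
    ext A
    simp [nearOne]
  rw [e]
  refine isOpen_iInter_of_finite fun i => isOpen_iInter_of_finite fun j => ?_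
  exact (isOpen_lt (h i j) continuous_const).inter
    (isOpen_lt ((h i j).comp continuous_inv) continuous_const)

theorem one_mem_nearOne : (1 : GL (Fin 2) ℝ) ∈ nearOne := by
  intro i j
  simp

theorem bump_eq_one {A : GL (Fin 2) ℝ} (hA : A ∈ nearOne) : bump (mk A) = 1 := by
  rw [bump_mk]
  refine cutoff_eq_one ?_
  have h00 := (hA 0 0).1
  have h01 := (hA 0 1).1
  have h10 := (hA 1 0).1
  have h11 := (hA 1 1).1
  simp only [Matrix.one_apply_eq, ne_eq, zero_ne_one, one_ne_zero, not_false_eq_true,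
    Matrix.one_apply_ne, sub_zero, abs_lt] at h00 h01 h10 h11
  unfold eccentricity
  have hd : 1 / 2 ≤ (Matrix.of (entries A)).det := by
    have e : (Matrix.of (entries A)).det = entries A 0 0 * entries A 1 1 -
        entries A 0 1 * entries A 1 0 := Matrix.det_fin_two _
    rw [e]
    simp only [entries]
    nlinarith
  have hn : (entries A 0 0 - entries A 1 1) ^ 2 + entries A 0 1 ^ 2 + entries A 1 0 ^ 2 ≤
      1 / 8 := by
    simp only [entries]
    nlinarith
  have hn0 : 0 ≤ (entries A 0 0 - entries A 1 1) ^ 2 + entries A 0 1 ^ 2 + entries A 1 0 ^ 2 := by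
    positivity
  rw [div_le_iff₀ (by positivity)]
  nlinarith

end PGL2R

/-! ### Bump vectors -/

theorem absPow_abs (r : ℝ) (s : ℂ) : absPow |r| s = absPow r s := by simp [absPow]

/-- The square of the Euclidean norm. -/
def euclidSq (x : Plane) : ℝ := x 0 ^ 2 + x 1 ^ 2

theorem euclidSq_smul (a : ℝ) (x : Plane) : euclidSq (a • x) = a ^ 2 * euclidSq x := by
  simp only [euclidSq, Pi.smul_apply, smul_eq_mul]
  ring

theorem euclidSq_circ (θ : ℝ) : euclidSq (circ θ) = 1 := by
  simp [euclidSq, circ]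

theorem euclidSq_pos {x : Plane} (hx : x ≠ 0) : 0 < euclidSq x := by
  refine lt_of_le_of_ne (by unfold euclidSq; positivity) fun h => hx ?_
  have h' : x 0 ^ 2 + x 1 ^ 2 = 0 := h.symm
  have h0 : x 0 = 0 := by nlinarith [sq_nonneg (x 0), sq_nonneg (x 1)]
  have h1 : x 1 = 0 := by nlinarith [sq_nonneg (x 0), sq_nonneg (x 1)]
  funext i
  fin_cases i
  exacts [h0, h1]

/-- A bump of angular size `σ` around the line where the coordinate `x i` vanishes, homogeneous of
degree zero. -/
def lineCap (i : Fin 2) (σ : ℝ) (x : Plane) : ℝ := cutoff (x i ^ 2 / (σ ^ 2 * euclidSq x))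

theorem lineCap_smul (i : Fin 2) (σ : ℝ) {a : ℝ} (ha : a ≠ 0) (x : Plane) :
    lineCap i σ (a • x) = lineCap i σ x := by
  rw [lineCap, lineCap, euclidSq_smul, Pi.smul_apply, smul_eq_mul, mul_pow, mul_left_comm,
    mul_div_mul_left _ _ (pow_ne_zero 2 ha)]

theorem lineCap_circ (i : Fin 2) (σ θ : ℝ) :
    lineCap i σ (circ θ) = cutoff (circ θ i ^ 2 / σ ^ 2) := by
  rw [lineCap, euclidSq_circ, mul_one]

theorem lineCap_nonneg (i : Fin 2) (σ : ℝ) (x : Plane) : 0 ≤ lineCap i σ x := cutoff_nonneg _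

theorem lineCap_le_one (i : Fin 2) (σ : ℝ) (x : Plane) : lineCap i σ x ≤ 1 := cutoff_le_one _

/-- The element of `V_τ` whose restriction to the circle is the bump `lineCap`. -/
def capVector (τ : ℂ) (i : Fin 2) (σ : ℝ) : V τ :=
  ⟨fun x => open Classical in
    if x = 0 then 0 else absPow (Real.sqrt (euclidSq x)) (τ - 1) * lineCap i σ x, by
    have hhom : ∀ a : ℝ, a ≠ 0 → ∀ x : Plane,
        (open Classical in if a • x = 0 then (0 : ℂ) else
          absPow (Real.sqrt (euclidSq (a • x))) (τ - 1) * lineCap i σ (a • x)) =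
        absPow a (τ - 1) * (open Classical in if x = 0 then (0 : ℂ) else
          absPow (Real.sqrt (euclidSq x)) (τ - 1) * lineCap i σ x) := by
      intro a ha x
      by_cases hx : x = 0
      · simp [hx]
      · rw [if_neg (smul_ne_zero ha hx), if_neg hx, euclidSq_smul, lineCap_smul i σ ha,
          Real.sqrt_mul (sq_nonneg a), Real.sqrt_sq_eq_abs, absPow_mul, absPow_abs, mul_assoc]
    refine ⟨if_pos rfl, hhom, contDiffOn_of_contDiff_circ hhom ?_⟩
    have e : (fun θ => open Classical in if circ θ = 0 then (0 : ℂ) else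
        absPow (Real.sqrt (euclidSq (circ θ))) (τ - 1) * lineCap i σ (circ θ)) =
        fun θ => ((cutoff (circ θ i ^ 2 / σ ^ 2) : ℝ) : ℂ) := by
      funext θ
      rw [if_neg (circ_ne_zero θ), euclidSq_circ, lineCap_circ]
      simp [absPow]
    rw [e]
    refine Complex.ofRealCLM.contDiff.comp (contDiff_cutoff.comp ?_)
    exact (((contDiff_apply ℝ ℝ i).comp contDiff_circ).pow 2).div_const _⟩

theorem capVector_apply (τ : ℂ) (i : Fin 2) (σ : ℝ) {x : Plane} (hx : x ≠ 0) :
    (capVector τ i σ).1 x = absPow (Real.sqrt (euclidSq x)) (τ - 1) * lineCap i σ x := if_neg hx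

theorem onCircle_capVector (τ : ℂ) (i : Fin 2) (σ θ : ℝ) :
    V.onCircle (capVector τ i σ) θ = lineCap i σ (circ θ) := by
  rw [V.onCircle, capVector_apply _ _ _ (circ_ne_zero θ), euclidSq_circ]
  simp [absPow]

/-- The total mass of a bump of angular size `σ` on the circle. -/
def capMass (σ : ℝ) : ℝ := ∫ θ in Set.Icc 0 (2 * Real.pi), cutoff (Real.sin θ ^ 2 / σ ^ 2)

theorem continuous_lineCap_circ (i : Fin 2) (σ : ℝ) : Continuous fun θ => lineCap i σ (circ θ) := by
  simp only [lineCap_circ]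
  exact contDiff_cutoff.continuous.comp
    (((continuous_apply i).comp contDiff_circ.continuous).pow 2 |>.div_const _)

theorem continuous_cutoff_sin (σ : ℝ) : Continuous fun θ => cutoff (Real.sin θ ^ 2 / σ ^ 2) :=
  contDiff_cutoff.continuous.comp ((Real.continuous_sin.pow 2).div_const _)

theorem periodic_cutoff_sin (σ : ℝ) :
    Function.Periodic (fun θ => cutoff (Real.sin θ ^ 2 / σ ^ 2)) Real.pi := by
  intro θ
  simp [Real.sin_add_pi]

theorem capMass_eq (σ : ℝ) :
    capMass σ = ∫ θ in (0 : ℝ)..(2 * Real.pi), cutoff (Real.sin θ ^ 2 / σ ^ 2) := by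
  rw [capMass, integral_Icc_eq_integral_Ioc, intervalIntegral.integral_of_le Real.two_pi_pos.le]

theorem setIntegral_lineCap (i : Fin 2) (σ : ℝ) :
    ∫ θ in Set.Icc 0 (2 * Real.pi), lineCap i σ (circ θ) = capMass σ := by
  simp only [lineCap_circ]
  fin_cases i
  · have e : ∀ θ, circ θ (⟨0, by norm_num⟩ : Fin 2) = Real.sin (θ + Real.pi / 2) := fun θ => by
      simp [circ, Real.sin_add_pi_div_two]
    simp only [e]
    rw [capMass_eq, integral_Icc_eq_integral_Ioc,
      ← intervalIntegral.integral_of_le Real.two_pi_pos.le,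
      intervalIntegral.integral_comp_add_right (fun θ => cutoff (Real.sin θ ^ 2 / σ ^ 2))]
    have := ((periodic_cutoff_sin σ).nat_mul 2).intervalIntegral_add_eq (0 + Real.pi / 2) 0
    push_cast at this
    simp only [zero_add] at this ⊢
    rw [← this]
    congr 1
    ring
  · rfl

theorem le_setIntegral_of_eq_one {f : ℝ → ℝ} (hf : Continuous f) (h0 : ∀ θ, 0 ≤ f θ) {a b : ℝ}
    (hab : a ≤ b) (ha : 0 ≤ a) (hb : b ≤ 2 * Real.pi) (h1 : ∀ θ ∈ Set.Icc a b, f θ = 1) :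
    b - a ≤ ∫ θ in Set.Icc 0 (2 * Real.pi), f θ := by
  have h2 : ∫ θ in Set.Icc a b, f θ = b - a := by
    rw [setIntegral_congr_fun measurableSet_Icc h1, integral_const, smul_eq_mul, mul_one,
      measureReal_restrict_apply_univ, Real.volume_real_Icc_of_le hab]
  rw [← h2]
  exact setIntegral_mono_set (hf.continuousOn.integrableOn_compact isCompact_Icc)
    (Filter.Eventually.of_forall h0) (Set.Icc_subset_Icc ha hb).eventuallyLE

theorem le_capMass {σ : ℝ} (hσ : 0 < σ) (hσ1 : σ ≤ 1) : 7 / 5 * σ ≤ capMass σ := by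
  have hpi := Real.pi_gt_three
  have h := le_setIntegral_of_eq_one (continuous_cutoff_sin σ) (fun θ => cutoff_nonneg _)
    (a := Real.pi - 7 / 10 * σ) (b := Real.pi + 7 / 10 * σ) (by linarith) (by linarith)
    (by linarith) fun θ hθ => ?_
  · rw [capMass]
    linarith
  refine cutoff_eq_one ?_
  have h2 : |Real.sin θ| ≤ 7 / 10 * σ := by
    have : |Real.sin (Real.pi - θ)| ≤ |Real.pi - θ| := Real.abs_sin_le_abs
    rw [Real.sin_pi_sub] at this
    refine this.trans (abs_le.2 ⟨by linarith [hθ.2], by linarith [hθ.1]⟩)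
  have h3 : Real.sin θ ^ 2 ≤ (7 / 10 * σ) ^ 2 :=
    sq_le_sq' (by linarith [abs_le.1 h2]) (abs_le.1 h2).2
  rw [div_le_iff₀ (by positivity)]
  nlinarith [sq_nonneg σ]

theorem capMass_le {σ : ℝ} (hσ : 0 < σ) : capMass σ ≤ 7 * σ := by
  have hpi := Real.pi_pos
  have hpi' := Real.pi_lt_d2
  have hii : ∀ a b, IntervalIntegrable (fun θ => cutoff (Real.sin θ ^ 2 / σ ^ 2)) volume a b :=
    fun a b => (continuous_cutoff_sin σ).intervalIntegrable a b
  have h1 : capMass σ =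
      2 * ∫ θ in (-(Real.pi / 2))..(Real.pi / 2), cutoff (Real.sin θ ^ 2 / σ ^ 2) := by
    have e1 := (periodic_cutoff_sin σ).intervalIntegral_add_eq 0 (-(Real.pi / 2))
    have e2 := (periodic_cutoff_sin σ).intervalIntegral_add_eq Real.pi (-(Real.pi / 2))
    rw [zero_add] at e1
    rw [show -(Real.pi / 2) + Real.pi = Real.pi / 2 by ring] at e1 e2
    rw [capMass_eq, ← intervalIntegral.integral_add_adjacent_intervals (hii 0 Real.pi) (hii _ _),
      e1, show 2 * Real.pi = Real.pi + Real.pi by ring, e2]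
    ring
  have h2 : ∫ θ in (-(Real.pi / 2))..(Real.pi / 2), cutoff (Real.sin θ ^ 2 / σ ^ 2) ≤
      Real.pi * σ := by
    rw [intervalIntegral.integral_of_le (by linarith), ← integral_Icc_eq_integral_Ioc]
    have h3 : ∀ θ ∈ Set.Icc (-(Real.pi / 2)) (Real.pi / 2), cutoff (Real.sin θ ^ 2 / σ ^ 2) ≤
        (Set.Icc (-(Real.pi / 2 * σ)) (Real.pi / 2 * σ)).indicator (fun _ => (1 : ℝ)) θ := by
      intro θ hθ
      by_cases h0 : cutoff (Real.sin θ ^ 2 / σ ^ 2) = 0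
      · rw [h0]
        exact Set.indicator_nonneg (fun _ _ => zero_le_one) _
      · have h4 := lt_one_of_cutoff_ne_zero h0
        rw [div_lt_one (by positivity)] at h4
        have h5 : |Real.sin θ| < σ := abs_lt_of_sq_lt_sq h4 hσ.le
        have h6 := Real.mul_abs_le_abs_sin (abs_le.2 hθ)
        have h7 : |θ| ≤ Real.pi / 2 * σ := by
          have : 2 / Real.pi * |θ| ≤ σ := h6.trans h5.le
          rw [div_mul_eq_mul_div, div_le_iff₀ hpi] at this
          linarith
        rw [Set.indicator_of_mem (Set.mem_Icc.2 (abs_le.1 h7))]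
        exact cutoff_le_one _
    calc ∫ θ in Set.Icc (-(Real.pi / 2)) (Real.pi / 2), cutoff (Real.sin θ ^ 2 / σ ^ 2)
        ≤ ∫ θ in Set.Icc (-(Real.pi / 2)) (Real.pi / 2),
          (Set.Icc (-(Real.pi / 2 * σ)) (Real.pi / 2 * σ)).indicator (fun _ => (1 : ℝ)) θ := by
          refine setIntegral_mono_on
            ((continuous_cutoff_sin σ).continuousOn.integrableOn_compact isCompact_Icc)
            ((integrable_const _).indicator measurableSet_Icc) measurableSet_Icc h3
      _ ≤ ∫ θ, (Set.Icc (-(Real.pi / 2 * σ)) (Real.pi / 2 * σ)).indicator (fun _ => (1 : ℝ)) θ := by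
          refine setIntegral_le_integral ?_ (Filter.Eventually.of_forall fun θ =>
            Set.indicator_nonneg (fun _ _ => zero_le_one) _)
          exact (integrable_indicator_iff measurableSet_Icc).2 (integrableOn_const (by simp))
      _ = Real.pi * σ := by
          rw [integral_indicator measurableSet_Icc, integral_const, smul_eq_mul, mul_one,
            measureReal_restrict_apply_univ, Real.volume_real_Icc_of_le (by nlinarith)]
          ring
  rw [h1]
  nlinarith

/-- The bump vector of size `σ`, centred at the pair of coordinate lines `x₀ = 0` and `y₁ = 0`,
normalised to have integral `1`.  The two lines are distinct, so that the invariant of the two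
variables, which is singular on the diagonal, stays away from `0` on its support. -/
def bumpVector (τ τ' : ℂ) (σ : ℝ) : E τ τ' :=
  (((capMass σ ^ 2)⁻¹ : ℝ) : ℂ) • E.tmul (capVector τ 0 σ) (capVector τ' 1 σ)

theorem onTorus_bumpVector (τ τ' : ℂ) (σ : ℝ) (p : ℝ × ℝ) : E.onTorus (bumpVector τ τ' σ) p =
    (((capMass σ ^ 2)⁻¹ * (lineCap 0 σ (circ p.1) * lineCap 1 σ (circ p.2)) : ℝ) : ℂ) := by
  have h : E.onTorus (bumpVector τ τ' σ) p = (((capMass σ ^ 2)⁻¹ : ℝ) : ℂ) *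
      (V.onCircle (capVector τ 0 σ) p.1 * V.onCircle (capVector τ' 1 σ) p.2) := rfl
  rw [h, onCircle_capVector, onCircle_capVector]
  push_cast
  ring

theorem exists_int_abs_sub_le {σ t : ℝ} (h : |Real.sin t| ≤ σ) :
    ∃ m : ℤ, |t - m * Real.pi| ≤ Real.pi / 2 * σ := by
  have hpi := Real.pi_pos
  refine ⟨round (t / Real.pi), ?_⟩
  set m := round (t / Real.pi)
  have h1 : |t - m * Real.pi| ≤ Real.pi / 2 := by
    have h2 := abs_sub_round (t / Real.pi)
    have h3 : t - m * Real.pi = (t / Real.pi - m) * Real.pi := by field_simp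
    rw [h3, abs_mul, abs_of_pos hpi]
    nlinarith
  have h2 := Real.mul_abs_le_abs_sin h1
  have h3 : |Real.sin (t - m * Real.pi)| = |Real.sin t| := by
    rw [Real.sin_sub_int_mul_pi, abs_mul, abs_zpow, abs_neg, abs_one, one_zpow, one_mul]
  rw [h3, div_mul_eq_mul_div, div_le_iff₀ hpi] at h2
  nlinarith

theorem setIntegral_lineCap_mul (σ : ℝ) :
    ∫ p in square, lineCap 0 σ (circ p.1) * lineCap 1 σ (circ p.2) = capMass σ ^ 2 := by
  rw [volume_restrict_square, integral_prod_mul (fun x => lineCap 0 σ (circ x))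
    (fun y => lineCap 1 σ (circ y)), setIntegral_lineCap, setIntegral_lineCap, pow_two]

/-- The size `1 / (250 T)` is small enough for the support, which has radius at most
`√2 (π / 2) / (250 T)`, and large enough for the `L²` norm. -/
theorem isBump_bumpVector (τ τ' : ℂ) {T : ℝ} (hT : 1 ≤ T) :
    IsBump T (bumpVector τ τ' (250 * T)⁻¹) := by
  set σ := (250 * T)⁻¹ with hσdef
  have hT0 : 0 < T := by linarith
  have hσ : 0 < σ := by positivity
  have hσ1 : σ ≤ 1 := inv_le_one_of_one_le₀ (by linarith)
  have hm := le_capMass hσ hσ1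
  have hm0 : 0 < capMass σ := by linarith
  have hsin : ∀ {i : Fin 2} {θ : ℝ}, lineCap i σ (circ θ) ≠ 0 → |circ θ i| ≤ σ := by
    intro i θ h
    rw [lineCap_circ] at h
    have h1 := lt_one_of_cutoff_ne_zero h
    rw [div_lt_one (by positivity)] at h1
    exact (abs_lt_of_sq_lt_sq h1 hσ.le).le
  refine ⟨fun p => ⟨_, ?_, onTorus_bumpVector τ τ' σ p⟩, ⟨(Real.pi / 2, 0), fun p hp => ?_⟩, ?_, ?_⟩
  · have := lineCap_nonneg 0 σ (circ p.1)
    have := lineCap_nonneg 1 σ (circ p.2)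
    positivity
  · rw [onTorus_bumpVector] at hp
    have hp' := Complex.ofReal_ne_zero.1 hp
    have h0 : lineCap 0 σ (circ p.1) ≠ 0 := fun h => hp' (by rw [h]; ring)
    have h1 : lineCap 1 σ (circ p.2) ≠ 0 := fun h => hp' (by rw [h]; ring)
    have k0 : |Real.sin (p.1 - Real.pi / 2)| ≤ σ := by
      rw [Real.sin_sub_pi_div_two, abs_neg]
      exact hsin h0
    have k1 : |Real.sin p.2| ≤ σ := hsin h1
    obtain ⟨m, hm⟩ := exists_int_abs_sub_le k0
    obtain ⟨n, hn⟩ := exists_int_abs_sub_le k1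
    refine ⟨m, n, ?_⟩
    have hpi : Real.pi < 3.15 := Real.pi_lt_d2
    have hpi0 := Real.pi_pos
    have e1 := sq_le_sq' (by linarith [(abs_le.1 hm).1]) (abs_le.1 hm).2
    have e2 := sq_le_sq' (by linarith [(abs_le.1 hn).1]) (abs_le.1 hn).2
    have e3 : (100 * T)⁻¹ = 5 / 2 * σ := by
      rw [hσdef]
      field_simp
      norm_num
    have e4 : Real.pi / 2 * σ ≤ 1.6 * σ := by nlinarith
    have e5 : (Real.pi / 2 * σ) ^ 2 ≤ (1.6 * σ) ^ 2 := by gcongr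
    rw [e3]
    simp only [sub_zero]
    nlinarith [sq_nonneg σ]
  · simp only [onTorus_bumpVector]
    rw [integral_complex_ofReal, integral_const_mul, setIntegral_lineCap_mul,
      inv_mul_cancel₀ (by positivity), Complex.ofReal_one]
  · have hcont : Continuous fun p : ℝ × ℝ => lineCap 0 σ (circ p.1) * lineCap 1 σ (circ p.2) :=
      ((continuous_lineCap_circ 0 σ).comp continuous_fst).mul
        ((continuous_lineCap_circ 1 σ).comp continuous_snd)
    have h1 : ∫ p in square, ‖E.onTorus (bumpVector τ τ' σ) p‖ ^ 2 ≤
        ∫ p in square, ((capMass σ ^ 2)⁻¹) ^ 2 *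
          (lineCap 0 σ (circ p.1) * lineCap 1 σ (circ p.2)) := by
      refine setIntegral_mono_on ?_ ?_ isCompact_square.measurableSet fun p _ => ?_
      · exact ((E.contDiff_onTorus _).continuous.norm.pow 2).continuousOn.integrableOn_compact
          isCompact_square
      · exact (continuous_const.mul hcont).continuousOn.integrableOn_compact isCompact_square
      · have n0 := lineCap_nonneg 0 σ (circ p.1)
        have n1 := lineCap_nonneg 1 σ (circ p.2)
        have l0 := lineCap_le_one 0 σ (circ p.1)
        have l1 := lineCap_le_one 1 σ (circ p.2)
        rw [onTorus_bumpVector, Complex.norm_real, Real.norm_of_nonneg (by positivity), mul_pow]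
        gcongr
        have n2 : 0 ≤ lineCap 0 σ (circ p.1) * lineCap 1 σ (circ p.2) := mul_nonneg n0 n1
        have l2 : lineCap 0 σ (circ p.1) * lineCap 1 σ (circ p.2) ≤ 1 := mul_le_one₀ l0 n1 l1
        nlinarith
    refine h1.trans ?_
    rw [integral_const_mul, setIntegral_lineCap_mul, pow_two, mul_assoc,
      inv_mul_cancel₀ (by positivity), mul_one]
    have h2 : (7 / 5 * σ) ^ 2 ≤ capMass σ ^ 2 := by gcongr
    calc (capMass σ ^ 2)⁻¹ ≤ ((7 / 5 * σ) ^ 2)⁻¹ := inv_anti₀ (by positivity) h2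
      _ = (5 / 7 * 250) ^ 2 * T ^ 2 := by
        rw [hσdef]
        field_simp
      _ ≤ 10 ^ 5 * T ^ 2 := by gcongr; norm_num

/-! ### Transformed bumps have comparable mass -/

/-- A linear form in `(sin s, cos s)` close to `± sin s` vanishes at a point near `0`, hence is
small compared with a complementary form on an interval of length `σ`. -/
theorem exists_sq_linear_sin_cos_le {P Q R S : ℝ} (hP : 99 / 100 ≤ |P|) (hP' : |P| ≤ 101 / 100)
    (hQ : |Q| ≤ 1 / 100) (hR : |R| ≤ 1 / 100) (hS : 99 / 100 ≤ |S|) :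
    ∃ s₀ : ℝ, |s₀| ≤ 1 / 20 ∧ ∀ σ : ℝ, 0 < σ → σ ≤ 1 / 250 → ∀ s, |s - s₀| ≤ σ / 2 →
      (P * Real.sin s + Q * Real.cos s) ^ 2 ≤ 1 / 2 * (σ ^ 2 *
        ((P * Real.sin s + Q * Real.cos s) ^ 2 + (R * Real.sin s + S * Real.cos s) ^ 2)) := by
  have hP0 : P ≠ 0 := by
    rintro rfl
    norm_num at hP
  set s₀ := Real.arctan (-Q / P) with hs₀
  have hs0 : |s₀| ≤ 1 / 20 := by
    have h1 : |-Q / P| ≤ 1 / 20 := by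
      rw [abs_div, abs_neg, div_le_iff₀ (abs_pos.2 hP0)]
      linarith
    have hmem := Real.arctan_mem_Ioo (-Q / P)
    have ht : Real.tan s₀ = -Q / P := Real.tan_arctan _
    rcases le_total 0 s₀ with h | h
    · have := Real.le_tan h hmem.2
      rw [ht] at this
      rw [abs_of_nonneg h]
      exact this.trans ((le_abs_self _).trans h1)
    · have := Real.le_tan (x := -s₀) (by linarith) (by linarith [hmem.1])
      rw [Real.tan_neg, ht] at this
      rw [abs_of_nonpos h]
      exact this.trans ((neg_le_abs _).trans h1)
  refine ⟨s₀, hs0, fun σ hσ hσ1 s hs => ?_⟩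
  have hzero : P * Real.sin s₀ + Q * Real.cos s₀ = 0 := by
    have hc : Real.cos s₀ ≠ 0 := (Real.cos_arctan_pos _).ne'
    rw [← Real.tan_mul_cos hc, hs₀, Real.tan_arctan]
    field_simp
    ring
  have hf : |P * Real.sin s + Q * Real.cos s| ≤ 51 / 100 * σ := by
    have e : P * Real.sin s + Q * Real.cos s =
        P * (Real.sin s - Real.sin s₀) + Q * (Real.cos s - Real.cos s₀) := by
      linear_combination hzero
    have h1 := (Real.abs_sin_sub_sin_le s s₀).trans hs
    have h2 := (Real.abs_cos_sub_cos_le s s₀).trans hs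
    rw [e]
    calc _ ≤ |P| * |Real.sin s - Real.sin s₀| + |Q| * |Real.cos s - Real.cos s₀| := by
          rw [← abs_mul, ← abs_mul]
          exact abs_add_le _ _
      _ ≤ 101 / 100 * (σ / 2) + 1 / 100 * (σ / 2) := by gcongr
      _ = 51 / 100 * σ := by ring
  have hs' : |s| ≤ 6 / 100 := by
    have := abs_sub_abs_le_abs_sub s s₀
    linarith
  have hcos : 99 / 100 ≤ Real.cos s := by
    have h1 := Real.one_sub_sq_div_two_le_cos (x := s)
    have h2 : s ^ 2 ≤ (6 / 100) ^ 2 := sq_le_sq' (abs_le.1 hs').1 (abs_le.1 hs').2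
    nlinarith
  have hg : 95 / 100 ≤ |R * Real.sin s + S * Real.cos s| := by
    have h1 : |S * Real.cos s| - |R * Real.sin s| ≤ |R * Real.sin s + S * Real.cos s| := by
      have := abs_sub_abs_le_abs_sub (S * Real.cos s) (-(R * Real.sin s))
      rwa [abs_neg, sub_neg_eq_add, add_comm (S * _)] at this
    have h2 : 99 / 100 * (99 / 100) ≤ |S * Real.cos s| := by
      rw [abs_mul]
      exact mul_le_mul hS (hcos.trans (le_abs_self _)) (by norm_num) (abs_nonneg _)
    have h3 : |R * Real.sin s| ≤ 1 / 100 * 1 := by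
      rw [abs_mul]
      exact mul_le_mul hR (Real.abs_sin_le_one s) (abs_nonneg _) (by norm_num)
    linarith
  have h1 : (P * Real.sin s + Q * Real.cos s) ^ 2 ≤ (51 / 100 * σ) ^ 2 :=
    sq_le_sq' (abs_le.1 hf).1 (abs_le.1 hf).2
  have h2 : (95 / 100 : ℝ) ^ 2 ≤ (R * Real.sin s + S * Real.cos s) ^ 2 := by
    rw [← sq_abs (R * Real.sin s + S * Real.cos s)]
    gcongr
  nlinarith [mul_nonneg (sq_nonneg σ) (sq_nonneg (P * Real.sin s + Q * Real.cos s)),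
    mul_le_mul_of_nonneg_left h2 (sq_nonneg σ)]

section Caps

variable {A : GL (Fin 2) ℝ}

theorem PGL2R.abs_entry_le_of_mem_nearOne (hA : A ∈ PGL2R.nearOne) {i j : Fin 2} (h : i ≠ j) :
    |(A : Matrix (Fin 2) (Fin 2) ℝ) i j| ≤ 1 / 100 := by
  simpa [Matrix.one_apply_ne h] using (hA i j).1.le

theorem PGL2R.abs_diag_sub_one_le_of_mem_nearOne (hA : A ∈ PGL2R.nearOne) (i : Fin 2) :
    |(A : Matrix (Fin 2) (Fin 2) ℝ) i i - 1| ≤ 1 / 100 := by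
  simpa using (hA i i).1.le

theorem PGL2R.inv_mem_nearOne (hA : A ∈ PGL2R.nearOne) : A⁻¹ ∈ PGL2R.nearOne := fun i j =>
  ⟨(hA i j).2, by simpa using (hA i j).1⟩

theorem continuous_lineCap_mulVec (A : GL (Fin 2) ℝ) (i : Fin 2) {σ : ℝ} (hσ : σ ≠ 0) :
    Continuous fun θ => lineCap i σ ((A : Matrix (Fin 2) (Fin 2) ℝ).mulVec (circ θ)) := by
  have hc : Continuous fun θ => (A : Matrix (Fin 2) (Fin 2) ℝ).mulVec (circ θ) :=
    (contDiff_mulVec _).continuous.comp contDiff_circ.continuous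
  have hc' : ∀ j, Continuous fun θ => (A : Matrix (Fin 2) (Fin 2) ℝ).mulVec (circ θ) j :=
    fun j => (continuous_apply j).comp hc
  unfold lineCap
  refine contDiff_cutoff.continuous.comp (((hc' i).pow 2).div ?_ fun θ => ?_)
  · exact continuous_const.mul (((hc' 0).pow 2).add ((hc' 1).pow 2))
  · exact mul_ne_zero (pow_ne_zero 2 hσ) (euclidSq_pos (mulVec_ne_zero A (circ_ne_zero θ))).ne'

theorem le_setIntegral_lineCap_mulVec (hA : A ∈ PGL2R.nearOne) (i : Fin 2) {σ : ℝ} (hσ : 0 < σ)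
    (hσ1 : σ ≤ 1 / 250) : σ ≤ ∫ θ in Set.Icc 0 (2 * Real.pi),
      lineCap i σ ((A : Matrix (Fin 2) (Fin 2) ℝ).mulVec (circ θ)) := by
  have hpi := Real.pi_gt_three
  have hdiag : ∀ j : Fin 2, 99 / 100 ≤ |(A : Matrix (Fin 2) (Fin 2) ℝ) j j| ∧
      |(A : Matrix (Fin 2) (Fin 2) ℝ) j j| ≤ 101 / 100 := fun j => by
    have h := abs_le.1 (PGL2R.abs_diag_sub_one_le_of_mem_nearOne hA j)
    rw [abs_of_nonneg (by linarith)]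
    exact ⟨by linarith, by linarith⟩
  have h01 := PGL2R.abs_entry_le_of_mem_nearOne hA (show (0 : Fin 2) ≠ 1 by decide)
  have h10 := PGL2R.abs_entry_le_of_mem_nearOne hA (show (1 : Fin 2) ≠ 0 by decide)
  -- `φ` is the centre of the cap before the transformation, `φ + s₀` that of the transformed cap;
  -- of the two antipodal centres, one in the interior of `[0, 2 π]` is taken.
  obtain ⟨φ, hφ, hφ', s₀, hs₀, h⟩ : ∃ φ, 3 / 2 ≤ φ ∧ φ ≤ Real.pi ∧ ∃ s₀ : ℝ, |s₀| ≤ 1 / 20 ∧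
      ∀ s, |s - s₀| ≤ σ / 2 →
        lineCap i σ ((A : Matrix (Fin 2) (Fin 2) ℝ).mulVec (circ (φ + s))) = 1 := by
    fin_cases i
    · obtain ⟨s₀, hs₀, h⟩ := exists_sq_linear_sin_cos_le (P := -A 0 0) (Q := A 0 1) (R := -A 1 0)
        (S := A 1 1) (by rw [abs_neg]; exact (hdiag 0).1) (by rw [abs_neg]; exact (hdiag 0).2) h01
        (by rw [abs_neg]; exact h10) (hdiag 1).1
      refine ⟨Real.pi / 2, by linarith, by linarith, s₀, hs₀, fun s hs => cutoff_eq_one ?_⟩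
      have e := h σ hσ hσ1 s hs
      have e0 : (A : Matrix (Fin 2) (Fin 2) ℝ).mulVec (circ (Real.pi / 2 + s)) 0 =
          -A 0 0 * Real.sin s + A 0 1 * Real.cos s := by
        simp [Matrix.mulVec, dotProduct, Fin.sum_univ_two, circ, add_comm (Real.pi / 2),
          Real.cos_add_pi_div_two, Real.sin_add_pi_div_two]
      have e1 : (A : Matrix (Fin 2) (Fin 2) ℝ).mulVec (circ (Real.pi / 2 + s)) 1 =
          -A 1 0 * Real.sin s + A 1 1 * Real.cos s := by
        simp [Matrix.mulVec, dotProduct, Fin.sum_univ_two, circ, add_comm (Real.pi / 2),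
          Real.cos_add_pi_div_two, Real.sin_add_pi_div_two]
      rw [← e0, ← e1] at e
      exact div_le_of_le_mul₀ (by unfold euclidSq; positivity) (by norm_num) e
    · obtain ⟨s₀, hs₀, h⟩ := exists_sq_linear_sin_cos_le (P := -A 1 1) (Q := -A 1 0) (R := -A 0 1)
        (S := -A 0 0) (by rw [abs_neg]; exact (hdiag 1).1) (by rw [abs_neg]; exact (hdiag 1).2)
        (by rw [abs_neg]; exact h10) (by rw [abs_neg]; exact h01)
        (by rw [abs_neg]; exact (hdiag 0).1)
      refine ⟨Real.pi, by linarith, le_rfl, s₀, hs₀, fun s hs => cutoff_eq_one ?_⟩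
      have e := h σ hσ hσ1 s hs
      have e0 : (A : Matrix (Fin 2) (Fin 2) ℝ).mulVec (circ (Real.pi + s)) 0 =
          -A 0 1 * Real.sin s + -A 0 0 * Real.cos s := by
        simp [Matrix.mulVec, dotProduct, Fin.sum_univ_two, circ, add_comm Real.pi]
        ring
      have e1 : (A : Matrix (Fin 2) (Fin 2) ℝ).mulVec (circ (Real.pi + s)) 1 =
          -A 1 1 * Real.sin s + -A 1 0 * Real.cos s := by
        simp [Matrix.mulVec, dotProduct, Fin.sum_univ_two, circ, add_comm Real.pi]
        ring
      rw [← e0, ← e1] at e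
      rw [add_comm (_ ^ 2)] at e
      exact div_le_of_le_mul₀ (by unfold euclidSq; positivity) (by norm_num) e
  have hs := abs_le.1 hs₀
  have := le_setIntegral_of_eq_one (continuous_lineCap_mulVec A i hσ.ne')
    (fun θ => lineCap_nonneg i σ _) (a := φ + s₀ - σ / 2) (b := φ + s₀ + σ / 2) (by linarith)
    (by linarith) (by linarith) fun θ hθ => by
      have := h (θ - φ) (abs_le.2 ⟨by linarith [hθ.1], by linarith [hθ.2]⟩)
      rwa [add_sub_cancel] at this
  linarith

/-- On the support of a transformed cap the small coordinate is controlled by the large one. -/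
theorem abs_div_le_of_lineCap_ne_zero {i j : Fin 2} (hij : i ≠ j) {σ : ℝ} (hσ : 0 < σ)
    (hσ1 : σ ≤ 1 / 250) {x : Plane} (hx : x ≠ 0) (h : lineCap i σ x ≠ 0) :
    x j ≠ 0 ∧ |x i / x j| ≤ 2 * σ := by
  have h1 := lt_one_of_cutoff_ne_zero h
  have hE : euclidSq x = x i ^ 2 + x j ^ 2 := by
    fin_cases i <;> fin_cases j <;> simp_all [euclidSq, add_comm]
  have hE0 := euclidSq_pos hx
  rw [div_lt_one (by positivity), hE] at h1
  have hσ2 : σ ^ 2 ≤ 1 / 2 := by nlinarith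
  have h2 : x i ^ 2 ≤ (2 * σ) ^ 2 * x j ^ 2 := by
    nlinarith [mul_nonneg (sub_nonneg.2 hσ2) (sq_nonneg (x i)),
      mul_nonneg (sq_nonneg σ) (sq_nonneg (x j))]
  have hj : x j ≠ 0 := by
    intro h0
    rw [h0] at h1 h2
    nlinarith [sq_nonneg (x i), mul_nonneg (sub_nonneg.2 hσ2) (sq_nonneg (x i))]
  refine ⟨hj, ?_⟩
  rw [abs_div, div_le_iff₀ (abs_pos.2 hj)]
  refine abs_le_of_sq_le_sq ?_ (by positivity)
  rw [mul_pow, sq_abs]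
  exact h2

end Caps

/-! ### The phase of the model kernel on a bump -/

theorem exp_half_le_re_cexp {w : ℂ} {K : ℝ} (h1 : -K ≤ w.re) (h2 : |w.im| ≤ 1) :
    Real.exp (-K) / 2 ≤ (Complex.exp w).re := by
  have h3 : 1 / 2 ≤ Real.cos w.im := by
    have h4 := Real.one_sub_sq_div_two_le_cos (x := w.im)
    have h5 : w.im ^ 2 ≤ 1 := (sq_le_one_iff_abs_le_one _).2 h2
    linarith
  rw [Complex.exp_re, div_eq_mul_one_div]
  exact mul_le_mul (Real.exp_le_exp.2 h1) h3 (by norm_num) (Real.exp_pos _).le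

theorem abs_mul_le_mul {a b X Y : ℝ} (ha : |a| ≤ X) (hb : |b| ≤ Y) : |a * b| ≤ X * Y :=
  (abs_mul a b).trans_le (mul_le_mul ha hb (abs_nonneg _) ((abs_nonneg _).trans ha))

theorem abs_log_le_one {r : ℝ} (h1 : 1 / 2 ≤ |r|) (h2 : |r| ≤ 2) : |Real.log r| ≤ 1 := by
  have h0 : 0 < |r| := by linarith
  rw [← Real.log_abs, abs_le]
  constructor
  · have h3 := Real.log_le_log (by norm_num) h1
    rw [one_div, Real.log_inv] at h3
    linarith [Real.log_two_lt_d9]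
  · linarith [Real.log_le_sub_one_of_pos h0]

theorem abs_log_sub_log_le {r s : ℝ} (hr : 1 / 2 ≤ |r|) (hs : 1 / 2 ≤ |s|) :
    |Real.log r - Real.log s| ≤ 2 * |r - s| := by
  have key : ∀ {x y : ℝ}, 1 / 2 ≤ |x| → 1 / 2 ≤ |y| →
      Real.log |x| - Real.log |y| ≤ 2 * |x - y| := by
    intro x y hx hy
    have hx0 : 0 < |x| := by linarith
    have hy0 : 0 < |y| := by linarith
    rw [← Real.log_div hx0.ne' hy0.ne']
    refine (Real.log_le_sub_one_of_pos (by positivity)).trans ?_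
    rw [div_sub_one hy0.ne', div_le_iff₀ hy0]
    have h1 := abs_sub_abs_le_abs_sub x y
    nlinarith [abs_nonneg (x - y)]
  rw [← Real.log_abs r, ← Real.log_abs s, abs_le]
  have h1 := key hr hs
  have h2 := key hs hr
  rw [abs_sub_comm s r] at h2
  exact ⟨by linarith, h1⟩

/-- The exponential of the logarithm of the integrand of the model functional has a real part bounded
below, after a rotation by the phase at the centre of the bump.  The logarithms `k` and `k'` of the
two scale factors enter with real coefficient `-2` only, by homogeneity, and the logarithms `l₁`,
`l₂`, `l₃` of the three invariants vary by `O(1 / T)` from their values `m₁`, `m₂`, `m₃` at the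
centre, while their coefficients are `O(T)`. -/
theorem exp_le_re_cexp_trilinear {τ τ' lam : ℂ} (hτ : IsClassOneParam τ) (hτ' : IsClassOneParam τ')
    (hlam : lam.re = 0) {T : ℝ} (hT : 5 * (‖τ‖ + ‖τ'‖) + 1 ≤ T) (hlamT : ‖lam‖ ≤ 2 * T)
    {d d' k k' a a' l₁ l₂ l₃ m₁ m₂ m₃ : ℝ} (hd : |d| ≤ 1) (hd' : |d'| ≤ 1) (hk : k ≤ 1)
    (hk' : k' ≤ 1) (ha : |a| ≤ 1 / (50 * T)) (ha' : |a'| ≤ 1 / (50 * T)) (hl₁ : |l₁| ≤ 1)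
    (hl₂ : |l₂| ≤ 1) (hl₃ : |l₃| ≤ 1) (hm₁ : |l₁ - m₁| ≤ 1 / (50 * T))
    (hm₂ : |l₂ - m₂| ≤ 1 / (50 * T)) (hm₃ : |l₃ - m₃| ≤ 1 / (50 * T)) :
    Real.exp (-10) / 2 ≤ (Complex.exp (
      -(((τ.im * d + τ'.im * d' + (τ.im - τ'.im - lam.im) * m₁ + (-τ.im + τ'.im - lam.im) * m₂ +
        (-τ.im - τ'.im + lam.im) * m₃) / 2 : ℝ) : ℂ) * Complex.I +
      ((τ - 1) / 2 * (d : ℝ) + (τ' - 1) / 2 * (d' : ℝ) + ((τ - 1) * ((k + a : ℝ) : ℂ) +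
        (τ' - 1) * ((k' + a' : ℝ) : ℂ)) + ((τ - τ' - lam - 1) / 2 * ((k' + l₁ : ℝ) : ℂ) +
        (-τ + τ' - lam - 1) / 2 * ((k + l₂ : ℝ) : ℂ) +
        (-τ - τ' + lam - 1) / 2 * ((k + k' + l₃ : ℝ) : ℂ))))).re := by
  obtain ⟨h1, h2⟩ := hτ.re_mem
  obtain ⟨h1', h2'⟩ := hτ'.re_mem
  have n1 := norm_nonneg τ
  have n2 := norm_nonneg τ'
  have hT0 : 0 < T := by linarith
  have hT1 : 1 / (50 * T) ≤ 1 / 50 := one_div_le_one_div_of_le (by norm_num) (by linarith)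
  have i1 := Complex.abs_im_le_norm τ
  have i2 := Complex.abs_im_le_norm τ'
  have i3 := Complex.abs_im_le_norm lam
  have r1 : |τ.re| ≤ 1 := abs_le.2 ⟨by linarith, by linarith⟩
  have r2 : |τ'.re| ≤ 1 := abs_le.2 ⟨by linarith, by linarith⟩
  apply exp_half_le_re_cexp
  · have e1 := abs_le.1 (abs_mul_le_mul (a := (τ.re - 1) / 2) (X := 1)
      (abs_le.2 ⟨by linarith, by linarith⟩) hd)
    have e2 := abs_le.1 (abs_mul_le_mul (a := (τ'.re - 1) / 2) (X := 1)
      (abs_le.2 ⟨by linarith, by linarith⟩) hd')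
    have e3 := abs_le.1 (abs_mul_le_mul (a := τ.re - 1) (X := 2)
      (abs_le.2 ⟨by linarith, by linarith⟩) (ha.trans hT1))
    have e4 := abs_le.1 (abs_mul_le_mul (a := τ'.re - 1) (X := 2)
      (abs_le.2 ⟨by linarith, by linarith⟩) (ha'.trans hT1))
    have e5 := abs_le.1 (abs_mul_le_mul (a := (τ.re - τ'.re - 1) / 2) (X := 1)
      (abs_le.2 ⟨by linarith, by linarith⟩) hl₁)
    have e6 := abs_le.1 (abs_mul_le_mul (a := (-τ.re + τ'.re - 1) / 2) (X := 1)
      (abs_le.2 ⟨by linarith, by linarith⟩) hl₂)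
    have e7 := abs_le.1 (abs_mul_le_mul (a := (-τ.re - τ'.re - 1) / 2) (X := 1)
      (abs_le.2 ⟨by linarith, by linarith⟩) hl₃)
    simp [hlam]
    linarith [e1.1, e2.1, e3.1, e4.1, e5.1, e6.1, e7.1]
  · have hc : ∀ {x y w : ℝ}, |x| ≤ ‖τ‖ → |y| ≤ ‖τ'‖ → |w| ≤ ‖lam‖ → |x + y + w| ≤ 11 / 5 * T := by
      intro x y w hx hy hw
      have := abs_add_three x y w
      linarith
    have b1 := abs_le.1 (abs_mul_le_mul (hc i1 (by rwa [abs_neg] : |-τ'.im| ≤ _)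
      (by rwa [abs_neg] : |-lam.im| ≤ _)) hm₁)
    have b2 := abs_le.1 (abs_mul_le_mul (hc (by rwa [abs_neg] : |-τ.im| ≤ _) i2
      (by rwa [abs_neg] : |-lam.im| ≤ _)) hm₂)
    have b3 := abs_le.1 (abs_mul_le_mul (hc (by rwa [abs_neg] : |-τ.im| ≤ _)
      (by rwa [abs_neg] : |-τ'.im| ≤ _) i3) hm₃)
    have b4 := abs_le.1 (abs_mul_le_mul (i1.trans (by linarith : ‖τ‖ ≤ T)) ha)
    have b5 := abs_le.1 (abs_mul_le_mul (i2.trans (by linarith : ‖τ'‖ ≤ T)) ha')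
    have q1 : 11 / 5 * T * (1 / (50 * T)) = 11 / 250 := by field_simp; norm_num
    have q2 : T * (1 / (50 * T)) = 1 / 50 := by field_simp
    rw [q1] at b1 b2 b3
    rw [q2] at b4 b5
    rw [abs_le]
    simp
    constructor <;> linarith [b1.1, b2.1, b3.1, b4.1, b5.1, b1.2, b2.2, b3.2, b4.2, b5.2]

/-- The invariant of a perturbed basis vector and a vector of the open quadrant. -/
theorem abs_invariant_bounds {p q r s c d t δ : ℝ} (hp : |p| ≤ 1 / 100) (hq : |q - 1| ≤ 1 / 100)
    (hr : |r - 1| ≤ 1 / 100) (hs : |s| ≤ 1 / 100) (hc : 3 / 5 ≤ c) (hc' : c ≤ 1) (hd : 3 / 5 ≤ d)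
    (hd' : d ≤ 1) (ht : |t| ≤ δ) (hδ : δ ≤ 1 / 125) :
    (1 / 2 ≤ |(p + t * q) * d - (r + t * s) * c| ∧ |(p + t * q) * d - (r + t * s) * c| ≤ 2) ∧
      1 / 2 ≤ |p * d - r * c| ∧
      |(p + t * q) * d - (r + t * s) * c - (p * d - r * c)| ≤ 6 / 5 * δ := by
  have hδ0 : 0 ≤ δ := (abs_nonneg _).trans ht
  have hc1 : |c| ≤ 1 := abs_le.2 ⟨by linarith, hc'⟩
  have hd1 : |d| ≤ 1 := abs_le.2 ⟨by linarith, hd'⟩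
  have h1 := abs_le.1 (abs_mul_le_mul hp hd1)
  have h2 := abs_le.1 (abs_mul_le_mul hr hc1)
  have h3 : |q * d - s * c| ≤ 6 / 5 := by
    have h4 := abs_le.1 (abs_mul_le_mul hq hd1)
    have h5 := abs_le.1 (abs_mul_le_mul hs hc1)
    exact abs_le.2 ⟨by linarith [h4.1, h5.2], by linarith [h4.2, h5.1]⟩
  have h6 := abs_mul_le_mul ht h3
  have e : (p + t * q) * d - (r + t * s) * c - (p * d - r * c) = t * (q * d - s * c) := by ring
  have h7 := abs_le.1 h6
  refine ⟨⟨?_, ?_⟩, ?_, ?_⟩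
  · exact le_abs.2 (Or.inr (by linarith))
  · exact abs_le.2 ⟨by linarith, by linarith⟩
  · exact le_abs.2 (Or.inr (by linarith))
  · rw [e]
    linarith

/-- The invariant of two perturbed basis vectors. -/
theorem abs_invariant_bounds' {p q r s p' q' r' s' t t' δ : ℝ} (hp : |p| ≤ 1 / 100)
    (hq : |q - 1| ≤ 1 / 100) (hr : |r - 1| ≤ 1 / 100) (hs : |s| ≤ 1 / 100) (hp' : |p'| ≤ 1 / 100)
    (hq' : |q' - 1| ≤ 1 / 100) (hr' : |r' - 1| ≤ 1 / 100) (hs' : |s'| ≤ 1 / 100) (ht : |t| ≤ δ)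
    (ht' : |t'| ≤ δ) (hδ : δ ≤ 1 / 125) :
    (1 / 2 ≤ |(p + t * q) * (p' + t' * q') - (r + t * s) * (r' + t' * s')| ∧
      |(p + t * q) * (p' + t' * q') - (r + t * s) * (r' + t' * s')| ≤ 2) ∧
      1 / 2 ≤ |p * p' - r * r'| ∧
      |(p + t * q) * (p' + t' * q') - (r + t * s) * (r' + t' * s') - (p * p' - r * r')| ≤
        6 / 5 * δ := by
  have hδ0 : 0 ≤ δ := (abs_nonneg _).trans ht
  have one : ∀ {x : ℝ}, |x - 1| ≤ 1 / 100 → |x| ≤ 101 / 100 := fun h => by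
    have := abs_le.1 h
    exact abs_le.2 ⟨by linarith, by linarith⟩
  have a1 := abs_mul_le_mul ht (one hq)
  have a2 := abs_mul_le_mul ht' (one hq')
  have a3 := abs_mul_le_mul ht hs
  have a4 := abs_mul_le_mul ht' hs'
  have v1 : |p' + t' * q'| ≤ 2 / 100 := (abs_add_le _ _).trans (by linarith)
  have v2 : |r' + t' * s'| ≤ 102 / 100 := (abs_add_le _ _).trans (by linarith [one hr'])
  have c1 := abs_le.1 (abs_mul_le_mul a1 v1)
  have c2 := abs_le.1 (abs_mul_le_mul hp a2)
  have c3 := abs_le.1 (abs_mul_le_mul a3 v2)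
  have c4 := abs_le.1 (abs_mul_le_mul (one hr) a4)
  have c5 := abs_le.1 (abs_mul_le_mul hp hp')
  have c6 := abs_le.1 (abs_mul_le_mul hr hr')
  have c7 := abs_le.1 hr
  have c8 := abs_le.1 hr'
  have e : (p + t * q) * (p' + t' * q') - (r + t * s) * (r' + t' * s') - (p * p' - r * r') =
      t * q * (p' + t' * q') + p * (t' * q') - t * s * (r' + t' * s') - r * (t' * s') := by ring
  have h : |(p + t * q) * (p' + t' * q') - (r + t * s) * (r' + t' * s') - (p * p' - r * r')| ≤
      6 / 100 * δ := by
    rw [e]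
    exact abs_le.2 ⟨by linarith [c1.1, c2.1, c3.2, c4.2], by linarith [c1.2, c2.2, c3.1, c4.1]⟩
  have h' := abs_le.1 h
  refine ⟨⟨?_, ?_⟩, ?_, by linarith⟩
  · exact le_abs.2 (Or.inr (by linarith))
  · exact abs_le.2 ⟨by linarith, by linarith⟩
  · exact le_abs.2 (Or.inr (by linarith))

theorem abs_log_det_le_one {M : GL (Fin 2) ℝ} (hM : M ∈ PGL2R.nearOne) :
    |Real.log (M : Matrix (Fin 2) (Fin 2) ℝ).det| ≤ 1 := by
  have h00 := abs_le.1 (PGL2R.abs_diag_sub_one_le_of_mem_nearOne hM 0)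
  have h11 := abs_le.1 (PGL2R.abs_diag_sub_one_le_of_mem_nearOne hM 1)
  have h01 := PGL2R.abs_entry_le_of_mem_nearOne hM (show (0 : Fin 2) ≠ 1 by decide)
  have h10 := PGL2R.abs_entry_le_of_mem_nearOne hM (show (1 : Fin 2) ≠ 0 by decide)
  have h := abs_le.1 (abs_mul_le_mul h01 h10)
  have hd : |(M : Matrix (Fin 2) (Fin 2) ℝ).det - 1| ≤ 1 / 2 := by
    rw [Matrix.det_fin_two, abs_le]
    constructor <;> nlinarith
  have hd' := abs_le.1 hd
  exact abs_log_le_one (le_abs.2 (Or.inl (by linarith))) (abs_le.2 ⟨by linarith, by linarith⟩)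

theorem log_mulVec_circ_le_one {A : GL (Fin 2) ℝ} (hA : A ∈ PGL2R.nearOne) (θ : ℝ) (i : Fin 2) :
    Real.log ((A : Matrix (Fin 2) (Fin 2) ℝ).mulVec (circ θ) i) ≤ 1 := by
  set y := (A : Matrix (Fin 2) (Fin 2) ℝ).mulVec (circ θ) i with hy
  have hy2 : |y| ≤ 2 := by
    have h : ∀ j, |(A : Matrix (Fin 2) (Fin 2) ℝ) i j * circ θ j| ≤
        (if i = j then 101 / 100 else 1 / 100) * 1 := by
      intro j
      refine abs_mul_le_mul ?_ ?_
      · split_ifs with hij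
        · have := abs_le.1 (PGL2R.abs_diag_sub_one_le_of_mem_nearOne hA i)
          rw [← hij]
          exact abs_le.2 ⟨by linarith, by linarith⟩
        · exact PGL2R.abs_entry_le_of_mem_nearOne hA hij
      · fin_cases j
        exacts [Real.abs_cos_le_one θ, Real.abs_sin_le_one θ]
    have e : y = (A : Matrix (Fin 2) (Fin 2) ℝ) i 0 * circ θ 0 +
        (A : Matrix (Fin 2) (Fin 2) ℝ) i 1 * circ θ 1 := by
      rw [hy, Matrix.mulVec, dotProduct, Fin.sum_univ_two]
    rw [e]
    refine (abs_add_le _ _).trans ((add_le_add (h 0) (h 1)).trans ?_)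
    fin_cases i <;> norm_num
  rcases eq_or_ne y 0 with h0 | h0
  · rw [h0, Real.log_zero]
    exact zero_le_one
  · rw [← Real.log_abs]
    linarith [Real.log_le_sub_one_of_pos (abs_pos.2 h0)]

theorem log_sqrt_euclidSq {x : Plane} {i j : Fin 2} (hij : i ≠ j) (hj : x j ≠ 0) :
    Real.log (Real.sqrt (euclidSq x)) = Real.log (x j) + Real.log (1 + (x i / x j) ^ 2) / 2 := by
  have e : euclidSq x = x j ^ 2 * (1 + (x i / x j) ^ 2) := by
    have : euclidSq x = x i ^ 2 + x j ^ 2 := by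
      fin_cases i <;> fin_cases j <;> simp_all [euclidSq, add_comm]
    rw [this]
    field_simp
    ring
  rw [Real.log_sqrt (by unfold euclidSq; positivity), e,
    Real.log_mul (pow_ne_zero 2 hj) (by positivity), Real.log_pow]
  push_cast
  ring

theorem abs_log_one_add_sq_le {t T : ℝ} (hT : 1 ≤ T) (ht : |t| ≤ 1 / (125 * T)) :
    |Real.log (1 + t ^ 2) / 2| ≤ 1 / (50 * T) := by
  have h0 : 0 ≤ Real.log (1 + t ^ 2) := Real.log_nonneg (by nlinarith [sq_nonneg t])
  have h1 := Real.log_le_sub_one_of_pos (show 0 < 1 + t ^ 2 by positivity)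
  have h2 : |t| ≤ 1 := ht.trans (by
    rw [div_le_one (by positivity)]
    linarith)
  have h3 : t ^ 2 ≤ 1 / (125 * T) := by
    rw [← sq_abs]
    nlinarith [abs_nonneg t]
  have h4 : 1 / (125 * T) ≤ 1 / (50 * T) := one_div_le_one_div_of_le (by positivity) (by linarith)
  have h5 : 0 ≤ 1 / (125 * T) := by positivity
  rw [abs_of_nonneg (by positivity)]
  linarith

/-! ### Lower bound for the model forms -/

section ModLower

variable {τ τ' lam : ℂ}

theorem absPow_eq_exp_log {r : ℝ} (hr : r ≠ 0) (s : ℂ) :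
    absPow r s = Complex.exp (s * (Real.log r : ℝ)) := by
  rw [absPow_eq_exp hr, Real.log_abs]

/-- On a transform of a bump vector of size `1 / T`, the integrand of the model functional has a
nearly constant phase, and its absolute value is comparable with the transformed bump. -/
theorem exists_phase (hτ : IsClassOneParam τ) (hτ' : IsClassOneParam τ') (hlam : lam.re = 0) {T : ℝ}
    (hT : 5 * (‖τ‖ + ‖τ'‖) + 1 ≤ T) (hlamT : ‖lam‖ ≤ 2 * T) {A B : GL (Fin 2) ℝ}
    (hA : A ∈ PGL2R.nearOne) (hB : B ∈ PGL2R.nearOne) {z : ℝ} (hc : 3 / 5 ≤ Real.cos z)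
    (hs : 3 / 5 ≤ Real.sin z) : ∃ φ : ℝ, ∀ p : ℝ × ℝ,
      Real.exp (-10) / 2 * ((capMass (250 * T)⁻¹ ^ 2)⁻¹ *
        (lineCap 0 (250 * T)⁻¹ ((A : Matrix (Fin 2) (Fin 2) ℝ).mulVec (circ p.1)) *
          lineCap 1 (250 * T)⁻¹ ((B : Matrix (Fin 2) (Fin 2) ℝ).mulVec (circ p.2)))) ≤
      (Complex.exp (-(φ : ℂ) * Complex.I) *
        (E.onTorus (E.actGL A⁻¹ B⁻¹ (bumpVector τ τ' (250 * T)⁻¹)) p *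
          modKernel τ τ' lam (circ p.1) (circ p.2) (circ z))).re := by
  have n1 := norm_nonneg τ
  have n2 := norm_nonneg τ'
  have hT1 : 1 ≤ T := by linarith
  have hT0 : 0 < T := by linarith
  have hM := PGL2R.inv_mem_nearOne hA
  have hM' := PGL2R.inv_mem_nearOne hB
  set M : Matrix (Fin 2) (Fin 2) ℝ := ((A⁻¹ : GL (Fin 2) ℝ) : Matrix (Fin 2) (Fin 2) ℝ) with hMdef
  set M' : Matrix (Fin 2) (Fin 2) ℝ := ((B⁻¹ : GL (Fin 2) ℝ) : Matrix (Fin 2) (Fin 2) ℝ) with hMdef'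
  set σ := (250 * T)⁻¹ with hσdef
  have hσ : 0 < σ := by positivity
  have hσ1 : σ ≤ 1 / 250 := by
    rw [hσdef, ← one_div]
    exact one_div_le_one_div_of_le (by norm_num) (by linarith)
  have hσ2 : 2 * σ = 1 / (125 * T) := by
    rw [hσdef]
    field_simp
    norm_num
  refine ⟨(τ.im * Real.log M.det + τ'.im * Real.log M'.det + (τ.im - τ'.im - lam.im) *
    Real.log (M' 1 0 * Real.cos z - M' 0 0 * Real.sin z) + (-τ.im + τ'.im - lam.im) *
    Real.log (M 0 1 * Real.sin z - M 1 1 * Real.cos z) + (-τ.im - τ'.im + lam.im) *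
    Real.log (M 0 1 * M' 1 0 - M 1 1 * M' 0 0)) / 2, fun p => ?_⟩
  set x := (A : Matrix (Fin 2) (Fin 2) ℝ).mulVec (circ p.1) with hxdef
  set y := (B : Matrix (Fin 2) (Fin 2) ℝ).mulVec (circ p.2) with hydef
  have hx : x ≠ 0 := mulVec_ne_zero A (circ_ne_zero _)
  have hy : y ≠ 0 := mulVec_ne_zero B (circ_ne_zero _)
  have hG : E.onTorus (E.actGL A⁻¹ B⁻¹ (bumpVector τ τ' σ)) p =
      (absPow M.det ((τ - 1) / 2) * absPow M'.det ((τ' - 1) / 2)) *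
        (((capMass σ ^ 2)⁻¹ : ℝ) * ((absPow (Real.sqrt (euclidSq x)) (τ - 1) * lineCap 0 σ x) *
          (absPow (Real.sqrt (euclidSq y)) (τ' - 1) * lineCap 1 σ y))) := by
    rw [onTorus_actGL_inv, ← capVector_apply τ 0 σ hx, ← capVector_apply τ' 1 σ hy]
    rfl
  rw [hG]
  by_cases h0 : lineCap 0 σ x = 0
  · simp [h0]
  by_cases h1 : lineCap 1 σ y = 0
  · simp [h1]
  obtain ⟨hx1, ht⟩ := abs_div_le_of_lineCap_ne_zero (show (0 : Fin 2) ≠ 1 by decide) hσ hσ1 hx h0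
  obtain ⟨hy0, ht'⟩ := abs_div_le_of_lineCap_ne_zero (show (1 : Fin 2) ≠ 0 by decide) hσ hσ1 hy h1
  have eE := log_sqrt_euclidSq (x := x) (show (0 : Fin 2) ≠ 1 by decide) hx1
  have eE' := log_sqrt_euclidSq (x := y) (show (1 : Fin 2) ≠ 0 by decide) hy0
  have hE : Real.sqrt (euclidSq x) ≠ 0 := (Real.sqrt_pos.2 (euclidSq_pos hx)).ne'
  have hE' : Real.sqrt (euclidSq y) ≠ 0 := (Real.sqrt_pos.2 (euclidSq_pos hy)).ne'
  set t := x 0 / x 1 with htdef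
  set t' := y 1 / y 0 with htdef'
  have hx0 : x 0 = t * x 1 := (div_mul_cancel₀ _ hx1).symm
  have hy1 : y 1 = t' * y 0 := (div_mul_cancel₀ _ hy0).symm
  have hξ : circ p.1 = M.mulVec x := by
    rw [hxdef, hMdef, Matrix.mulVec_mulVec, ← Units.val_mul, inv_mul_cancel, Units.val_one,
      Matrix.one_mulVec]
  have hη : circ p.2 = M'.mulVec y := by
    rw [hydef, hMdef', Matrix.mulVec_mulVec, ← Units.val_mul, inv_mul_cancel, Units.val_one,
      Matrix.one_mulVec]
  have hξ0 : circ p.1 0 = x 1 * (M 0 1 + t * M 0 0) := by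
    rw [hξ, Matrix.mulVec, dotProduct, Fin.sum_univ_two, hx0]
    ring
  have hξ1 : circ p.1 1 = x 1 * (M 1 1 + t * M 1 0) := by
    rw [hξ, Matrix.mulVec, dotProduct, Fin.sum_univ_two, hx0]
    ring
  have hη0 : circ p.2 0 = y 0 * (M' 0 0 + t' * M' 0 1) := by
    rw [hη, Matrix.mulVec, dotProduct, Fin.sum_univ_two, hy1]
    ring
  have hη1 : circ p.2 1 = y 0 * (M' 1 0 + t' * M' 1 1) := by
    rw [hη, Matrix.mulVec, dotProduct, Fin.sum_univ_two, hy1]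
    ring
  have d0 : |M 0 0 - 1| ≤ 1 / 100 := PGL2R.abs_diag_sub_one_le_of_mem_nearOne hM 0
  have d1 : |M 1 1 - 1| ≤ 1 / 100 := PGL2R.abs_diag_sub_one_le_of_mem_nearOne hM 1
  have f0 : |M 0 1| ≤ 1 / 100 :=
    PGL2R.abs_entry_le_of_mem_nearOne hM (show (0 : Fin 2) ≠ 1 by decide)
  have f1 : |M 1 0| ≤ 1 / 100 :=
    PGL2R.abs_entry_le_of_mem_nearOne hM (show (1 : Fin 2) ≠ 0 by decide)
  have d0' : |M' 0 0 - 1| ≤ 1 / 100 := PGL2R.abs_diag_sub_one_le_of_mem_nearOne hM' 0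
  have d1' : |M' 1 1 - 1| ≤ 1 / 100 := PGL2R.abs_diag_sub_one_le_of_mem_nearOne hM' 1
  have f0' : |M' 0 1| ≤ 1 / 100 :=
    PGL2R.abs_entry_le_of_mem_nearOne hM' (show (0 : Fin 2) ≠ 1 by decide)
  have f1' : |M' 1 0| ≤ 1 / 100 :=
    PGL2R.abs_entry_le_of_mem_nearOne hM' (show (1 : Fin 2) ≠ 0 by decide)
  have hδ : 2 * σ ≤ 1 / 125 := by linarith
  obtain ⟨⟨u1, v1⟩, w1, x1⟩ := abs_invariant_bounds f1' d1' d0' f0' hs (Real.sin_le_one z) hc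
    (Real.cos_le_one z) ht' hδ
  obtain ⟨⟨u2, v2⟩, w2, x2⟩ := abs_invariant_bounds f0 d0 d1 f1 hc (Real.cos_le_one z) hs
    (Real.sin_le_one z) ht hδ
  obtain ⟨⟨u3, v3⟩, w3, x3⟩ := abs_invariant_bounds' f0 d0 d1 f1 f1' d1' d0' f0' ht ht' hδ
  have o1 : omega (circ p.2) (circ z) = y 0 * -((M' 1 0 + t' * M' 1 1) * Real.cos z -
      (M' 0 0 + t' * M' 0 1) * Real.sin z) := by
    rw [omega, hη0, hη1]
    simp only [circ, Matrix.cons_val_zero, Matrix.cons_val_one]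
    ring
  have o2 : omega (circ p.1) (circ z) = x 1 * ((M 0 1 + t * M 0 0) * Real.sin z -
      (M 1 1 + t * M 1 0) * Real.cos z) := by
    rw [omega, hξ0, hξ1]
    simp only [circ, Matrix.cons_val_zero, Matrix.cons_val_one]
    ring
  have o3 : omega (circ p.1) (circ p.2) = x 1 * y 0 * ((M 0 1 + t * M 0 0) *
      (M' 1 0 + t' * M' 1 1) - (M 1 1 + t * M 1 0) * (M' 0 0 + t' * M' 0 1)) := by
    rw [omega, hξ0, hξ1, hη0, hη1]
    ring
  have nz : ∀ {r : ℝ}, 1 / 2 ≤ |r| → r ≠ 0 := fun h h0 => by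
    rw [h0, abs_zero] at h
    norm_num at h
  have hlog : ∀ {r s : ℝ}, 1 / 2 ≤ |r| → 1 / 2 ≤ |s| → |r - s| ≤ 6 / 5 * (2 * σ) →
      |Real.log r - Real.log s| ≤ 1 / (50 * T) := by
    intro r s hr hs hrs
    refine (abs_log_sub_log_le hr hs).trans ?_
    rw [hσ2] at hrs
    calc 2 * |r - s| ≤ 2 * (6 / 5 * (1 / (125 * T))) := by gcongr
      _ = 12 / 625 * (1 / T) := by ring
      _ ≤ 1 / 50 * (1 / T) := mul_le_mul_of_nonneg_right (by norm_num) (by positivity)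
      _ = 1 / (50 * T) := by ring
  rw [hσ2] at ht ht'
  have hD : |Real.log M.det| ≤ 1 := abs_log_det_le_one hM
  have hD' : |Real.log M'.det| ≤ 1 := abs_log_det_le_one hM'
  have key := exp_le_re_cexp_trilinear hτ hτ' hlam hT hlamT hD hD'
    (log_mulVec_circ_le_one hA p.1 1)
    (log_mulVec_circ_le_one hB p.2 0) (abs_log_one_add_sq_le hT1 ht)
    (abs_log_one_add_sq_le hT1 ht') (abs_log_le_one u1 v1) (abs_log_le_one u2 v2)
    (abs_log_le_one u3 v3) (hlog u1 w1 x1) (hlog u2 w2 x2) (hlog u3 w3 x3)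
  -- The logarithms of the scale factors `x 1`, `y 0` recombine with those of the reduced
  -- invariants.
  have L1 : Real.log (y 0) + Real.log ((M' 1 0 + t' * M' 1 1) * Real.cos z -
      (M' 0 0 + t' * M' 0 1) * Real.sin z) = Real.log (omega (circ p.2) (circ z)) := by
    rw [o1, Real.log_mul hy0 (neg_ne_zero.2 (nz u1)), Real.log_neg_eq_log]
  have L2 : Real.log (x 1) + Real.log ((M 0 1 + t * M 0 0) * Real.sin z -
      (M 1 1 + t * M 1 0) * Real.cos z) = Real.log (omega (circ p.1) (circ z)) := by
    rw [o2, Real.log_mul hx1 (nz u2)]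
  have L3 : Real.log (x 1) + Real.log (y 0) + Real.log ((M 0 1 + t * M 0 0) *
      (M' 1 0 + t' * M' 1 1) - (M 1 1 + t * M 1 0) * (M' 0 0 + t' * M' 0 1)) =
      Real.log (omega (circ p.1) (circ p.2)) := by
    rw [o3, Real.log_mul (mul_ne_zero hx1 hy0) (nz u3), Real.log_mul hx1 hy0]
  rw [← hxdef, ← hydef, ← eE, ← eE', L1, L2, L3] at key
  have hω1 : omega (circ p.2) (circ z) ≠ 0 := by
    rw [o1]
    exact mul_ne_zero hy0 (neg_ne_zero.2 (nz u1))
  have hω2 : omega (circ p.1) (circ z) ≠ 0 := by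
    rw [o2]
    exact mul_ne_zero hx1 (nz u2)
  have hω3 : omega (circ p.1) (circ p.2) ≠ 0 := by
    rw [o3]
    exact mul_ne_zero (mul_ne_zero hx1 hy0) (nz u3)
  rw [modKernel, absPow_eq_exp_log hω1, absPow_eq_exp_log hω2, absPow_eq_exp_log hω3,
    absPow_eq_exp_log hE, absPow_eq_exp_log hE',
    absPow_eq_exp_log (show M.det ≠ 0 from det_coe_ne_zero A⁻¹),
    absPow_eq_exp_log (show M'.det ≠ 0 from det_coe_ne_zero B⁻¹)]
  -- All powers are exponentials, so the integrand is the transformed bump times the exponential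
  -- whose real part is bounded below in `key`.
  rw [mul_comm (Real.exp (-10) / 2)]
  have hβ : 0 ≤ (capMass σ ^ 2)⁻¹ * (lineCap 0 σ x * lineCap 1 σ y) :=
    mul_nonneg (by positivity) (mul_nonneg (lineCap_nonneg _ _ _) (lineCap_nonneg _ _ _))
  refine (mul_le_mul_of_nonneg_left key hβ).trans (le_of_eq ?_)
  rw [← Complex.re_ofReal_mul]
  congr 1
  simp only [Complex.exp_add, Complex.ofReal_mul]
  ring

theorem norm_exp_mul (φ : ℝ) (w : ℂ) : ‖Complex.exp (-(φ : ℂ) * Complex.I) * w‖ = ‖w‖ := by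
  rw [norm_mul, ← Complex.ofReal_neg, Complex.norm_exp_ofReal_mul_I, one_mul]

theorem setIntegral_lineCap_mulVec_ge {A B : GL (Fin 2) ℝ} (hA : A ∈ PGL2R.nearOne)
    (hB : B ∈ PGL2R.nearOne) {σ : ℝ} (hσ : 0 < σ) (hσ1 : σ ≤ 1 / 250) :
    1 / 49 ≤ ∫ p in square, (capMass σ ^ 2)⁻¹ *
      (lineCap 0 σ ((A : Matrix (Fin 2) (Fin 2) ℝ).mulVec (circ p.1)) *
        lineCap 1 σ ((B : Matrix (Fin 2) (Fin 2) ℝ).mulVec (circ p.2))) := by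
  rw [integral_const_mul, volume_restrict_square,
    integral_prod_mul (fun x => lineCap 0 σ ((A : Matrix (Fin 2) (Fin 2) ℝ).mulVec (circ x)))
      (fun y => lineCap 1 σ ((B : Matrix (Fin 2) (Fin 2) ℝ).mulVec (circ y)))]
  have h1 := le_setIntegral_lineCap_mulVec hA 0 hσ hσ1
  have h2 := le_setIntegral_lineCap_mulVec hB 1 hσ hσ1
  have h3 := le_capMass hσ (by linarith)
  have h4 := capMass_le hσ
  have h5 : 0 < capMass σ := by linarith
  have h6 : capMass σ ^ 2 ≤ (7 * σ) ^ 2 := by gcongr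
  have h7 := mul_le_mul h1 h2 hσ.le (hσ.le.trans h1)
  rw [inv_mul_eq_div, le_div_iff₀ (by positivity)]
  refine le_trans ?_ h7
  nlinarith

/-- The model operator is bounded below on the transforms of a bump vector of size `1 / T`, uniformly
in the parameters, as long as `lam` is at most `2 T` and the angle `z` is away from both lines. -/
theorem le_norm_modOp (hτ : IsClassOneParam τ) (hτ' : IsClassOneParam τ') (hlam : lam.re = 0)
    {T : ℝ} (hT : 5 * (‖τ‖ + ‖τ'‖) + 1 ≤ T) (hlamT : ‖lam‖ ≤ 2 * T) {A B : GL (Fin 2) ℝ}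
    (hA : A ∈ PGL2R.nearOne) (hB : B ∈ PGL2R.nearOne) {z : ℝ} (hc : 3 / 5 ≤ Real.cos z)
    (hs : 3 / 5 ≤ Real.sin z) :
    ((2 * Real.pi) ^ 2)⁻¹ * (Real.exp (-10) / 2 * (1 / 49)) ≤
      ‖modOp lam (E.actGL A⁻¹ B⁻¹ (bumpVector τ τ' (250 * T)⁻¹)) z‖ := by
  have n1 := norm_nonneg τ
  have n2 := norm_nonneg τ'
  have hT1 : 1 ≤ T := by linarith
  have hσ : 0 < (250 * T)⁻¹ := by positivity
  have hσ1 : (250 * T)⁻¹ ≤ 1 / 250 := by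
    rw [← one_div]
    exact one_div_le_one_div_of_le (by norm_num) (by linarith)
  obtain ⟨φ, hφ⟩ := exists_phase hτ hτ' hlam hT hlamT hA hB hc hs
  have hint := integrableOn_mul_modKernel hτ hτ' hlam
    (E.actGL A⁻¹ B⁻¹ (bumpVector τ τ' (250 * T)⁻¹)) z
  set σ := (250 * T)⁻¹
  rw [modOp, norm_mul, Complex.norm_real, Real.norm_of_nonneg (by positivity)]
  refine mul_le_mul_of_nonneg_left ?_ (by positivity)
  rw [← norm_exp_mul φ, ← integral_const_mul]
  refine le_trans ?_ (Complex.re_le_norm _)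
  have hre := integral_re (hint.const_mul (Complex.exp (-(φ : ℂ) * Complex.I)))
  simp only [RCLike.re_to_complex] at hre
  rw [← hre]
  refine (mul_le_mul_of_nonneg_left (setIntegral_lineCap_mulVec_ge hA hB hσ hσ1)
    (by positivity)).trans ?_
  rw [← integral_const_mul]
  refine setIntegral_mono_on ?_ (hint.const_mul _).re isCompact_square.measurableSet fun p _ => hφ p
  refine (Continuous.continuousOn ?_).integrableOn_compact isCompact_square
  exact continuous_const.mul (continuous_const.mul
    (((continuous_lineCap_mulVec A 0 hσ.ne').comp continuous_fst).mul
      ((continuous_lineCap_mulVec B 1 hσ.ne').comp continuous_snd)))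

theorem cos_sin_ge_of_mem {z : ℝ} (hz : z ∈ Set.Icc (Real.pi / 4 - 1 / 20) (Real.pi / 4 + 1 / 20)) :
    3 / 5 ≤ Real.cos z ∧ 3 / 5 ≤ Real.sin z := by
  obtain ⟨w, rfl⟩ : ∃ w, z = Real.pi / 4 + w := ⟨z - Real.pi / 4, by ring⟩
  have hw : |w| ≤ 1 / 20 := abs_le.2 ⟨by linarith [hz.1], by linarith [hz.2]⟩
  have h1 := abs_le.1 ((Real.abs_sin_le_abs (x := w)).trans hw)
  have h2 := Real.one_sub_sq_div_two_le_cos (x := w)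
  have h3 : w ^ 2 ≤ (1 / 20) ^ 2 := sq_le_sq' (abs_le.1 hw).1 (abs_le.1 hw).2
  have h4 : 7 / 5 ≤ Real.sqrt 2 := Real.le_sqrt_of_sq_le (by norm_num)
  rw [Real.cos_add, Real.sin_add, Real.cos_pi_div_four, Real.sin_pi_div_four]
  constructor <;> nlinarith

/-- The lower bound for the model forms on the transforms of bump vectors: the square of the bound
`le_norm_modOp`, integrated over an interval of length `1 / 10` around `π / 4`. -/
def modLower : ℝ :=
  (2 * Real.pi)⁻¹ * (1 / 10 * (((2 * Real.pi) ^ 2)⁻¹ * (Real.exp (-10) / 2 * (1 / 49))) ^ 2)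

theorem modLower_pos : 0 < modLower := by
  have := Real.pi_pos
  unfold modLower
  positivity

theorem modLower_le_modForm (hτ : IsClassOneParam τ) (hτ' : IsClassOneParam τ') (hlam : lam.re = 0)
    {T : ℝ} (hT : 5 * (‖τ‖ + ‖τ'‖) + 1 ≤ T) (hlamT : ‖lam‖ ≤ 2 * T) {A B : GL (Fin 2) ℝ}
    (hA : A ∈ PGL2R.nearOne) (hB : B ∈ PGL2R.nearOne) :
    modLower ≤ modForm τ τ' lam (E.actGL A⁻¹ B⁻¹ (bumpVector τ τ' (250 * T)⁻¹)) := by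
  have hpi := Real.pi_gt_three
  set u : E τ τ' := E.actGL A⁻¹ B⁻¹ (bumpVector τ τ' (250 * T)⁻¹) with hu
  obtain ⟨K, hK⟩ := (E.biperiodic_onTorus u).exists_bound (E.contDiff_onTorus u).continuous
  obtain ⟨C, hC⟩ := exists_norm_modOp_le hτ hτ' hlam
  have hi : ∀ a b : ℝ, IntegrableOn (fun z => ‖modOp lam u z‖ ^ 2) (Set.Icc a b) := fun a b => by
    refine Measure.integrableOn_of_bounded (M := (C * K) ^ 2) (by simp)
      ((measurable_modOp u).norm.pow_const 2).aestronglyMeasurable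
      (Filter.Eventually.of_forall fun z => ?_)
    rw [Real.norm_of_nonneg (by positivity)]
    have := hC u K hK z
    gcongr
  set c := ((2 * Real.pi) ^ 2)⁻¹ * (Real.exp (-10) / 2 * (1 / 49)) with hcdef
  have hc0 : 0 ≤ c := by positivity
  rw [modLower, modForm]
  refine mul_le_mul_of_nonneg_left ?_ (by positivity)
  calc 1 / 10 * c ^ 2 =
      ∫ z in Set.Icc (Real.pi / 4 - 1 / 20) (Real.pi / 4 + 1 / 20), c ^ 2 := by
        rw [integral_const, smul_eq_mul, measureReal_restrict_apply_univ,
          Real.volume_real_Icc_of_le (by linarith)]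
        ring
    _ ≤ ∫ z in Set.Icc (Real.pi / 4 - 1 / 20) (Real.pi / 4 + 1 / 20), ‖modOp lam u z‖ ^ 2 := by
        refine setIntegral_mono_on (integrableOn_const (by simp)) (hi _ _) measurableSet_Icc
          fun z hz => ?_
        obtain ⟨h1, h2⟩ := cos_sin_ge_of_mem hz
        have := le_norm_modOp hτ hτ' hlam hT hlamT hA hB h1 h2
        gcongr
    _ ≤ ∫ z in Set.Icc 0 (2 * Real.pi), ‖modOp lam u z‖ ^ 2 := by
        exact setIntegral_mono_set (hi _ _) (Filter.Eventually.of_forall fun z => sq_nonneg _)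
          (Set.Icc_subset_Icc (by linarith) (by linarith)).eventuallyLE

/-- The functionals defined by the bump vectors are bounded below on the model forms. -/
theorem exists_le_smoothedValue_modForm (m : Measure PGL2R) [m.IsHaarMeasure] :
    ∃ c > 0, ∀ τ τ' lam : ℂ, IsClassOneParam τ → IsClassOneParam τ' → lam.re = 0 → ∀ T : ℝ,
      5 * (‖τ‖ + ‖τ'‖) + 1 ≤ T → ‖lam‖ ≤ 2 * T → ENNReal.ofReal c ≤
        smoothedValue m PGL2R.bump₂ (bumpVector τ τ' (250 * T)⁻¹) (modForm τ τ' lam) := by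
  set W : Set PGL2R := PGL2R.mk '' PGL2R.nearOne with hW
  have hWo : IsOpen W := PGL2R.isOpenQuotientMap_mk.isOpenMap _ PGL2R.isOpen_nearOne
  have hW0 : m W ≠ 0 :=
    (hWo.measure_pos m ⟨_, Set.mem_image_of_mem _ PGL2R.one_mem_nearOne⟩).ne'
  have hpos : ENNReal.ofReal modLower * (m W * m W) ≠ 0 :=
    mul_ne_zero (ENNReal.ofReal_pos.2 modLower_pos).ne' (mul_ne_zero hW0 hW0)
  obtain ⟨c, hc, hc'⟩ : ∃ c : ℝ, 0 < c ∧
      ENNReal.ofReal c ≤ ENNReal.ofReal modLower * (m W * m W) := by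
    obtain ⟨r, h0, h1⟩ := ENNReal.lt_iff_exists_nnreal_btwn.1 (pos_iff_ne_zero.2 hpos)
    refine ⟨r, by exact_mod_cast h0, ?_⟩
    rw [ENNReal.ofReal_coe_nnreal]
    exact h1.le
  refine ⟨c, hc, fun τ τ' lam hτ hτ' hlam T hT hlamT => hc'.trans ?_⟩
  rw [← Measure.prod_prod, ← setLIntegral_const]
  refine le_trans ?_ (setLIntegral_le_lintegral (W ×ˢ W) _)
  refine setLIntegral_mono' (hWo.prod hWo).measurableSet ?_
  rintro ⟨_, _⟩ ⟨⟨A, hA, rfl⟩, ⟨B, hB, rfl⟩⟩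
  refine ENNReal.ofReal_le_ofReal ?_
  have e : E.act (PGL2R.mk A, PGL2R.mk B)⁻¹ (bumpVector τ τ' (250 * T)⁻¹) =
      E.actGL A⁻¹ B⁻¹ (bumpVector τ τ' (250 * T)⁻¹) := by
    rw [← E.act_mk, map_inv, map_inv]
    rfl
  rw [e, PGL2R.bump₂, PGL2R.bump_eq_one hA, PGL2R.bump_eq_one hB, one_mul, one_mul]
  exact modLower_le_modForm hτ hτ' hlam hT hlamT hA hB

end ModLower

end TripleProduct

end

theorem mainTheorem4 (Γ : Subgroup PGL2R) [DiscreteTopology Γ] [CompactSpace (AutSpace Γ)]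
    (μ : Measure (AutSpace Γ)) [IsProbabilityMeasure μ]
    (hμ : ∀ g : PGL2R, μ.map (AutSpace.translate g) = μ)
    (m : Measure PGL2R) [m.IsHaarMeasure] :
    ∃ h : PGL2R × PGL2R → ℝ,
      PGL2R.Smooth₂ h ∧ HasCompactSupport h ∧ (∀ g, 0 ≤ h g) ∧
      ∃ C > 0, ∃ c > 0,
        ∀ τ τ' : ℂ, IsClassOneParam τ → IsClassOneParam τ' →
        ∀ (ν : EnhancedRep μ τ) (ν' : EnhancedRep μ τ'),
        ∃ N : E τ τ' →ₗ[ℂ] (AutSpace Γ × AutSpace Γ → ℂ), IsRealisation ν ν' N ∧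
        ∃ (hdiag : diagForm μ N ∈ hermCone τ τ')
          (hmod : ∀ lam : ℂ, lam.re = 0 → modForm τ τ' lam ∈ hermCone τ τ'),
        ∃ T₀ > 0, ∀ T : ℝ, T₀ ≤ T →
          ∃ ρ : PositiveFunctional τ τ',
            (∃ u : E τ τ', IsBump T u ∧
              ∀ H : hermCone τ τ', ρ H = smoothedValue m h u H.1) ∧
            ρ ⟨diagForm μ N, hdiag⟩ ≤ ENNReal.ofReal (C * T ^ 2) ∧
            ∀ (lam : ℂ) (hlam : lam.re = 0), ‖lam‖ ≤ 2 * T →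
              ENNReal.ofReal c ≤ ρ ⟨modForm τ τ' lam, hmod lam hlam⟩ := by
  obtain ⟨C, hC, hdiagC⟩ := exists_smoothedValue_diagForm_le hμ m PGL2R.continuous_bump₂
    PGL2R.hasCompactSupport_bump₂
  obtain ⟨c, hc, hmodc⟩ := exists_le_smoothedValue_modForm m
  refine ⟨PGL2R.bump₂, PGL2R.smooth₂_bump₂, PGL2R.hasCompactSupport_bump₂, PGL2R.bump₂_nonneg,
    C.toReal * 10 ^ 5 + 1, by positivity, c, hc, fun τ τ' hτ hτ' ν ν' => ?_⟩
  -- From this `T₀` on, `‖τ‖ + ‖τ'‖ ≤ T / 5`, as the estimate of the phase requires.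
  refine ⟨realisation ν ν', isRealisation_realisation ν ν', diagForm_mem_hermCone ν ν',
    fun lam hlam => modForm_mem_hermCone hτ hτ' hlam, 5 * (‖τ‖ + ‖τ'‖) + 1, by positivity,
    fun T hT => ?_⟩
  have hT1 : 1 ≤ T := by linarith [norm_nonneg τ, norm_nonneg τ']
  have hbump := isBump_bumpVector τ τ' hT1
  refine ⟨smoothedFunctional m PGL2R.continuous_bump₂ PGL2R.bump₂_nonneg
    (bumpVector τ τ' (250 * T)⁻¹), ⟨_, hbump, fun _ => rfl⟩, ?_, fun lam hlam hlamT =>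
      hmodc τ τ' lam hτ hτ' hlam T hT hlamT⟩
  refine (hdiagC hτ hτ' ν ν' (bumpVector τ τ' (250 * T)⁻¹)).trans ?_
  rw [← ENNReal.ofReal_toReal hC, ← ENNReal.ofReal_mul ENNReal.toReal_nonneg]
  refine ENNReal.ofReal_le_ofReal ?_
  have h := mul_le_mul_of_nonneg_left hbump.norm_le (ENNReal.toReal_nonneg (a := C))
  rw [ENNReal.toReal_ofReal ENNReal.toReal_nonneg]
  nlinarith [sq_nonneg T]
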